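/- Let $\mathbf x_t=[(\mathbf x^1_t)^{\mathrm T},(\mathbf x^2_t)^{\mathrm T}]^{\mathrm T}$, $\mathbf x^1_t\in\mathbb R^n$, $\mathbf x^2_t\in\mathbb R^m$, $t=1,2,\dots$, obey $\mathbf x_{t+1}=\mathbf A\mathbf x_t+\mathbf B\mathbf u_t+\mathbf w_t$, where $\mathbf A=\begin{bmatrix}\mathbf A_{11}&\mathbf A_{12}\\ \mathbf A_{21}&\mathbf A_{22}\end{bmatrix}$ and the $\mathbf w_t\sim\mathcal N(\mathbf 0,\mathrm{diag}(\mathbf W_{11},\mathbf W_{22}))$ are IID with $\mathbf W_{11},\mathbf W_{22}\succ0$. Fix a sensor matrix $\mathbf C_1\in\mathbb R^{n\times n}$ such that $\left(\begin{bmatrix}\mathbf C_1\\ \mathbf A_{21}\end{bmatrix},\mathbf A_{11}\right)$ is detectable, and a gain $\mathbf K$ (arbitrary; in particular the certainty-equivalence LQG gain). Consider two feedback systems, both with $\mathbf u_t=\mathbf K[(\hat{\mathbf x}^1_t)^{\mathrm T},(\mathbf x^2_t)^{\mathrm T}]^{\mathrm T}$. Gaussian system (G): $\mathbf x_1$ is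 Gaussian, $\mathbf y_t=\mathbf C_1\mathbf x^1_t+\mathbf v_t$ with $\mathbf v_t\sim\mathcal N(\mathbf 0,\mathbf I)$ IID, $\tilde{\mathbf x}^1_t=\mathbb E[\mathbf x^1_t\mid\mathbf x^2_{1:t},\mathbf y_{1:t-1}]$, $\hat{\mathbf x}^1_t=\mathbb E[\mathbf x^1_t\mid\mathbf x^2_{1:t},\mathbf y_{1:t}]$; $\mathbf x_1$, $\{\mathbf w_t\}$, $\{\mathbf v_t\}$ are independent. Quantized system (NG): $\mathbf x_1$ is any random vector with finite second moments; with $\Delta=2\sqrt3$ and a dither $\mathbf d_t\in\mathbb R^n$ whose coordinates are IID (over coordinates and $t$) uniform on $[-\Delta/2,\Delta/2)$, $\mathbf y_t=\mathbf q_\Delta\big(\mathbf C_1(\mathbf x^1_t-\tilde{\mathbf x}^1_t)+\mathbf d_t\big)-\mathbf d_t$, where $\mathbf q_\Delta$ rounds each coordinate lying in $[j\Delta-\Delta/2,j\Delta+\Delta/2)$, $j\in\mathbb Z$, to $j\Delta$; $\tilde{\mathbf x}^1_t$ and $\hat{\mathbf x}^1_t$ are the linear (affine) minimum mean squared error estimates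 of $\mathbf x^1_t$ given $(\mathbf x^2_{1:t},\mathbf y_{1:t-1})$ and $(\mathbf x^2_{1:t},\mathbf y_{1:t})$ respectively; $\mathbf x_1$, $\{\mathbf w_t\}$, $\{\mathbf d_t\}$ are independent. (i) If $\mathbf x^{\mathrm{NG}}_1$ and $\mathbf x^{\mathrm G}_1$ have identical first and second moments, then the processes $\{\xi_t\}=\{(\mathbf x_t,\hat{\mathbf x}^1_t,\tilde{\mathbf x}^1_t)\}$ of the two systems are equivalent up to second moments: they are square integrable and $\mathbb E[\xi^{\mathrm{NG}}_t]=\mathbb E[\xi^{\mathrm G}_t]$ and $\mathbb E[\xi^{\mathrm{NG}}_s(\xi^{\mathrm{NG}}_t)^{\mathrm T}]=\mathbb E[\xi^{\mathrm G}_s(\xi^{\mathrm G}_t)^{\mathrm T}]$ for all $s,t$. (ii) There is exactly one pair $\hat{\mathbf P},\tilde{\mathbf P}\succ0$ with $\hat{\mathbf P}^{-1}=\tilde{\mathbf P}^{-1}+\mathbf C_1^{\mathrm T}\mathbf C_1$ and $\tilde{\mathbf P}=\mathbf W_{11}+\mathbf A_{11}(\hat{\mathbf P}^{-1}+\mathbf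 A_{21}^{\mathrm T}\mathbf W_{22}^{-1}\mathbf A_{21})^{-1}\mathbf A_{11}^{\mathrm T}$. Regardless of the initial condition, the estimation error $\mathbf x^1_t-\hat{\mathbf x}^1_t$ is square integrable for every $t$ and $\mathbb E[(\mathbf x^1_t-\hat{\mathbf x}^1_t)(\mathbf x^1_t-\hat{\mathbf x}^1_t)^{\mathrm T}]\to\hat{\mathbf P}$ as $t\to\infty$, in every Gaussian system and in every quantized system. -/

import Mathlib

open MeasureTheory ProbabilityTheory Filter Topology Matrix

noncomputable section

namespace LQGSideInfo

/-! ### Moments of random vectors -/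

/-- The matrix `E[X Yᵀ]`. -/
def crossMoment {Ω ι κ : Type*} [MeasurableSpace Ω] (μ : Measure Ω)
    (X : Ω → EuclideanSpace ℝ ι) (Y : Ω → EuclideanSpace ℝ κ) : Matrix ι κ ℝ :=
  Matrix.of fun i j => ∫ ω, X ω i * Y ω j ∂μ

/-- The vector `E[X]`. -/
def mean {Ω ι : Type*} [MeasurableSpace Ω] (μ : Measure Ω)
    (X : Ω → EuclideanSpace ℝ ι) : ι → ℝ :=
  fun i => ∫ ω, X ω i ∂μ

/-- Two random vectors (possibly on different probability spaces) have finite and identical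
first and second moments. -/
def SameMoments {Ω Ω' ι : Type*} [MeasurableSpace Ω] [MeasurableSpace Ω'] [Fintype ι]
    (μ : Measure Ω) (μ' : Measure Ω')
    (X : Ω → EuclideanSpace ℝ ι) (X' : Ω' → EuclideanSpace ℝ ι) : Prop :=
  MemLp X 2 μ ∧ MemLp X' 2 μ' ∧ mean μ X = mean μ' X' ∧
    crossMoment μ X X = crossMoment μ' X' X'

/-- Two vector valued processes are equivalent up to second moments: they are square integrable,
have the same mean function and the same correlation function `(s, t) ↦ E[ξ_s ξ_tᵀ]`. -/
def EquivUpToSecondMoments {Ω Ω' ι : Type*} [MeasurableSpace Ω] [MeasurableSpace Ω'] [Fintype ι]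
    (μ : Measure Ω) (μ' : Measure Ω')
    (ξ : ℕ → Ω → EuclideanSpace ℝ ι) (ξ' : ℕ → Ω' → EuclideanSpace ℝ ι) : Prop :=
  (∀ t, MemLp (ξ t) 2 μ) ∧ (∀ t, MemLp (ξ' t) 2 μ') ∧
    (∀ t, mean μ (ξ t) = mean μ' (ξ' t)) ∧
    ∀ s t, crossMoment μ (ξ s) (ξ t) = crossMoment μ' (ξ' s) (ξ' t)

/-! ### Block vectors -/

/-- The column vector `[aᵀ, bᵀ]ᵀ`. -/
def stack {ι κ : Type*} (a : EuclideanSpace ℝ ι) (b : EuclideanSpace ℝ κ) :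
    EuclideanSpace ℝ (ι ⊕ κ) :=
  WithLp.toLp 2 (Sum.elim a.ofLp b.ofLp)

/-- The first block of a block vector. -/
def fstBlock {ι κ : Type*} (a : EuclideanSpace ℝ (ι ⊕ κ)) : EuclideanSpace ℝ ι :=
  WithLp.toLp 2 fun i => a (Sum.inl i)

/-- The second block of a block vector. -/
def sndBlock {ι κ : Type*} (a : EuclideanSpace ℝ (ι ⊕ κ)) : EuclideanSpace ℝ κ :=
  WithLp.toLp 2 fun j => a (Sum.inr j)

/-! ### Estimators -/

/-- The vector of observations `(y_0, …, y_{k-1}, s_0, …, s_{l-1})`. -/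
def history {Ω : Type*} {n m : ℕ} (y : ℕ → Ω → EuclideanSpace ℝ (Fin n))
    (s : ℕ → Ω → EuclideanSpace ℝ (Fin m)) (k l : ℕ) (ω : Ω) :
    (Fin k → EuclideanSpace ℝ (Fin n)) × (Fin l → EuclideanSpace ℝ (Fin m)) :=
  (fun i => y i ω, fun i => s i ω)

/-- The σ-algebra generated by `(y_0, …, y_{k-1}, s_0, …, s_{l-1})`. -/
abbrev historySigma {Ω : Type*} {n m : ℕ} (y : ℕ → Ω → EuclideanSpace ℝ (Fin n))
    (s : ℕ → Ω → EuclideanSpace ℝ (Fin m)) (k l : ℕ) : MeasurableSpace Ω :=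
  MeasurableSpace.comap (history y s k l) inferInstance

/-- `Z` is an affine function of the observations `(y_0, …, y_{k-1}, s_0, …, s_{l-1})`. -/
def IsAffineEstimator {Ω : Type*} {n m : ℕ} (y : ℕ → Ω → EuclideanSpace ℝ (Fin n))
    (s : ℕ → Ω → EuclideanSpace ℝ (Fin m)) (k l : ℕ)
    (Z : Ω → EuclideanSpace ℝ (Fin n)) : Prop :=
  ∃ (a : EuclideanSpace ℝ (Fin n)) (L : Fin k → Matrix (Fin n) (Fin n) ℝ)
    (M : Fin l → Matrix (Fin n) (Fin m) ℝ),
    ∀ ω, Z ω = a + ∑ i, (L i).toEuclideanLin ((history y s k l ω).1 i)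
      + ∑ i, (M i).toEuclideanLin ((history y s k l ω).2 i)

/-- `Z` is the linear (affine) minimum mean squared error estimate of `X` given the observations
`(y_0, …, y_{k-1}, s_0, …, s_{l-1})`. -/
def IsLMMSE {Ω : Type*} [MeasurableSpace Ω] (μ : Measure Ω) {n m : ℕ}
    (y : ℕ → Ω → EuclideanSpace ℝ (Fin n)) (s : ℕ → Ω → EuclideanSpace ℝ (Fin m)) (k l : ℕ)
    (X Z : Ω → EuclideanSpace ℝ (Fin n)) : Prop :=
  IsAffineEstimator y s k l Z ∧
    ∀ Z', IsAffineEstimator y s k l Z' → eLpNorm (X - Z) 2 μ ≤ eLpNorm (X - Z') 2 μ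

/-- `Z` is (a version of) the conditional expectation `E[X | y_0, …, y_{k-1}, s_0, …, s_{l-1}]`,
that is, the minimum mean squared error estimate. -/
def IsMMSE {Ω : Type*} [MeasurableSpace Ω] (μ : Measure Ω) {n m : ℕ}
    (y : ℕ → Ω → EuclideanSpace ℝ (Fin n)) (s : ℕ → Ω → EuclideanSpace ℝ (Fin m)) (k l : ℕ)
    (X Z : Ω → EuclideanSpace ℝ (Fin n)) : Prop :=
  Measurable[historySigma y s k l] Z ∧ Z =ᵐ[μ] μ[X | historySigma y s k l]

/-! ### Uniform quantization with subtractive dither -/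

/-- Elementwise uniform quantizer with sensitivity `Δ`: a coordinate in
`[jΔ - Δ/2, jΔ + Δ/2)`, `j ∈ ℤ`, is mapped to `jΔ`. -/
def quantizer {n : ℕ} (Δ : ℝ) (z : EuclideanSpace ℝ (Fin n)) : EuclideanSpace ℝ (Fin n) :=
  WithLp.toLp 2 fun i => (⌊z i / Δ + 1 / 2⌋ : ℝ) * Δ

/-- The quantizer with subtractive dither `d`. -/
def ditheredQuantizer {n : ℕ} (Δ : ℝ) (d z : EuclideanSpace ℝ (Fin n)) :
    EuclideanSpace ℝ (Fin n) :=
  quantizer Δ (z + d) - d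

/-- The sensitivity used throughout; the quantization noise then has unit variance. -/
def sensitivity : ℝ := 2 * √3

/-! ### The plant and the two feedback loops -/

/-- The matrices that specify the plant `x_{t+1} = A x_t + B u_t + w_t`, `w_t ∼ N(0, W)`,
`W = diag(W₁₁, W₂₂)`, the sensor gain `C₁` and the feedback gain `K`. -/
structure Setup (n m p : ℕ) where
  A : Matrix (Fin n ⊕ Fin m) (Fin n ⊕ Fin m) ℝ
  B : Matrix (Fin n ⊕ Fin m) (Fin p) ℝ
  W₁₁ : Matrix (Fin n) (Fin n) ℝ
  W₂₂ : Matrix (Fin m) (Fin m) ℝ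
  C₁ : Matrix (Fin n) (Fin n) ℝ
  K : Matrix (Fin p) (Fin n ⊕ Fin m) ℝ

/-- The block diagonal covariance of the process noise. -/
def Setup.W {n m p : ℕ} (S : Setup n m p) : Matrix (Fin n ⊕ Fin m) (Fin n ⊕ Fin m) ℝ :=
  Matrix.fromBlocks S.W₁₁ 0 0 S.W₂₂

/-- What the two feedback loops have in common. Time starts at `0`, so that `x 0` is the initial
state. The primitive random variables are the initial state, the process noise `w` and the
sensor randomness `e` (measurement noise or dither). -/
structure FeedbackLoop {n m p : ℕ} (S : Setup n m p) {Ω : Type*} [MeasurableSpace Ω]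
    (μ : Measure Ω) where
  /-- the state -/
  x : ℕ → Ω → EuclideanSpace ℝ (Fin n ⊕ Fin m)
  /-- the process noise -/
  w : ℕ → Ω → EuclideanSpace ℝ (Fin n ⊕ Fin m)
  /-- the sensor randomness -/
  e : ℕ → Ω → EuclideanSpace ℝ (Fin n)
  /-- the measurement available to the controller -/
  y : ℕ → Ω → EuclideanSpace ℝ (Fin n)
  /-- the estimate of the first block of `x t` from `y_0, …, y_{t-1}` and `x²_0, …, x²_t` -/
  xTilde : ℕ → Ω → EuclideanSpace ℝ (Fin n)
  /-- the estimate of the first block of `x t` from `y_0, …, y_t` and `x²_0, …, x²_t` -/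
  xHat : ℕ → Ω → EuclideanSpace ℝ (Fin n)
  measurable_x_zero : Measurable (x 0)
  memLp_x_zero : MemLp (x 0) 2 μ
  measurable_w : ∀ t, Measurable (w t)
  measurable_e : ∀ t, Measurable (e t)
  w_law : ∀ t, μ.map (w t) = multivariateGaussian 0 S.W
  w_iIndep : iIndepFun w μ
  e_iIndep : iIndepFun e μ
  w_indep_e : IndepFun (fun ω t => w t ω) (fun ω t => e t ω) μ
  x_zero_indep : IndepFun (x 0) (fun ω => (fun t => w t ω, fun t => e t ω)) μ
  /-- plant dynamics with control input `u_t = K [x̂¹_t ; x²_t]` -/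
  dynamics : ∀ t ω, x (t + 1) ω = S.A.toEuclideanLin (x t ω)
    + S.B.toEuclideanLin (S.K.toEuclideanLin (stack (xHat t ω) (sndBlock (x t ω)))) + w t ω

namespace FeedbackLoop

variable {n m p : ℕ} {S : Setup n m p} {Ω : Type*} [MeasurableSpace Ω] {μ : Measure Ω}

/-- The first block of the state. -/
def x₁ (F : FeedbackLoop S μ) (t : ℕ) (ω : Ω) : EuclideanSpace ℝ (Fin n) := fstBlock (F.x t ω)

/-- The second block of the state, i.e. the side information. -/
def x₂ (F : FeedbackLoop S μ) (t : ℕ) (ω : Ω) : EuclideanSpace ℝ (Fin m) := sndBlock (F.x t ω)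

/-- The process `(x_t, x̂¹_t, x̃¹_t)`. -/
def joint (F : FeedbackLoop S μ) (t : ℕ) (ω : Ω) :
    EuclideanSpace ℝ ((Fin n ⊕ Fin m) ⊕ (Fin n ⊕ Fin n)) :=
  stack (F.x t ω) (stack (F.xHat t ω) (F.xTilde t ω))

/-- The estimation error `x¹_t - x̂¹_t`. -/
def error (F : FeedbackLoop S μ) (t : ℕ) (ω : Ω) : EuclideanSpace ℝ (Fin n) :=
  F.x₁ t ω - F.xHat t ω

end FeedbackLoop

/-- The Gaussian test channel: Gaussian initial state, linear sensor `y_t = C₁ x¹_t + v_t` with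
`v_t ∼ N(0, I)`, conditional mean estimates. -/
structure GaussianLoop {n m p : ℕ} (S : Setup n m p) {Ω : Type*} [MeasurableSpace Ω]
    (μ : Measure Ω) extends FeedbackLoop S μ where
  x_zero_gaussian : IsGaussian (μ.map (x 0))
  e_law : ∀ t, μ.map (e t) = multivariateGaussian 0 1
  sensor : ∀ t ω, y t ω = S.C₁.toEuclideanLin (toFeedbackLoop.x₁ t ω) + e t ω
  xTilde_mmse : ∀ t,
    IsMMSE μ y toFeedbackLoop.x₂ t (t + 1) (toFeedbackLoop.x₁ t) (xTilde t)
  xHat_mmse : ∀ t,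
    IsMMSE μ y toFeedbackLoop.x₂ (t + 1) (t + 1) (toFeedbackLoop.x₁ t) (xHat t)

/-- The quantized loop: arbitrary square integrable initial state, dither coordinates that are
i.i.d. uniform on `[-Δ/2, Δ/2)`, predictive dithered quantization of `C₁ (x¹_t - x̃¹_t)`, and
linear minimum mean squared error estimates. -/
structure QuantizedLoop {n m p : ℕ} (S : Setup n m p) {Ω : Type*} [MeasurableSpace Ω]
    (μ : Measure Ω) extends FeedbackLoop S μ where
  e_coord_iIndep : ∀ t, iIndepFun (fun i ω => e t ω i) μ
  e_coord_law : ∀ t i, pdf.IsUniform (fun ω => e t ω i)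
    (Set.Ico (-(sensitivity / 2)) (sensitivity / 2)) μ volume
  sensor : ∀ t ω, y t ω = ditheredQuantizer sensitivity (e t ω)
    (S.C₁.toEuclideanLin (toFeedbackLoop.x₁ t ω - xTilde t ω))
  xTilde_lmmse : ∀ t,
    IsLMMSE μ y toFeedbackLoop.x₂ t (t + 1) (toFeedbackLoop.x₁ t) (xTilde t)
  xHat_lmmse : ∀ t,
    IsLMMSE μ y toFeedbackLoop.x₂ (t + 1) (t + 1) (toFeedbackLoop.x₁ t) (xHat t)

/-! ### Steady state of the Kalman filter -/

/-- All complex eigenvalues lie in the open unit disc. -/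
def IsSchurStable {n : ℕ} (M : Matrix (Fin n) (Fin n) ℝ) : Prop :=
  ∀ z ∈ spectrum ℂ (M.map (fun r : ℝ => (r : ℂ))), ‖z‖ < 1

/-- The pair `(H, F)` is detectable: some output injection makes `F - L H` Schur stable. -/
def IsDetectable {n : ℕ} {κ : Type*} [Fintype κ] (H : Matrix κ (Fin n) ℝ)
    (F : Matrix (Fin n) (Fin n) ℝ) : Prop :=
  ∃ L : Matrix (Fin n) κ ℝ, IsSchurStable (F - L * H)

/-- `(Phat, Ptilde)` is a positive definite solution of the steady state equations
`P̂⁻¹ = P̃⁻¹ + C₁ᵀ C₁` and `P̃ = W₁₁ + A₁₁ (P̂⁻¹ + A₂₁ᵀ W₂₂⁻¹ A₂₁)⁻¹ A₁₁ᵀ`. -/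
structure IsSteadyState {n m p : ℕ} (S : Setup n m p)
    (Phat Ptilde : Matrix (Fin n) (Fin n) ℝ) : Prop where
  posDef_hat : Phat.PosDef
  posDef_tilde : Ptilde.PosDef
  measurement : Phat⁻¹ = Ptilde⁻¹ + S.C₁ᵀ * S.C₁
  prediction : Ptilde = S.W₁₁ + S.A.toBlocks₁₁ *
    (Phat⁻¹ + S.A.toBlocks₂₁ᵀ * S.W₂₂⁻¹ * S.A.toBlocks₂₁)⁻¹ * S.A.toBlocks₁₁ᵀ

end LQGSideInfo

end

/-! Only second moments matter, so both systems are moved into the Hilbert space `Lp ℝ 2 μ`. There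
each becomes an `L2Loop`: the noises are white, the dynamics are linear, and both estimates are
orthogonal projections onto the span of the constant and the observations.

For the quantized system, `quantError` is periodic. Averaged over a uniform dither, any function of
it gives the same value whatever the quantizer input. The effective noise `y_t - C₁(x¹_t - x̃¹_t)`
therefore has mean zero, is uncorrelated with everything determined before the dither is drawn, and
has covariance `Δ²/12 · I = I`. Since `x̃¹_t` is affine in earlier observations, adding `C₁ x̃¹_t`
back to `y_t` gives a linear sensor without changing the observation spans (`obsSpan_congr`). Affine
MMSE estimates are projections by the usual variational argument.

For the Gaussian system, all variables stay in a subspace of jointly Gaussian elements. There an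
orthogonal residual is independent of the data, so the conditional mean is again the projection.
This must be proved along the time induction, because the estimate is fed back into the state.

Part (i): the primitive vectors (constant, initial state, noises) have the same Gram matrix in both
loops. The span of corresponding pairs is then the graph of an isometry, and it contains all pairs
of states, observations and estimates (`mem_pairSpan`), because an isometry carries projections to
projections.

Part (ii): feedback is known to the estimator and drops out of the errors. The next side information
acts as a second sensor `A₂₁ x¹_t + w²_t`, so the prediction error covariance follows the Riccati
map of the stacked sensor `[C₁; A₂₁]` with noise `diag(I, W₂₂)` (`innerMatrix_predErr_succ`). That
iteration converges (`exists_riccati_tendsto`). From zero it increases, and detectability bounds it.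
From any start it is squeezed between this sequence and a geometrically decaying excess over the
fixed point. The steady state equations are the information form of the same map. -/

noncomputable section

namespace LQGSideInfo

/-! ### The Riccati map -/

section Riccati

open scoped MatrixOrder

variable {ι ι' κ : Type*} [Fintype ι] [Fintype κ]

/-- Error covariance after a filter step with gain `L`, where the target is `A e + noise(W)` and the
innovation is `H e + noise(R)`, for a prior error `e` with covariance `P`. -/
def filterCov (A : Matrix ι' ι ℝ) (H : Matrix κ ι ℝ) (W : Matrix ι' ι' ℝ) (R : Matrix κ κ ℝ)
    (P : Matrix ι ι ℝ) (L : Matrix ι' κ ℝ) : Matrix ι' ι' ℝ :=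
  (A - L * H) * P * (A - L * H)ᵀ + L * R * Lᵀ + W

/-- The optimal gain. -/
def kalmanGain (A : Matrix ι' ι ℝ) (H : Matrix κ ι ℝ) (R : Matrix κ κ ℝ)
    [DecidableEq κ] (P : Matrix ι ι ℝ) : Matrix ι' κ ℝ :=
  A * P * Hᵀ * (H * P * Hᵀ + R)⁻¹

/-- The Riccati map. -/
def riccati (A : Matrix ι' ι ℝ) (H : Matrix κ ι ℝ) (W : Matrix ι' ι' ℝ) (R : Matrix κ κ ℝ)
    [DecidableEq κ] (P : Matrix ι ι ℝ) : Matrix ι' ι' ℝ :=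
  filterCov A H W R P (kalmanGain A H R P)

theorem posSemidef_mul_mul_transpose {P : Matrix ι ι ℝ} (hP : P.PosSemidef)
    (B : Matrix κ ι ℝ) : (B * P * Bᵀ).PosSemidef := by
  simpa using hP.mul_mul_conjTranspose_same B

theorem mul_mul_transpose_mono {P Q : Matrix ι ι ℝ} (h : P ≤ Q) (B : Matrix κ ι ℝ) :
    B * P * Bᵀ ≤ B * Q * Bᵀ := by
  have := posSemidef_mul_mul_transpose h B
  rw [Matrix.le_iff]
  rwa [Matrix.mul_sub, Matrix.sub_mul] at this

theorem transpose_eq_of_posSemidef {ι : Type*} {P : Matrix ι ι ℝ} (hP : P.PosSemidef) : Pᵀ = P := by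
  simpa [Matrix.IsHermitian] using hP.isHermitian

variable (A : Matrix ι' ι ℝ) (H : Matrix κ ι ℝ) {W : Matrix ι' ι' ℝ} {R : Matrix κ κ ℝ}
  {P : Matrix ι ι ℝ}

theorem innovation_posDef (hR : R.PosDef) (hP : P.PosSemidef) : (H * P * Hᵀ + R).PosDef :=
  Matrix.PosDef.posSemidef_add (posSemidef_mul_mul_transpose hP H) hR

theorem filterCov_mono [Fintype ι'] {P Q : Matrix ι ι ℝ} (h : P ≤ Q) (L : Matrix ι' κ ℝ) :
    filterCov A H W R P L ≤ filterCov A H W R Q L := by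
  rw [filterCov, filterCov]
  have := mul_mul_transpose_mono h (A - L * H)
  gcongr

variable [DecidableEq κ]

/-- The normal equation of the least squares problem. It is what later makes the residual orthogonal
to the innovation. -/
theorem kalmanGain_mul (hR : R.PosDef) (hP : P.PosSemidef) :
    kalmanGain A H R P * (H * P * Hᵀ + R) = A * P * Hᵀ := by
  have := (innovation_posDef H hR hP).isUnit
  rw [kalmanGain, Matrix.mul_assoc,
    Matrix.nonsing_inv_mul _ ((Matrix.isUnit_iff_isUnit_det _).1 this), Matrix.mul_one]

/-- The innovation covariance dominates `R`, so the inverted matrix is nonsingular even where `P` is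
singular. -/
theorem continuousAt_riccati (hR : R.PosDef) (hP : P.PosSemidef) :
    ContinuousAt (riccati A H W R) P := by
  have hS := innovation_posDef H hR hP
  have hinv : ContinuousAt (fun P : Matrix ι ι ℝ => (H * P * Hᵀ + R)⁻¹) P := by
    refine ContinuousAt.comp (f := fun P : Matrix ι ι ℝ => H * P * Hᵀ + R)
      (g := Inv.inv) ?_ (by fun_prop)
    refine continuousAt_matrix_inv _ ?_
    rw [Ring.inverse_eq_inv']
    exact continuousAt_inv₀ hS.det_pos.ne'
  have hcont : Continuous fun p : Matrix ι ι ℝ × Matrix κ κ ℝ =>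
      filterCov A H W R p.1 (A * p.1 * Hᵀ * p.2) := by
    unfold filterCov
    fun_prop
  exact hcont.continuousAt.comp (f := fun P : Matrix ι ι ℝ => (P, (H * P * Hᵀ + R)⁻¹))
    (continuousAt_id.prodMk hinv)

/-- Completing the square in the gain: `L` survives only in a square centred at `kalmanGain` and
weighted by the innovation covariance, which makes optimality visible. -/
theorem filterCov_eq (hR : R.PosDef) (hP : P.PosSemidef) (L : Matrix ι' κ ℝ) :
    filterCov A H W R P L = A * P * Aᵀ + W
      + (L - kalmanGain A H R P) * (H * P * Hᵀ + R) * (L - kalmanGain A H R P)ᵀ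
      - kalmanGain A H R P * (H * P * Hᵀ + R) * (kalmanGain A H R P)ᵀ := by
  have h1 := kalmanGain_mul A H hR hP
  have h2 : (H * P * Hᵀ + R) * (kalmanGain A H R P)ᵀ = H * P * Aᵀ := by
    have := congrArg Matrix.transpose h1
    rw [Matrix.transpose_mul, transpose_eq_of_posSemidef (innovation_posDef H hR hP).posSemidef]
      at this
    rw [this]
    simp [Matrix.transpose_mul, transpose_eq_of_posSemidef hP, Matrix.mul_assoc]
  generalize hG : kalmanGain A H R P = G at *
  have h3 : (L - G) * (H * P * Hᵀ + R) * (L - G)ᵀ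
      = L * (H * P * Hᵀ + R) * Lᵀ - L * (H * P * Aᵀ) - A * P * Hᵀ * Lᵀ
        + G * (H * P * Hᵀ + R) * Gᵀ := by
    rw [← h1, ← h2]
    simp only [Matrix.transpose_sub, Matrix.sub_mul, Matrix.mul_sub, Matrix.mul_assoc]
    abel
  rw [h3, filterCov]
  simp only [Matrix.transpose_sub, Matrix.transpose_mul, Matrix.sub_mul, Matrix.mul_sub,
    Matrix.mul_add, Matrix.add_mul, Matrix.mul_assoc]
  abel

theorem riccati_eq (hR : R.PosDef) (hP : P.PosSemidef) :
    riccati A H W R P = A * (P - P * Hᵀ * (H * P * Hᵀ + R)⁻¹ * H * P) * Aᵀ + W := by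
  have h2 : (H * P * Hᵀ + R) * (kalmanGain A H R P)ᵀ = H * P * Aᵀ := by
    have := congrArg Matrix.transpose (kalmanGain_mul A H hR hP)
    rw [Matrix.transpose_mul, transpose_eq_of_posSemidef (innovation_posDef H hR hP).posSemidef]
      at this
    rw [this]
    simp [Matrix.transpose_mul, transpose_eq_of_posSemidef hP, Matrix.mul_assoc]
  rw [riccati, filterCov_eq A H hR hP, Matrix.mul_assoc (kalmanGain A H R P), h2, kalmanGain]
  simp only [sub_self, Matrix.zero_mul, add_zero, Matrix.mul_sub, Matrix.sub_mul, Matrix.mul_assoc]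
  abel

/-- The Riccati map in information form. -/
theorem riccati_eq_inv [DecidableEq ι] (hR : R.PosDef) (hP : P.PosDef) :
    riccati A H W R P = A * (P⁻¹ + Hᵀ * R⁻¹ * H)⁻¹ * Aᵀ + W := by
  have hS := (innovation_posDef H hR hP.posSemidef).isUnit
  have hPi : P⁻¹⁻¹ = P := Matrix.nonsing_inv_nonsing_inv _
    ((Matrix.isUnit_iff_isUnit_det _).1 hP.isUnit)
  have hRi : R⁻¹⁻¹ = R := Matrix.nonsing_inv_nonsing_inv _
    ((Matrix.isUnit_iff_isUnit_det _).1 hR.isUnit)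
  -- The Woodbury identity, applied with `P⁻¹` as base matrix and `R⁻¹` as middle factor.
  rw [riccati_eq A H hR hP.posSemidef, Matrix.add_mul_mul_inv_eq_sub _ _ _ _ hP.inv.isUnit
    hR.inv.isUnit (by rw [hPi, hRi, add_comm]; exact hS), hPi, hRi, add_comm R]

variable [Fintype ι']

theorem riccati_le (hR : R.PosDef) (hP : P.PosSemidef) (L : Matrix ι' κ ℝ) :
    riccati A H W R P ≤ filterCov A H W R P L := by
  rw [riccati, filterCov_eq A H hR hP, filterCov_eq A H hR hP L, Matrix.le_iff]
  have := posSemidef_mul_mul_transpose (innovation_posDef H hR hP).posSemidef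
    (L - kalmanGain A H R P)
  simpa using this

/-- A minimum over gains of maps monotone in the covariance is monotone: the optimal gain for `Q` is
a suboptimal one for `P`. -/
theorem riccati_mono (hR : R.PosDef) {P Q : Matrix ι ι ℝ} (hP : P.PosSemidef) (h : P ≤ Q) :
    riccati A H W R P ≤ riccati A H W R Q :=
  (riccati_le A H hR hP _).trans (filterCov_mono A H h _)

theorem riccati_posSemidef (hR : R.PosDef) (hW : W.PosSemidef) (hP : P.PosSemidef) :
    (riccati A H W R P).PosSemidef :=
  ((posSemidef_mul_mul_transpose hP _).add
    (posSemidef_mul_mul_transpose hR.posSemidef _)).add hW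

theorem riccati_posDef (hR : R.PosDef) (hW : W.PosDef) (hP : P.PosSemidef) :
    (riccati A H W R P).PosDef :=
  Matrix.PosDef.posSemidef_add ((posSemidef_mul_mul_transpose hP _).add
    (posSemidef_mul_mul_transpose hR.posSemidef _)) hW

end Riccati

/-! ### Quadratic forms and convergence of symmetric matrices -/

section Quadratic

open scoped MatrixOrder

variable {ι : Type*} [Fintype ι]

theorem dotProduct_mulVec_le_of_le {M N : Matrix ι ι ℝ} (h : M ≤ N) (x : ι → ℝ) :
    x ⬝ᵥ M *ᵥ x ≤ x ⬝ᵥ N *ᵥ x := by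
  have := Matrix.PosSemidef.dotProduct_mulVec_nonneg h x
  simp only [star_trivial, Matrix.sub_mulVec, dotProduct_sub] at this
  linarith

theorem le_of_dotProduct_mulVec_le {M N : Matrix ι ι ℝ} (hM : M.IsHermitian) (hN : N.IsHermitian)
    (h : ∀ x : ι → ℝ, x ⬝ᵥ M *ᵥ x ≤ x ⬝ᵥ N *ᵥ x) : M ≤ N := by
  refine Matrix.PosSemidef.of_dotProduct_mulVec_nonneg (hN.sub hM) fun x => ?_
  simp only [star_trivial, Matrix.sub_mulVec, dotProduct_sub]
  linarith [h x]

/-- Polarization. It reduces limits of symmetric matrices to scalar limits of quadratic forms, where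
the Loewner order becomes the order of `ℝ`. -/
theorem entry_eq_of_isHermitian [DecidableEq ι] {M : Matrix ι ι ℝ} (hM : M.IsHermitian) (i j : ι) :
    M i j = ((Pi.single i 1 + Pi.single j 1) ⬝ᵥ M *ᵥ (Pi.single i 1 + Pi.single j 1)
      - Pi.single i 1 ⬝ᵥ M *ᵥ Pi.single i 1 - Pi.single j 1 ⬝ᵥ M *ᵥ Pi.single j 1) / 2 := by
  have : M j i = M i j := by simpa using hM.apply i j
  simp only [Matrix.mulVec_add, dotProduct_add, add_dotProduct, Matrix.mulVec_single_one,
    single_one_dotProduct, Matrix.col_apply]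
  linarith

theorem tendsto_of_dotProduct_mulVec {α : Type*} {l : Filter α} {M : α → Matrix ι ι ℝ}
    {P : Matrix ι ι ℝ} (hM : ∀ a, (M a).IsHermitian) (hP : P.IsHermitian)
    (h : ∀ x : ι → ℝ, Tendsto (fun a => x ⬝ᵥ M a *ᵥ x) l (𝓝 (x ⬝ᵥ P *ᵥ x))) :
    Tendsto M l (𝓝 P) := by
  classical
  refine tendsto_pi_nhds.2 fun i => tendsto_pi_nhds.2 fun j => ?_
  rw [entry_eq_of_isHermitian hP]
  simp_rw [fun a => entry_eq_of_isHermitian (hM a) i j]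
  exact (((h _).sub (h _)).sub (h _)).div_const 2

theorem tendsto_dotProduct_mulVec {α : Type*} {l : Filter α} {M : α → Matrix ι ι ℝ}
    {P : Matrix ι ι ℝ} (h : Tendsto M l (𝓝 P)) (x : ι → ℝ) :
    Tendsto (fun a => x ⬝ᵥ M a *ᵥ x) l (𝓝 (x ⬝ᵥ P *ᵥ x)) :=
  ((by fun_prop : Continuous fun M : Matrix ι ι ℝ => x ⬝ᵥ M *ᵥ x).tendsto P).comp h

theorem tendsto_of_le_of_le {α : Type*} {l : Filter α} {L M U : α → Matrix ι ι ℝ}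
    {P : Matrix ι ι ℝ} (hM : ∀ a, (M a).IsHermitian) (hP : P.IsHermitian)
    (hL : Tendsto L l (𝓝 P)) (hU : Tendsto U l (𝓝 P)) (hLM : ∀ a, L a ≤ M a)
    (hMU : ∀ a, M a ≤ U a) : Tendsto M l (𝓝 P) :=
  tendsto_of_dotProduct_mulVec hM hP fun x =>
    tendsto_of_tendsto_of_tendsto_of_le_of_le (tendsto_dotProduct_mulVec hL x)
      (tendsto_dotProduct_mulVec hU x) (fun a => dotProduct_mulVec_le_of_le (hLM a) x)
      fun a => dotProduct_mulVec_le_of_le (hMU a) x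

/-- A monotone sequence of symmetric matrices with bounded quadratic forms converges. -/
theorem exists_tendsto_of_monotone {M : ℕ → Matrix ι ι ℝ} (hM : ∀ k, (M k).IsHermitian)
    (hmono : Monotone M) (hbdd : ∀ x : ι → ℝ, ∃ B, ∀ k, x ⬝ᵥ M k *ᵥ x ≤ B) :
    ∃ P : Matrix ι ι ℝ, P.IsHermitian ∧ Tendsto M atTop (𝓝 P) ∧ ∀ k, M k ≤ P := by
  classical
  have hconv : ∀ x : ι → ℝ, ∃ q, Tendsto (fun k => x ⬝ᵥ M k *ᵥ x) atTop (𝓝 q) := fun x => by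
    obtain ⟨B, hB⟩ := hbdd x
    exact ⟨_, tendsto_atTop_ciSup (fun a b hab => dotProduct_mulVec_le_of_le (hmono hab) x)
      ⟨B, by rintro _ ⟨k, rfl⟩; exact hB k⟩⟩
  choose q hq using hconv
  have hT : Tendsto M atTop (𝓝 (Matrix.of fun i j =>
      (q (Pi.single i 1 + Pi.single j 1) - q (Pi.single i 1) - q (Pi.single j 1)) / 2)) := by
    refine tendsto_pi_nhds.2 fun i => tendsto_pi_nhds.2 fun j => ?_
    simp_rw [fun a => entry_eq_of_isHermitian (hM a) i j]
    exact (((hq _).sub (hq _)).sub (hq _)).div_const 2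
  generalize (Matrix.of fun i j =>
      (q (Pi.single i 1 + Pi.single j 1) - q (Pi.single i 1) - q (Pi.single j 1)) / 2) = P at hT
  have hP : P.IsHermitian := by
    have h1 : Tendsto (fun k => (M k)ᴴ) atTop (𝓝 Pᴴ) :=
      ((by fun_prop : Continuous fun M : Matrix ι ι ℝ => Mᴴ).tendsto P).comp hT
    exact tendsto_nhds_unique (h1.congr fun k => hM k) hT
  refine ⟨P, hP, hT, fun k => le_of_dotProduct_mulVec_le (hM k) hP fun x => ?_⟩
  exact ge_of_tendsto (tendsto_dotProduct_mulVec hT x) (eventually_atTop.2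
    ⟨k, fun j hj => dotProduct_mulVec_le_of_le (hmono hj) x⟩)

/-- A positive definite matrix dominates a positive multiple of any symmetric matrix. -/
theorem exists_smul_le_of_posDef {M N : Matrix ι ι ℝ} (hN : N.PosDef) (hM : M.IsHermitian) :
    ∃ δ : ℝ, 0 < δ ∧ δ • M ≤ N := by
  have hherm (δ : ℝ) : (δ • M).IsHermitian := by
    rw [Matrix.IsHermitian, Matrix.conjTranspose_smul, hM.eq, star_trivial]
  rcases isEmpty_or_nonempty ι with hι | hι
  · exact ⟨1, one_pos, le_of_dotProduct_mulVec_le (hherm 1) hN.isHermitian (by simp)⟩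
  -- Both forms are compared on the unit sphere, where compactness gives a positive minimum for `N`
  -- and a finite maximum for the absolute value of the form of `M`. Homogeneity does the rest.
  have hK : IsCompact (Metric.sphere (0 : ι → ℝ) 1) := isCompact_sphere _ _
  have hne : (Metric.sphere (0 : ι → ℝ) 1).Nonempty := NormedSpace.sphere_nonempty.2 zero_le_one
  obtain ⟨x₀, hx₀, hmin⟩ := hK.exists_isMinOn hne
    (f := fun x => x ⬝ᵥ N *ᵥ x) (by fun_prop)
  obtain ⟨x₁, hx₁, hmax⟩ := hK.exists_isMaxOn hne
    (f := fun x => |x ⬝ᵥ M *ᵥ x|) (by fun_prop)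
  have hpos : 0 < x₀ ⬝ᵥ N *ᵥ x₀ := by
    have : x₀ ≠ 0 := by rintro rfl; simp at hx₀
    simpa using hN.dotProduct_mulVec_pos this
  set c := x₀ ⬝ᵥ N *ᵥ x₀
  set B := |x₁ ⬝ᵥ M *ᵥ x₁|
  have hB : 0 ≤ B := abs_nonneg _
  -- The summand `1` keeps the quotient meaningful when the form of `M` vanishes.
  refine ⟨c / (B + 1), by positivity,
    le_of_dotProduct_mulVec_le (hherm _) hN.isHermitian fun x => ?_⟩
  rcases eq_or_ne x 0 with rfl | hx
  · simp
  have hn : 0 < ‖x‖ := norm_pos_iff.2 hx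
  have hxs : ‖x‖⁻¹ • x ∈ Metric.sphere (0 : ι → ℝ) 1 := by
    simp [norm_smul, hn.ne']
  have h1 : c ≤ _ := hmin hxs
  have h2 : _ ≤ B := hmax hxs
  simp only [Matrix.mulVec_smul, smul_dotProduct, dotProduct_smul, smul_eq_mul] at h1 h2
  set a := ‖x‖⁻¹ with ha
  have ha0 : 0 < a := inv_pos.2 hn
  have h3 : a * (a * (x ⬝ᵥ M *ᵥ x)) ≤ B := (le_abs_self _).trans h2
  simp only [Matrix.smul_mulVec, dotProduct_smul, smul_eq_mul]
  have h4 : c / (B + 1) * (a * (a * (x ⬝ᵥ M *ᵥ x))) ≤ c :=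
    calc _ ≤ c / (B + 1) * B := by gcongr
      _ ≤ c := by
        rw [div_mul_eq_mul_div, div_le_iff₀ (by positivity)]
        nlinarith
  have h5 : a * a * (c / (B + 1) * (x ⬝ᵥ M *ᵥ x)) ≤ a * a * (x ⬝ᵥ N *ᵥ x) := by
    calc _ = c / (B + 1) * (a * (a * (x ⬝ᵥ M *ᵥ x))) := by ring
      _ ≤ c := h4
      _ ≤ _ := h1.trans_eq (by ring)
  exact le_of_mul_le_mul_left h5 (by positivity)

end Quadratic

/-! ### Powers of Schur stable matrices -/

section Schur

open scoped NNReal ENNReal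

attribute [local instance] Matrix.linftyOpNormedRing Matrix.linftyOpNormedAlgebra

theorem norm_entry_le_linftyOp {n : ℕ} (M : Matrix (Fin n) (Fin n) ℂ) (a b : Fin n) :
    ‖M a b‖ ≤ ‖M‖ := by
  have h1 : ‖M a b‖₊ ≤ ‖M‖₊ := by
    rw [Matrix.linfty_opNNNorm_def]
    calc ‖M a b‖₊ ≤ ∑ j, ‖M a j‖₊ :=
          Finset.single_le_sum (f := fun j => ‖M a j‖₊) (fun _ _ => zero_le) (Finset.mem_univ b)
      _ ≤ _ := Finset.le_sup (f := fun i => ∑ j, ‖M i j‖₊) (Finset.mem_univ a)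
  exact h1

/-- The entries of the powers of a Schur stable matrix decay geometrically. -/
theorem IsSchurStable.exists_pow_le {n : ℕ} {F : Matrix (Fin n) (Fin n) ℝ} (hF : IsSchurStable F) :
    ∃ r : ℝ, 0 ≤ r ∧ r < 1 ∧ ∀ᶠ k : ℕ in atTop, ∀ a b, |(F ^ k) a b| ≤ r ^ k := by
  rcases isEmpty_or_nonempty (Fin n) with h | h
  · exact ⟨0, le_rfl, one_pos, Eventually.of_forall fun k a => isEmptyElim a⟩
  set G : Matrix (Fin n) (Fin n) ℂ := F.map (fun r : ℝ => (r : ℂ)) with hG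
  have hrad : spectralRadius ℂ G < ((1 : ℝ≥0) : ℝ≥0∞) :=
    spectrum.spectralRadius_lt_of_forall_lt G fun z hz => hF z hz
  -- A rate strictly between the spectral radius and `1`; by Gelfand's formula the `k`-th roots of
  -- the norms of the powers eventually drop below it.
  obtain ⟨r, hr1, hr2⟩ := ENNReal.lt_iff_exists_nnreal_btwn.1 hrad
  have hT := spectrum.pow_nnnorm_pow_one_div_tendsto_nhds_spectralRadius G
  refine ⟨r, r.2, by exact_mod_cast hr2, ?_⟩
  filter_upwards [hT.eventually (gt_mem_nhds hr1), eventually_gt_atTop 0] with k hk hk0 a b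
  have hle : ‖G ^ k‖ ≤ (r : ℝ) ^ k := by
    have h1 : ((‖G ^ k‖₊ : ℝ≥0∞) ^ (1 / (k : ℝ))) ^ (k : ℝ) ≤ (r : ℝ≥0∞) ^ (k : ℝ) :=
      ENNReal.rpow_le_rpow hk.le (by positivity)
    rw [← ENNReal.rpow_mul, one_div, inv_mul_cancel₀ (by positivity), ENNReal.rpow_one,
      ENNReal.rpow_natCast] at h1
    exact_mod_cast h1
  have hpow : G ^ k = (F ^ k).map (fun r : ℝ => (r : ℂ)) :=
    (map_pow (Complex.ofRealHom.mapMatrix) F k).symm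
  calc |(F ^ k) a b| = ‖(G ^ k) a b‖ := by rw [hpow]; simp
    _ ≤ ‖G ^ k‖ := norm_entry_le_linftyOp _ _ _
    _ ≤ _ := hle

/-- The controllability Gramians of a Schur stable matrix are bounded. -/
theorem IsSchurStable.exists_sum_le {n : ℕ} {F : Matrix (Fin n) (Fin n) ℝ} (hF : IsSchurStable F)
    (N : Matrix (Fin n) (Fin n) ℝ) (x : Fin n → ℝ) :
    ∃ B, ∀ k, ∑ j ∈ Finset.range k, x ⬝ᵥ (F ^ j * N * (F ^ j)ᵀ) *ᵥ x ≤ B := by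
  obtain ⟨r, hr0, hr1, hr⟩ := hF.exists_pow_le
  have hs : Summable fun j => x ⬝ᵥ (F ^ j * N * (F ^ j)ᵀ) *ᵥ x := by
    -- Each summand contains two entries of `F ^ j`, so it is eventually dominated by a geometric
    -- term of ratio `r * r`.
    refine Summable.of_norm_bounded_eventually_nat
      (g := fun j => (∑ a, ∑ b, ∑ c, ∑ d, |x a| * |N d c| * |x b|) * (r * r) ^ j)
      ((summable_geometric_of_lt_one (by positivity) (by nlinarith)).mul_left _) ?_
    filter_upwards [hr] with j hj
    simp only [dotProduct, Matrix.mulVec, Matrix.mul_apply, Matrix.transpose_apply,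
      Finset.mul_sum, Finset.sum_mul, Real.norm_eq_abs]
    refine (Finset.abs_sum_le_sum_abs _ _).trans (Finset.sum_le_sum fun a _ => ?_)
    refine (Finset.abs_sum_le_sum_abs _ _).trans (Finset.sum_le_sum fun b _ => ?_)
    refine (Finset.abs_sum_le_sum_abs _ _).trans (Finset.sum_le_sum fun c _ => ?_)
    refine (Finset.abs_sum_le_sum_abs _ _).trans (Finset.sum_le_sum fun d _ => ?_)
    rw [mul_pow]
    simp only [abs_mul]
    calc |x a| * (|(F ^ j) a d| * |N d c| * |(F ^ j) b c| * |x b|)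
        ≤ |x a| * (r ^ j * |N d c| * r ^ j * |x b|) := by
          have := hj a d; have := hj b c; gcongr
      _ = _ := by ring
  obtain ⟨B, hB⟩ := hs.tendsto_sum_tsum_nat.bddAbove_range
  exact ⟨B, fun k => hB ⟨k, rfl⟩⟩

end Schur

/-! ### Convergence of the Riccati iteration -/

section RiccatiLimit

open scoped MatrixOrder

variable {n : ℕ} {κ : Type*} [Fintype κ] [DecidableEq κ]
  {A : Matrix (Fin n) (Fin n) ℝ} {H : Matrix κ (Fin n) ℝ} {W : Matrix (Fin n) (Fin n) ℝ}
  {R : Matrix κ κ ℝ}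

theorem riccati_iterate_posSemidef (hR : R.PosDef) (hW : W.PosDef) {P : Matrix (Fin n) (Fin n) ℝ}
    (hP : P.PosSemidef) (k : ℕ) : ((riccati A H W R)^[k] P).PosSemidef := by
  induction k with
  | zero => exact hP
  | succ k ih =>
    rw [Function.iterate_succ_apply']
    exact riccati_posSemidef A H hR hW.posSemidef ih

theorem riccati_iterate_mono (hR : R.PosDef) (hW : W.PosDef) {P Q : Matrix (Fin n) (Fin n) ℝ}
    (hP : P.PosSemidef) (hPQ : P ≤ Q) (k : ℕ) :
    (riccati A H W R)^[k] P ≤ (riccati A H W R)^[k] Q := by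
  induction k with
  | zero => exact hPQ
  | succ k ih =>
    rw [Function.iterate_succ_apply', Function.iterate_succ_apply']
    exact riccati_mono A H hR (riccati_iterate_posSemidef hR hW hP k) ih

/-- Zero lies below its own image, and monotone iterates preserve this inequality. -/
theorem riccati_iterate_zero_monotone (hR : R.PosDef) (hW : W.PosDef) :
    Monotone fun k => (riccati A H W R)^[k] 0 := by
  refine monotone_nat_of_le_succ fun k => ?_
  rw [Function.iterate_succ_apply]
  exact riccati_iterate_mono hR hW Matrix.PosSemidef.zero
    (riccati_posSemidef A H hR hW.posSemidef Matrix.PosSemidef.zero).nonneg k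

/-- A fixed gain is suboptimal at every step, so the iteration stays below the linear Lyapunov
recursion from zero, whose solution is this partial Gramian. A stabilizing `L` then gives
boundedness. -/
theorem riccati_iterate_zero_le (hR : R.PosDef) (hW : W.PosDef) (L : Matrix (Fin n) κ ℝ) (k : ℕ) :
    (riccati A H W R)^[k] 0 ≤ ∑ j ∈ Finset.range k,
      (A - L * H) ^ j * (L * R * Lᵀ + W) * ((A - L * H) ^ j)ᵀ := by
  induction k with
  | zero => simp
  | succ k ih =>
    rw [Function.iterate_succ_apply']
    refine (riccati_le A H hR (riccati_iterate_posSemidef hR hW Matrix.PosSemidef.zero k) L).trans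
      ((filterCov_mono A H ih L).trans_eq ?_)
    rw [Finset.sum_range_succ', filterCov, Finset.mul_sum, Finset.sum_mul, add_assoc]
    congr 1
    · refine Finset.sum_congr rfl fun j _ => ?_
      rw [pow_succ', Matrix.transpose_mul]
      simp only [Matrix.mul_assoc]
    · simp

/-- Detectability yields a positive definite fixed point of the Riccati map, the limit of the
iteration from zero. -/
theorem exists_riccati_fixedPoint (hR : R.PosDef) (hW : W.PosDef) (hdet : IsDetectable H A) :
    ∃ P : Matrix (Fin n) (Fin n) ℝ, P.PosDef ∧ riccati A H W R P = P ∧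
      Tendsto (fun k => (riccati A H W R)^[k] 0) atTop (𝓝 P) := by
  obtain ⟨L, hL⟩ := hdet
  have hpsd := riccati_iterate_posSemidef (A := A) (H := H) hR hW
    (Matrix.PosSemidef.zero : (0 : Matrix (Fin n) (Fin n) ℝ).PosSemidef)
  obtain ⟨P, hPh, hPt, hPle⟩ := exists_tendsto_of_monotone (fun k => (hpsd k).isHermitian)
    (riccati_iterate_zero_monotone hR hW) fun x => by
      obtain ⟨B, hB⟩ := hL.exists_sum_le (L * R * Lᵀ + W) x
      refine ⟨B, fun k => le_trans ?_ (hB k)⟩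
      have := dotProduct_mulVec_le_of_le (riccati_iterate_zero_le (A := A) (H := H) hR hW L k) x
      rwa [Matrix.sum_mulVec, dotProduct_sum] at this
  have hP : P.PosSemidef := Matrix.nonneg_iff_posSemidef.1 (hPle 0)
  have hfix : riccati A H W R P = P := by
    have h1 := (continuousAt_riccati A H (W := W) hR hP).tendsto.comp hPt
    have h2 := hPt.comp (tendsto_add_atTop_nat 1)
    refine tendsto_nhds_unique (h1.congr fun k => ?_) h2
    simp only [Function.comp_apply, Function.iterate_succ_apply']
  -- A limit is only semidefinite; strictness comes from the summand `W` in the fixed point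
  -- equation.
  exact ⟨P, hfix ▸ riccati_posDef A H hR hW hP, hfix, hPt⟩

/-- The difference to a fixed point contracts from above. -/
theorem exists_riccati_iterate_sub_le (hR : R.PosDef) (hW : W.PosDef)
    {P : Matrix (Fin n) (Fin n) ℝ} (hP : P.PosDef) (hfix : riccati A H W R P = P)
    {P₀ : Matrix (Fin n) (Fin n) ℝ} (hP₀ : P₀.PosSemidef) :
    ∃ c r : ℝ, 0 ≤ r ∧ r < 1 ∧ ∀ k, (riccati A H W R)^[k] P₀ - P ≤ (c * r ^ k) • P := by
  set G := kalmanGain A H R P with hG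
  obtain ⟨δ, hδ, hδP⟩ := exists_smul_le_of_posDef hW hP.isHermitian
  -- Truncation at `1` makes the contraction factor `1 - d` nonnegative.
  set d := min δ 1 with hd
  have hd0 : 0 < d := lt_min hδ one_pos
  have hdW : d • P ≤ W := by
    refine le_trans ?_ hδP
    rw [Matrix.le_iff, ← sub_smul]
    exact hP.posSemidef.smul (sub_nonneg.2 (min_le_left _ _))
  -- The fixed point equation writes `P` as this term plus `G * R * Gᵀ + W`, and `W` alone removes
  -- the share `d • P`. So `P` serves as a Lyapunov matrix for its own closed loop.
  have hF : (A - G * H) * P * (A - G * H)ᵀ ≤ (1 - d) • P := by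
    have h1 : (A - G * H) * P * (A - G * H)ᵀ = P - G * R * Gᵀ - W := by
      conv_rhs => rw [← hfix, riccati, filterCov, ← hG]
      abel
    rw [h1, sub_smul, one_smul, sub_sub]
    refine sub_le_sub_left (hdW.trans ?_) P
    have := posSemidef_mul_mul_transpose hR.posSemidef G
    exact le_add_of_nonneg_left this.nonneg
  obtain ⟨c, hc, hcP⟩ := exists_smul_le_of_posDef hP (hP₀.isHermitian.sub hP.isHermitian)
  refine ⟨c⁻¹, 1 - d, sub_nonneg.2 (min_le_right _ _), by linarith, fun k => ?_⟩
  induction k with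
  | zero =>
    have := Matrix.PosSemidef.smul (Matrix.le_iff.1 hcP) (inv_nonneg.2 hc.le)
    rw [smul_sub, smul_smul, inv_mul_cancel₀ hc.ne', one_smul] at this
    rw [pow_zero, mul_one, Matrix.le_iff]
    exact this
  | succ k ih =>
    set Q := (riccati A H W R)^[k] P₀ with hQ
    have hQp : Q.PosSemidef := riccati_iterate_posSemidef hR hW hP₀ k
    rw [Function.iterate_succ_apply', ← hQ]
    have hr : (0 : ℝ) ≤ 1 - d := sub_nonneg.2 (min_le_right _ _)
    -- Freezing the gain of the fixed point is suboptimal for `Q`, and it makes the upper bound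
    -- linear in `Q - P`.
    calc riccati A H W R Q - P ≤ filterCov A H W R Q G - filterCov A H W R P G := by
          have hfix' : filterCov A H W R P G = P := hfix
          rw [hfix']
          exact sub_le_sub_right (riccati_le A H hR hQp G) _
      _ = (A - G * H) * (Q - P) * (A - G * H)ᵀ := by
          rw [filterCov, filterCov, Matrix.mul_sub (A - G * H), Matrix.sub_mul _ _ (A - G * H)ᵀ]
          abel
      _ ≤ (A - G * H) * ((c⁻¹ * (1 - d) ^ k) • P) * (A - G * H)ᵀ := mul_mul_transpose_mono ih _
      _ = (c⁻¹ * (1 - d) ^ k) • ((A - G * H) * P * (A - G * H)ᵀ) := by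
          rw [Matrix.mul_smul, Matrix.smul_mul]
      _ ≤ (c⁻¹ * (1 - d) ^ k) • ((1 - d) • P) := by
          have := Matrix.PosSemidef.smul (Matrix.le_iff.1 hF)
            (show 0 ≤ c⁻¹ * (1 - d) ^ k by positivity)
          rwa [smul_sub] at this
      _ = _ := by rw [smul_smul, pow_succ, mul_assoc]

/-- Under detectability the Riccati iteration converges to one positive definite fixed point,
whatever the initial covariance. -/
theorem exists_riccati_tendsto (hR : R.PosDef) (hW : W.PosDef) (hdet : IsDetectable H A) :
    ∃ P : Matrix (Fin n) (Fin n) ℝ, P.PosDef ∧ riccati A H W R P = P ∧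
      ∀ P₀ : Matrix (Fin n) (Fin n) ℝ, P₀.PosSemidef →
        Tendsto (fun k => (riccati A H W R)^[k] P₀) atTop (𝓝 P) := by
  obtain ⟨P, hP, hfix, hPt⟩ := exists_riccati_fixedPoint hR hW hdet
  refine ⟨P, hP, hfix, fun P₀ hP₀ => ?_⟩
  obtain ⟨c, r, hr0, hr1, hle⟩ := exists_riccati_iterate_sub_le hR hW hP hfix hP₀
  have hU : Tendsto (fun k => P + (c * r ^ k) • P) atTop (𝓝 P) := by
    have h0 := ((tendsto_pow_atTop_nhds_zero_of_lt_one hr0 hr1).const_mul c).smul_const P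
    simpa using h0.const_add P
  -- The squeeze: the iteration from zero is below, `P` plus a geometric multiple of itself is
  -- above.
  exact tendsto_of_le_of_le (fun k => (riccati_iterate_posSemidef hR hW hP₀ k).isHermitian)
    hP.isHermitian hPt hU
    (fun k => riccati_iterate_mono hR hW Matrix.PosSemidef.zero hP₀.nonneg k)
    fun k => sub_le_iff_le_add'.1 (hle k)

end RiccatiLimit

/-! ### Steady state -/

section SteadyState

variable {n m p : ℕ} (S : Setup n m p)

/-- Sensor output and side information, as one observation of the first state block. -/
def Setup.obsMatrix : Matrix (Fin n ⊕ Fin m) (Fin n) ℝ := Matrix.fromRows S.C₁ S.A.toBlocks₂₁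

/-- Covariance of the noise in the combined observation. -/
def Setup.obsCov : Matrix (Fin n ⊕ Fin m) (Fin n ⊕ Fin m) ℝ := Matrix.fromBlocks 1 0 0 S.W₂₂

/-- One step of the covariance of the prediction error. -/
def Setup.predict : Matrix (Fin n) (Fin n) ℝ → Matrix (Fin n) (Fin n) ℝ :=
  riccati S.A.toBlocks₁₁ S.obsMatrix S.W₁₁ S.obsCov

/-- The covariance update due to the sensor output. -/
def Setup.correct : Matrix (Fin n) (Fin n) ℝ → Matrix (Fin n) (Fin n) ℝ :=
  riccati 1 S.C₁ 0 1

theorem posDef_fromBlocks_zero {ι κ : Type*} [Fintype ι] [Fintype κ]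
    {M : Matrix ι ι ℝ} {N : Matrix κ κ ℝ} (hM : M.PosDef) (hN : N.PosDef) :
    (Matrix.fromBlocks M 0 0 N).PosDef := by
  refine Matrix.PosDef.of_dotProduct_mulVec_pos ?_ fun x hx => ?_
  · rw [Matrix.IsHermitian, Matrix.fromBlocks_conjTranspose, hM.isHermitian.eq, hN.isHermitian.eq]
    simp
  · obtain ⟨a, b, rfl⟩ : ∃ a b, x = Sum.elim a b := ⟨x ∘ Sum.inl, x ∘ Sum.inr, by simp⟩
    rw [star_trivial, Matrix.fromBlocks_mulVec]
    simp only [Sum.elim_comp_inl, Sum.elim_comp_inr, Matrix.zero_mulVec, add_zero, zero_add,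
      sumElim_dotProduct_sumElim]
    have ha := hM.posSemidef.dotProduct_mulVec_nonneg a
    have hb := hN.posSemidef.dotProduct_mulVec_nonneg b
    by_cases ha0 : a = 0
    · have hb0 : b ≠ 0 := by
        rintro rfl
        exact hx (by rw [ha0]; ext (i | i) <;> rfl)
      have := hN.dotProduct_mulVec_pos hb0
      simp only [star_trivial] at *
      linarith
    · have := hM.dotProduct_mulVec_pos ha0
      simp only [star_trivial] at *
      linarith

variable {S}

theorem Setup.obsCov_posDef (h : S.W₂₂.PosDef) : S.obsCov.PosDef :=
  posDef_fromBlocks_zero Matrix.PosDef.one h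

/-- Information from uncorrelated sensors adds up. This splits the stacked Riccati map into the two
terms of the steady state equations. -/
theorem Setup.transpose_obsMatrix_mul (h : S.W₂₂.PosDef) :
    S.obsMatrixᵀ * S.obsCov⁻¹ * S.obsMatrix =
      S.C₁ᵀ * S.C₁ + S.A.toBlocks₂₁ᵀ * S.W₂₂⁻¹ * S.A.toBlocks₂₁ := by
  have hi : S.obsCov⁻¹ = Matrix.fromBlocks 1 0 0 S.W₂₂⁻¹ := by
    rw [Setup.obsCov, inv_fromBlocks_zero₁₂_of_isUnit_iff _ _ _
      (iff_of_true isUnit_one h.isUnit)]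
    simp
  rw [hi, Setup.obsMatrix, Matrix.transpose_fromRows, Matrix.fromCols_mul_fromBlocks,
    Matrix.fromCols_mul_fromRows]
  simp

theorem Setup.correct_eq {P : Matrix (Fin n) (Fin n) ℝ} (hP : P.PosDef) :
    S.correct P = (P⁻¹ + S.C₁ᵀ * S.C₁)⁻¹ := by
  rw [Setup.correct, riccati_eq_inv _ _ Matrix.PosDef.one hP]
  simp

theorem Setup.predict_eq (h : S.W₂₂.PosDef) {P : Matrix (Fin n) (Fin n) ℝ} (hP : P.PosDef) :
    S.predict P = S.W₁₁ + S.A.toBlocks₁₁ * (P⁻¹ + S.C₁ᵀ * S.C₁ +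
      S.A.toBlocks₂₁ᵀ * S.W₂₂⁻¹ * S.A.toBlocks₂₁)⁻¹ * S.A.toBlocks₁₁ᵀ := by
  rw [Setup.predict, riccati_eq_inv _ _ (Setup.obsCov_posDef h) hP,
    Setup.transpose_obsMatrix_mul h, add_comm, add_assoc]

theorem inv_add_transpose_mul_self_posDef (C : Matrix (Fin n) (Fin n) ℝ)
    {P : Matrix (Fin n) (Fin n) ℝ} (hP : P.PosDef) : (P⁻¹ + Cᵀ * C).PosDef :=
  hP.inv.add_posSemidef (by simpa using Matrix.posSemidef_conjTranspose_mul_self C)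

/-- The steady state equations say that `P̃` is a fixed point of the prediction step and that `P̂`
is its correction. -/
theorem isSteadyState_iff (h : S.W₂₂.PosDef) {Phat Ptilde : Matrix (Fin n) (Fin n) ℝ} :
    IsSteadyState S Phat Ptilde ↔
      Ptilde.PosDef ∧ S.predict Ptilde = Ptilde ∧ Phat = S.correct Ptilde := by
  constructor
  · rintro ⟨h1, h2, h3, h4⟩
    refine ⟨h2, ?_, ?_⟩
    · rw [Setup.predict_eq h h2, ← h3]
      exact h4.symm
    · rw [Setup.correct_eq h2, ← h3,
        Matrix.nonsing_inv_nonsing_inv _ ((Matrix.isUnit_iff_isUnit_det _).1 h1.isUnit)]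
  · rintro ⟨h1, h2, rfl⟩
    have hpd := inv_add_transpose_mul_self_posDef S.C₁ h1
    have h3 : (S.correct Ptilde)⁻¹ = Ptilde⁻¹ + S.C₁ᵀ * S.C₁ := by
      rw [Setup.correct_eq h1,
        Matrix.nonsing_inv_nonsing_inv _ ((Matrix.isUnit_iff_isUnit_det _).1 hpd.isUnit)]
    refine ⟨by rw [Setup.correct_eq h1]; exact hpd.inv, h1, h3, ?_⟩
    rw [h3, ← Setup.predict_eq h h1, h2]

/-- Existence and uniqueness of the steady state, and convergence to it of the covariance
recursion from any initial prediction error covariance. -/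
theorem exists_steadyState (hW₁₁ : S.W₁₁.PosDef) (hW₂₂ : S.W₂₂.PosDef)
    (hdet : IsDetectable S.obsMatrix S.A.toBlocks₁₁) :
    ∃ Phat Ptilde, IsSteadyState S Phat Ptilde ∧
      (∀ Phat' Ptilde', IsSteadyState S Phat' Ptilde' → Phat' = Phat ∧ Ptilde' = Ptilde) ∧
      ∀ P₀ : Matrix (Fin n) (Fin n) ℝ, P₀.PosSemidef →
        Tendsto (fun k => S.correct (S.predict^[k] P₀)) atTop (𝓝 Phat) := by
  obtain ⟨P, hP, hfix, hconv⟩ := exists_riccati_tendsto (Setup.obsCov_posDef hW₂₂) hW₁₁ hdet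
  refine ⟨S.correct P, P, (isSteadyState_iff hW₂₂).2 ⟨hP, hfix, rfl⟩, fun Q' P' h => ?_,
    fun P₀ hP₀ => ?_⟩
  · obtain ⟨h1, h2, h3⟩ := (isSteadyState_iff hW₂₂).1 h
    -- Iterating from a fixed point is constant, so global convergence forces uniqueness.
    have : P' = P := tendsto_nhds_unique
      (tendsto_const_nhds.congr fun k => (Function.iterate_fixed h2 k).symm)
      (hconv P' h1.posSemidef)
    exact ⟨by rw [h3, this], this⟩
  · exact (continuousAt_riccati 1 S.C₁ (W := 0) Matrix.PosDef.one hP.posSemidef).tendsto.comp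
      (hconv P₀ hP₀)

end SteadyState

/-! ### Linear combinations and Gram matrices of families of vectors -/

section Families

variable {ι ι' κ : Type*} [Fintype κ] {E E' : Type*} [AddCommGroup E] [Module ℝ E]
  [AddCommGroup E'] [Module ℝ E']

/-- The family obtained by applying a matrix to a family of vectors. -/
def comb (M : Matrix ι κ ℝ) (e : κ → E) (i : ι) : E := ∑ j, M i j • e j

theorem comb_mem {V : Submodule ℝ E} {e : κ → E} (M : Matrix ι κ ℝ) (h : ∀ j, e j ∈ V) (i : ι) :
    comb M e i ∈ V :=
  V.sum_mem fun j _ => V.smul_mem _ (h j)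

theorem comb_add (M : Matrix ι κ ℝ) (e f : κ → E) : comb M (e + f) = comb M e + comb M f := by
  ext i; simp [comb, Finset.sum_add_distrib]

theorem comb_sub (M : Matrix ι κ ℝ) (e f : κ → E) : comb M (e - f) = comb M e - comb M f := by
  ext i; simp [comb, smul_sub, Finset.sum_sub_distrib]

theorem sub_comb (M N : Matrix ι κ ℝ) (e : κ → E) : comb (M - N) e = comb M e - comb N e := by
  ext i; simp [comb, sub_smul, Finset.sum_sub_distrib]

theorem comb_one [DecidableEq κ] (e : κ → E) : comb 1 e = e := by
  ext i; simp [comb, Matrix.one_apply, ite_smul]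

theorem comb_comb [Fintype ι] (M : Matrix ι' ι ℝ) (N : Matrix ι κ ℝ) (e : κ → E) :
    comb M (comb N e) = comb (M * N) e := by
  ext i
  simp only [comb, Matrix.mul_apply, Finset.smul_sum, Finset.sum_smul, smul_smul]
  exact Finset.sum_comm

theorem comb_prodMk (M : Matrix ι κ ℝ) (e : κ → E) (e' : κ → E') (i : ι) :
    comb M (fun j => (e j, e' j)) i = (comb M e i, comb M e' i) := by
  ext <;> simp [comb, Prod.fst_sum, Prod.snd_sum]

theorem comb_fromRows (M : Matrix ι κ ℝ) (N : Matrix ι' κ ℝ) (e : κ → E) :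
    comb (Matrix.fromRows M N) e = Sum.elim (comb M e) (comb N e) := by
  ext (i | i) <;> rfl

end Families

section Gram

open scoped RealInnerProductSpace

variable {ι ι' κ : Type*} [Fintype κ] {E : Type*} [NormedAddCommGroup E] [InnerProductSpace ℝ E]

/-- The matrix of inner products of two families of vectors. -/
def innerMatrix (e : ι → E) (f : ι' → E) : Matrix ι ι' ℝ := Matrix.of fun i j => ⟪e i, f j⟫

theorem innerMatrix_comb_left (M : Matrix ι κ ℝ) (e : κ → E) (f : ι' → E) :
    innerMatrix (comb M e) f = M * innerMatrix e f := by
  ext i j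
  simp [innerMatrix, comb, Matrix.mul_apply, sum_inner, real_inner_smul_left]

theorem innerMatrix_transpose (e : ι → E) (f : ι' → E) :
    (innerMatrix e f)ᵀ = innerMatrix f e := by
  ext i j
  exact real_inner_comm _ _

theorem innerMatrix_comb_right (M : Matrix ι κ ℝ) (e : ι' → E) (f : κ → E) :
    innerMatrix e (comb M f) = innerMatrix e f * Mᵀ := by
  rw [← innerMatrix_transpose, innerMatrix_comb_left, Matrix.transpose_mul, innerMatrix_transpose]

theorem innerMatrix_add_left (e f : ι → E) (g : ι' → E) :
    innerMatrix (e + f) g = innerMatrix e g + innerMatrix f g := by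
  ext i j; simp [innerMatrix, inner_add_left]

theorem innerMatrix_add_right (g : ι → E) (e f : ι' → E) :
    innerMatrix g (e + f) = innerMatrix g e + innerMatrix g f := by
  ext i j; simp [innerMatrix, inner_add_right]

theorem innerMatrix_sub_left (e f : ι → E) (g : ι' → E) :
    innerMatrix (e - f) g = innerMatrix e g - innerMatrix f g := by
  ext i j; simp [innerMatrix, inner_sub_left]

theorem innerMatrix_sub_right (g : ι → E) (e f : ι' → E) :
    innerMatrix g (e - f) = innerMatrix g e - innerMatrix g f := by
  ext i j; simp [innerMatrix, inner_sub_right]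

theorem innerMatrix_self_posSemidef (e : κ → E) : (innerMatrix e e).PosSemidef := by
  refine Matrix.PosSemidef.of_dotProduct_mulVec_nonneg ?_ fun x => ?_
  · rw [Matrix.IsHermitian, Matrix.conjTranspose_eq_transpose_of_trivial, innerMatrix_transpose]
  · have h : star x ⬝ᵥ innerMatrix e e *ᵥ x = ⟪∑ i, x i • e i, ∑ j, x j • e j⟫ := by
      simp only [star_trivial, dotProduct, Matrix.mulVec, innerMatrix, Matrix.of_apply, sum_inner,
        inner_sum, real_inner_smul_left, real_inner_smul_right]
      refine Finset.sum_congr rfl fun i _ => ?_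
      rw [Finset.mul_sum]
      exact Finset.sum_congr rfl fun j _ => by rw [real_inner_comm (e i)]; ring
    rw [h]
    exact real_inner_self_nonneg

/-- Orthogonal projections are unique. -/
theorem eq_of_inner_sub_eq_zero {V : Submodule ℝ E} {X Z Z' : E} (hZ : Z ∈ V) (hZ' : Z' ∈ V)
    (h : ∀ u ∈ V, ⟪X - Z, u⟫ = 0) (h' : ∀ u ∈ V, ⟪X - Z', u⟫ = 0) : Z = Z' := by
  have hm := V.sub_mem hZ hZ'
  have h1 : ⟪Z - Z', Z - Z'⟫ = 0 := by
    have h2 : Z - Z' = (X - Z') - (X - Z) := by abel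
    conv_lhs => rw [h2, inner_sub_left, ← h2]
    rw [h' _ hm, h _ hm, sub_zero]
  exact sub_eq_zero.1 (inner_self_eq_zero.1 h1)

/-- **Measurement update.** If `e` is orthogonal to the old data `V` and the new data `U` arises
from `V` by adding the innovation `H e + η`, then the error of the projection of `A e + ω` (up to a
vector in `U`) onto `U` has the covariance given by the Riccati map. -/
theorem innerMatrix_projection_error [Fintype ι] [DecidableEq κ] {A : Matrix ι' ι ℝ}
    {C : Matrix κ ι ℝ} {W : Matrix ι' ι' ℝ} {R : Matrix κ κ ℝ} (hR : R.PosDef)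
    {V U : Submodule ℝ E} {e : ι → E} {η : κ → E} {ω : ι' → E} {X Z : ι' → E}
    (he : ∀ i, ∀ u ∈ V, ⟪e i, u⟫ = 0) (hη : ∀ i, ∀ u ∈ V, ⟪η i, u⟫ = 0)
    (hω : ∀ i, ∀ u ∈ V, ⟪ω i, u⟫ = 0)
    (hηη : innerMatrix η η = R) (hωω : innerMatrix ω ω = W) (heη : innerMatrix e η = 0)
    (heω : innerMatrix e ω = 0) (hηω : innerMatrix η ω = 0)
    (hinn : ∀ i, (comb C e + η) i ∈ U)
    (hU : U ≤ V ⊔ Submodule.span ℝ (Set.range (comb C e + η)))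
    (hX : ∀ i, (X - (comb A e + ω)) i ∈ U) (hZ : ∀ i, Z i ∈ U)
    (hXZ : ∀ i, ∀ u ∈ U, ⟪(X - Z) i, u⟫ = 0) :
    innerMatrix (X - Z) (X - Z) = riccati A C W R (innerMatrix e e) := by
  set P := innerMatrix e e with hP
  have hPs : P.PosSemidef := innerMatrix_self_posSemidef e
  set G := kalmanGain A C R P with hG
  have hηe : innerMatrix η e = 0 := by rw [← innerMatrix_transpose, heη, Matrix.transpose_zero]
  have hωe : innerMatrix ω e = 0 := by rw [← innerMatrix_transpose, heω, Matrix.transpose_zero]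
  have hωη : innerMatrix ω η = 0 := by rw [← innerMatrix_transpose, hηω, Matrix.transpose_zero]
  -- The expected residual: the target `A e + ω` minus `G` times the innovation `C e + η`.
  set ε : ι' → E := comb (A - G * C) e + ω - comb G η with hε
  have hcross : innerMatrix ε (comb C e + η) = 0 := by
    simp only [hε, innerMatrix_add_left, innerMatrix_sub_left, innerMatrix_add_right,
      innerMatrix_comb_left, innerMatrix_comb_right, heη, hηe, hωe, hωη, hηη, ← hP]
    have := kalmanGain_mul A C hR hPs
    rw [← hG, Matrix.mul_add] at this
    simp only [Matrix.sub_mul, Matrix.mul_zero, add_zero, sub_zero]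
    rw [← this]
    simp only [Matrix.mul_assoc]
    abel
  have hperp : ∀ i, ∀ u ∈ U, ⟪ε i, u⟫ = 0 := by
    intro i u hu
    -- All three ingredients are orthogonal to the old data; orthogonality to the innovation is the
    -- normal equation `hcross`.
    have hle : V ⊔ Submodule.span ℝ (Set.range (comb C e + η)) ≤ (innerSL ℝ (ε i)).ker := by
      refine sup_le (fun z hz => ?_) (Submodule.span_le.2 ?_)
      · have h1 : ⟪comb (A - G * C) e i, z⟫ = 0 := by
          simp [comb, sum_inner, real_inner_smul_left, he _ z hz]
        have h2 : ⟪comb G η i, z⟫ = 0 := by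
          simp [comb, sum_inner, real_inner_smul_left, hη _ z hz]
        simp [hε, h1, h2, hω i z hz]
      · rintro _ ⟨j, rfl⟩
        exact congrFun (congrFun hcross i) j
    exact hle (hU hu)
  have hZε : X - Z = ε := by
    ext i
    -- Terms of `X` already known in `U`, such as the control input, are absorbed here, so they
    -- never affect the error.
    have hmem : X i - ε i ∈ U := by
      have h1 : X i - ε i = (X - (comb A e + ω)) i + comb G (comb C e + η) i := by
        rw [comb_add, comb_comb, hε, sub_comb]
        simp only [Pi.sub_apply, Pi.add_apply]
        abel
      rw [h1]
      exact U.add_mem (hX i) (comb_mem G hinn i)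
    have := eq_of_inner_sub_eq_zero (hZ i) hmem (X := X i) (hXZ i)
      (by simpa using hperp i)
    rw [Pi.sub_apply, this]
    abel
  rw [hZε, riccati, filterCov, ← hG]
  simp only [hε, innerMatrix_add_left, innerMatrix_sub_left, innerMatrix_add_right,
    innerMatrix_sub_right, innerMatrix_comb_left, innerMatrix_comb_right, heη, hηe, hωe, hωη, hηη,
    heω, hηω, hωω, ← hP]
  simp only [Matrix.mul_zero, add_zero, sub_zero, zero_add, zero_sub, Matrix.neg_mul,
    Matrix.mul_assoc]
  abel

end Gram

/-! ### The feedback loop in a Hilbert space -/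

section ObsSpan

variable {ι κ : Type*} {E E' : Type*} [AddCommGroup E] [Module ℝ E] [AddCommGroup E'] [Module ℝ E']

/-- The span of a constant and the observations `y_0, …, y_{k-1}, s_0, …, s_{l-1}`. -/
def obsSpan (one : E) (y : ℕ → ι → E) (s : ℕ → κ → E) (k l : ℕ) : Submodule ℝ E :=
  Submodule.span ℝ ({one} ∪ {z | ∃ r < k, ∃ i, y r i = z} ∪ {z | ∃ r < l, ∃ j, s r j = z})

variable {one : E} {y : ℕ → ι → E} {s : ℕ → κ → E} {k l : ℕ}

theorem obsSpan_le {V : Submodule ℝ E} : obsSpan one y s k l ≤ V ↔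
    one ∈ V ∧ (∀ r < k, ∀ i, y r i ∈ V) ∧ ∀ r < l, ∀ j, s r j ∈ V := by
  rw [obsSpan, Submodule.span_le]
  simp only [Set.union_subset_iff, Set.singleton_subset_iff, SetLike.mem_coe, and_assoc]
  refine and_congr_right fun _ => and_congr ?_ ?_
  · exact ⟨fun h r hr i => h ⟨r, hr, i, rfl⟩, by rintro h _ ⟨r, hr, i, rfl⟩; exact h r hr i⟩
  · exact ⟨fun h r hr i => h ⟨r, hr, i, rfl⟩, by rintro h _ ⟨r, hr, i, rfl⟩; exact h r hr i⟩

theorem one_mem_obsSpan : one ∈ obsSpan one y s k l := (obsSpan_le.1 le_rfl).1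

theorem fst_mem_obsSpan {r : ℕ} (hr : r < k) (i : ι) : y r i ∈ obsSpan one y s k l :=
  (obsSpan_le.1 le_rfl).2.1 r hr i

theorem snd_mem_obsSpan {r : ℕ} (hr : r < l) (j : κ) : s r j ∈ obsSpan one y s k l :=
  (obsSpan_le.1 le_rfl).2.2 r hr j

theorem obsSpan_mono {k' l' : ℕ} (hk : k ≤ k') (hl : l ≤ l') :
    obsSpan one y s k l ≤ obsSpan one y s k' l' :=
  obsSpan_le.2 ⟨one_mem_obsSpan, fun _ hr => fst_mem_obsSpan (hr.trans_le hk),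
    fun _ hr => snd_mem_obsSpan (hr.trans_le hl)⟩

theorem map_obsSpan (f : E →ₗ[ℝ] E') : (obsSpan one y s k l).map f =
    obsSpan (f one) (fun r i => f (y r i)) (fun r j => f (s r j)) k l := by
  refine le_antisymm (Submodule.map_le_iff_le_comap.2 (obsSpan_le.2 ⟨one_mem_obsSpan,
    fun r hr i => ?_, fun r hr j => ?_⟩)) (obsSpan_le.2 ⟨Submodule.mem_map_of_mem one_mem_obsSpan,
    fun r hr i => Submodule.mem_map_of_mem (fst_mem_obsSpan hr i),
    fun r hr j => Submodule.mem_map_of_mem (snd_mem_obsSpan hr j)⟩)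
  · exact fst_mem_obsSpan (y := fun r i => f (y r i)) hr i
  · exact snd_mem_obsSpan (s := fun r j => f (s r j)) hr j

/-- Shifting each observation by a vector in the span of the earlier ones does not change the
span. -/
theorem obsSpan_congr {y' : ℕ → ι → E}
    (h : ∀ t i, y' t i - y t i ∈ obsSpan one y s t (t + 1)) (hkl : k ≤ l) :
    obsSpan one y' s k l = obsSpan one y s k l := by
  refine le_antisymm (obsSpan_le.2 ⟨one_mem_obsSpan, fun r hr i => ?_, fun r hr =>
    snd_mem_obsSpan hr⟩) (obsSpan_le.2 ⟨one_mem_obsSpan, fun r => ?_, fun r hr =>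
    snd_mem_obsSpan hr⟩)
  · have := (obsSpan one y s k l).add_mem
      (obsSpan_mono hr.le (hr.trans_le hkl) (h r i)) (fst_mem_obsSpan hr i)
    rwa [sub_add_cancel] at this
  -- To recover the observation with index `r` its shift must be known from the new data. The shift
  -- uses only observations before `r` and side information up to `r`, which `k ≤ l` makes
  -- available.
  · induction r using Nat.strong_induction_on with
    | _ r ih =>
      intro hr i
      have hle : obsSpan one y s r (r + 1) ≤ obsSpan one y' s k l :=
        obsSpan_le.2 ⟨one_mem_obsSpan, fun q hq => ih q hq (hq.trans hr),
          fun q hq => snd_mem_obsSpan (by omega)⟩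
      have := (obsSpan one y' s k l).sub_mem (fst_mem_obsSpan hr i) (hle (h r i))
      rwa [sub_sub_cancel] at this

end ObsSpan

section L2Loop

open scoped RealInnerProductSpace

variable {n m p : ℕ}

/-- The second order description of the feedback loop: random variables are vectors of a real
inner product space, estimates are orthogonal projections onto the span of the observations. -/
structure L2Loop (S : Setup n m p) (E : Type*) [NormedAddCommGroup E] [InnerProductSpace ℝ E] where
  one : E
  x : ℕ → Fin n ⊕ Fin m → E
  w : ℕ → Fin n ⊕ Fin m → E
  v : ℕ → Fin n → E
  y : ℕ → Fin n → E
  xTilde : ℕ → Fin n → E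
  xHat : ℕ → Fin n → E
  inner_one_one : ⟪one, one⟫ = 1
  inner_one_w : ∀ t i, ⟪one, w t i⟫ = 0
  inner_one_v : ∀ t i, ⟪one, v t i⟫ = 0
  inner_x_w : ∀ t i j, ⟪x 0 i, w t j⟫ = 0
  inner_x_v : ∀ t i j, ⟪x 0 i, v t j⟫ = 0
  inner_w_v : ∀ s t i j, ⟪w s i, v t j⟫ = 0
  inner_w_w : ∀ s t i j, ⟪w s i, w t j⟫ = if s = t then S.W i j else 0
  inner_v_v : ∀ s t i j, ⟪v s i, v t j⟫ = if s = t then (1 : Matrix (Fin n) (Fin n) ℝ) i j else 0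
  dynamics : ∀ t, x (t + 1) = comb S.A (x t)
    + comb (S.B * S.K) (Sum.elim (xHat t) (x t ∘ Sum.inr)) + w t
  sensor : ∀ t, y t = comb S.C₁ (x t ∘ Sum.inl) + v t
  xTilde_mem : ∀ t i, xTilde t i ∈ obsSpan one y (fun r => x r ∘ Sum.inr) t (t + 1)
  xTilde_orth : ∀ t i, ∀ u ∈ obsSpan one y (fun r => x r ∘ Sum.inr) t (t + 1),
    ⟪x t (Sum.inl i) - xTilde t i, u⟫ = 0
  xHat_mem : ∀ t i, xHat t i ∈ obsSpan one y (fun r => x r ∘ Sum.inr) (t + 1) (t + 1)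
  xHat_orth : ∀ t i, ∀ u ∈ obsSpan one y (fun r => x r ∘ Sum.inr) (t + 1) (t + 1),
    ⟪x t (Sum.inl i) - xHat t i, u⟫ = 0

namespace L2Loop

variable {S : Setup n m p} {E E' : Type*} [NormedAddCommGroup E] [InnerProductSpace ℝ E]
  [NormedAddCommGroup E'] [InnerProductSpace ℝ E']

/-- The span of the observations available at some time. -/
abbrev obs (ℒ : L2Loop S E) (k l : ℕ) : Submodule ℝ E :=
  obsSpan ℒ.one ℒ.y (fun r => ℒ.x r ∘ Sum.inr) k l

/-! #### Equality of second moments -/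

/-- The primitive vectors. -/
def prim (ℒ : L2Loop S E) :
    Unit ⊕ (Fin n ⊕ Fin m) ⊕ (ℕ × (Fin n ⊕ Fin m)) ⊕ (ℕ × Fin n) → E :=
  Sum.elim (fun _ => ℒ.one) (Sum.elim (ℒ.x 0) (Sum.elim (fun q => ℒ.w q.1 q.2)
    fun q => ℒ.v q.1 q.2))

/-- The span of the pairs of corresponding primitive vectors. -/
def pairSpan (ℒ : L2Loop S E) (ℒ' : L2Loop S E') : Submodule ℝ (E × E') :=
  Submodule.span ℝ (Set.range fun a => (ℒ.prim a, ℒ'.prim a))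

variable {ℒ : L2Loop S E} {ℒ' : L2Loop S E'}

/-- Apart from the moments of the initial state, every entry of this Gram matrix is fixed by the
axioms of `L2Loop`. -/
theorem inner_prim (hone : ∀ i, ⟪ℒ.one, ℒ.x 0 i⟫ = ⟪ℒ'.one, ℒ'.x 0 i⟫)
    (hx : ∀ i j, ⟪ℒ.x 0 i, ℒ.x 0 j⟫ = ⟪ℒ'.x 0 i, ℒ'.x 0 j⟫) (a b) :
    ⟪ℒ.prim a, ℒ.prim b⟫ = ⟪ℒ'.prim a, ℒ'.prim b⟫ := by
  have h1 := fun (ℒ : L2Loop S E) t i => (real_inner_comm _ _).trans (ℒ.inner_one_w t i)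
  have h2 := fun (ℒ : L2Loop S E) t i => (real_inner_comm _ _).trans (ℒ.inner_one_v t i)
  have h3 := fun (ℒ : L2Loop S E) t i j => (real_inner_comm _ _).trans (ℒ.inner_x_w t i j)
  have h4 := fun (ℒ : L2Loop S E) t i j => (real_inner_comm _ _).trans (ℒ.inner_x_v t i j)
  have h5 := fun (ℒ : L2Loop S E) s t i j => (real_inner_comm _ _).trans (ℒ.inner_w_v s t i j)
  have k1 := fun (ℒ : L2Loop S E') t i => (real_inner_comm _ _).trans (ℒ.inner_one_w t i)
  have k2 := fun (ℒ : L2Loop S E') t i => (real_inner_comm _ _).trans (ℒ.inner_one_v t i)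
  have k3 := fun (ℒ : L2Loop S E') t i j => (real_inner_comm _ _).trans (ℒ.inner_x_w t i j)
  have k4 := fun (ℒ : L2Loop S E') t i j => (real_inner_comm _ _).trans (ℒ.inner_x_v t i j)
  have k5 := fun (ℒ : L2Loop S E') s t i j => (real_inner_comm _ _).trans (ℒ.inner_w_v s t i j)
  have h6 : ∀ i, ⟪ℒ.x 0 i, ℒ.one⟫ = ⟪ℒ'.x 0 i, ℒ'.one⟫ := fun i => by
    rw [real_inner_comm, hone, real_inner_comm]
  rcases a with a | a | a | a <;> rcases b with b | b | b | b <;>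
    simp only [prim, Sum.elim_inl, Sum.elim_inr, inner_one_one, inner_one_w, inner_one_v, inner_x_w,
      inner_x_v, inner_w_v, inner_w_w, inner_v_v, h1, h2, h3, h4, h5, h6, k1, k2, k3, k4, k5, hone,
      hx]

/-- By bilinearity it suffices to compare generators. Thus `pairSpan` is the graph of an isometry
between the spans of the primitives. -/
theorem inner_eq_of_mem_pairSpan (hone : ∀ i, ⟪ℒ.one, ℒ.x 0 i⟫ = ⟪ℒ'.one, ℒ'.x 0 i⟫)
    (hx : ∀ i j, ⟪ℒ.x 0 i, ℒ.x 0 j⟫ = ⟪ℒ'.x 0 i, ℒ'.x 0 j⟫) {z z' : E × E'}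
    (hz : z ∈ pairSpan ℒ ℒ') (hz' : z' ∈ pairSpan ℒ ℒ') : ⟪z.1, z'.1⟫ = ⟪z.2, z'.2⟫ := by
  induction hz using Submodule.span_induction with
  | mem z hz =>
    obtain ⟨a, rfl⟩ := hz
    induction hz' using Submodule.span_induction with
    | mem z' hz' => obtain ⟨b, rfl⟩ := hz'; exact inner_prim hone hx a b
    | zero => simp
    | add u u' _ _ hu hu' => simp [inner_add_right, hu, hu']
    | smul c u _ hu => simp [real_inner_smul_right, hu]
  | zero => simp
  | add u u' _ _ hu hu' => simp [inner_add_left, hu, hu']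
  | smul c u _ hu => simp [real_inner_smul_left, hu]

/-- Orthogonal projections of corresponding vectors onto corresponding subspaces correspond. -/
theorem prodMk_mem_of_projection (hone : ∀ i, ⟪ℒ.one, ℒ.x 0 i⟫ = ⟪ℒ'.one, ℒ'.x 0 i⟫)
    (hx : ∀ i j, ⟪ℒ.x 0 i, ℒ.x 0 j⟫ = ⟪ℒ'.x 0 i, ℒ'.x 0 j⟫) {V : Submodule ℝ (E × E')}
    (hV : V ≤ pairSpan ℒ ℒ') {X : E} {X' : E'} (hX : (X, X') ∈ pairSpan ℒ ℒ') {Z : E} {Z' : E'}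
    (hZ : Z ∈ V.map (LinearMap.fst ℝ E E')) (hZ' : Z' ∈ V.map (LinearMap.snd ℝ E E'))
    (horth : ∀ u ∈ V.map (LinearMap.fst ℝ E E'), ⟪X - Z, u⟫ = 0)
    (horth' : ∀ u ∈ V.map (LinearMap.snd ℝ E E'), ⟪X' - Z', u⟫ = 0) : (Z, Z') ∈ V := by
  obtain ⟨⟨Z₁, Z₂⟩, hm, rfl⟩ := hZ
  -- The partner `Z₂` of the first projection has an orthogonal residual too, because inner products
  -- agree on pairs; uniqueness of projections identifies it with `Z'`.
  have : Z' = Z₂ := by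
    refine eq_of_inner_sub_eq_zero hZ' (Submodule.mem_map_of_mem hm) horth' ?_
    rintro _ ⟨⟨u₁, u₂⟩, hu, rfl⟩
    have h1 := horth _ (Submodule.mem_map_of_mem hu)
    have h2 := inner_eq_of_mem_pairSpan hone hx
      ((pairSpan ℒ ℒ').sub_mem hX (hV hm)) (hV hu)
    exact h2.symm.trans h1
  rw [this]
  exact hm

/-- The span of the pairs of corresponding observations. -/
def obsPair (ℒ : L2Loop S E) (ℒ' : L2Loop S E') (k l : ℕ) : Submodule ℝ (E × E') :=
  obsSpan (ℒ.one, ℒ'.one) (fun r i => (ℒ.y r i, ℒ'.y r i))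
    (fun r j => (ℒ.x r (Sum.inr j), ℒ'.x r (Sum.inr j))) k l

theorem map_fst_obsPair (k l : ℕ) :
    (obsPair ℒ ℒ' k l).map (LinearMap.fst ℝ E E') = ℒ.obs k l := map_obsSpan _

theorem map_snd_obsPair (k l : ℕ) :
    (obsPair ℒ ℒ' k l).map (LinearMap.snd ℝ E E') = ℒ'.obs k l := map_obsSpan _

theorem sensor_mem_pairSpan {t : ℕ} (hxt : ∀ i, (ℒ.x t i, ℒ'.x t i) ∈ pairSpan ℒ ℒ') (i : Fin n) :
    (ℒ.y t i, ℒ'.y t i) ∈ pairSpan ℒ ℒ' := by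
  have h1 := comb_mem S.C₁ (fun j => hxt (Sum.inl j)) i
  rw [comb_prodMk] at h1
  have h2 : (ℒ.v t i, ℒ'.v t i) ∈ pairSpan ℒ ℒ' :=
    Submodule.subset_span ⟨Sum.inr (Sum.inr (Sum.inr (t, i))), rfl⟩
  have := (pairSpan ℒ ℒ').add_mem h1 h2
  rw [ℒ.sensor, ℒ'.sensor]
  exact this

theorem obsPair_succ_le {t : ℕ} (hxt : ∀ i, (ℒ.x t i, ℒ'.x t i) ∈ pairSpan ℒ ℒ')
    (hobs : obsPair ℒ ℒ' t (t + 1) ≤ pairSpan ℒ ℒ') :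
    obsPair ℒ ℒ' (t + 1) (t + 1) ≤ pairSpan ℒ ℒ' := by
  obtain ⟨h1, h2, h3⟩ := obsSpan_le.1 hobs
  refine obsSpan_le.2 ⟨h1, fun r hr i => ?_, h3⟩
  rcases Nat.lt_succ_iff_lt_or_eq.1 hr with hr | rfl
  · exact h2 r hr i
  · exact sensor_mem_pairSpan hxt i

theorem xHat_mem_obsPair (hone : ∀ i, ⟪ℒ.one, ℒ.x 0 i⟫ = ⟪ℒ'.one, ℒ'.x 0 i⟫)
    (hx : ∀ i j, ⟪ℒ.x 0 i, ℒ.x 0 j⟫ = ⟪ℒ'.x 0 i, ℒ'.x 0 j⟫) {t : ℕ}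
    (hxt : ∀ i, (ℒ.x t i, ℒ'.x t i) ∈ pairSpan ℒ ℒ')
    (hobs : obsPair ℒ ℒ' t (t + 1) ≤ pairSpan ℒ ℒ') (i : Fin n) :
    (ℒ.xHat t i, ℒ'.xHat t i) ∈ obsPair ℒ ℒ' (t + 1) (t + 1) := by
  refine prodMk_mem_of_projection hone hx (obsPair_succ_le hxt hobs) (hxt (Sum.inl i)) ?_ ?_ ?_ ?_
  · rw [map_fst_obsPair]; exact ℒ.xHat_mem t i
  · rw [map_snd_obsPair]; exact ℒ'.xHat_mem t i
  · rw [map_fst_obsPair]; exact ℒ.xHat_orth t i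
  · rw [map_snd_obsPair]; exact ℒ'.xHat_orth t i

theorem xTilde_mem_obsPair (hone : ∀ i, ⟪ℒ.one, ℒ.x 0 i⟫ = ⟪ℒ'.one, ℒ'.x 0 i⟫)
    (hx : ∀ i j, ⟪ℒ.x 0 i, ℒ.x 0 j⟫ = ⟪ℒ'.x 0 i, ℒ'.x 0 j⟫) {t : ℕ}
    (hxt : ∀ i, (ℒ.x t i, ℒ'.x t i) ∈ pairSpan ℒ ℒ')
    (hobs : obsPair ℒ ℒ' t (t + 1) ≤ pairSpan ℒ ℒ') (i : Fin n) :
    (ℒ.xTilde t i, ℒ'.xTilde t i) ∈ obsPair ℒ ℒ' t (t + 1) := by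
  refine prodMk_mem_of_projection hone hx hobs (hxt (Sum.inl i)) ?_ ?_ ?_ ?_
  · rw [map_fst_obsPair]; exact ℒ.xTilde_mem t i
  · rw [map_snd_obsPair]; exact ℒ'.xTilde_mem t i
  · rw [map_fst_obsPair]; exact ℒ.xTilde_orth t i
  · rw [map_snd_obsPair]; exact ℒ'.xTilde_orth t i

/-- Both loops use the same coefficients for dynamics and sensor, and projections correspond. States
and observations go through the induction together because the next state contains `xHat`. -/
theorem mem_pairSpan (hone : ∀ i, ⟪ℒ.one, ℒ.x 0 i⟫ = ⟪ℒ'.one, ℒ'.x 0 i⟫)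
    (hx : ∀ i j, ⟪ℒ.x 0 i, ℒ.x 0 j⟫ = ⟪ℒ'.x 0 i, ℒ'.x 0 j⟫) (t : ℕ) :
    (∀ i, (ℒ.x t i, ℒ'.x t i) ∈ pairSpan ℒ ℒ') ∧
      obsPair ℒ ℒ' t (t + 1) ≤ pairSpan ℒ ℒ' := by
  induction t with
  | zero =>
    have h0 : ∀ i, (ℒ.x 0 i, ℒ'.x 0 i) ∈ pairSpan ℒ ℒ' := fun i =>
      Submodule.subset_span ⟨Sum.inr (Sum.inl i), rfl⟩
    refine ⟨h0, obsSpan_le.2 ⟨Submodule.subset_span ⟨Sum.inl (), rfl⟩, by simp, fun r hr j => ?_⟩⟩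
    obtain rfl : r = 0 := by omega
    exact h0 _
  | succ t ih =>
    obtain ⟨hxt, hobs⟩ := ih
    have hle := obsPair_succ_le hxt hobs
    have hs : ∀ i, (ℒ.x (t + 1) i, ℒ'.x (t + 1) i) ∈ pairSpan ℒ ℒ' := fun i => by
      have h1 := comb_mem S.A hxt i
      have h2 := comb_mem (S.B * S.K) (V := pairSpan ℒ ℒ')
        (e := fun j => (Sum.elim (ℒ.xHat t) (ℒ.x t ∘ Sum.inr) j,
          Sum.elim (ℒ'.xHat t) (ℒ'.x t ∘ Sum.inr) j))
        (by
          rintro (j | j)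
          · exact hle (xHat_mem_obsPair hone hx hxt hobs j)
          · exact hxt (Sum.inr j)) i
      have h3 : (ℒ.w t i, ℒ'.w t i) ∈ pairSpan ℒ ℒ' :=
        Submodule.subset_span ⟨Sum.inr (Sum.inr (Sum.inl (t, i))), rfl⟩
      rw [comb_prodMk] at h1 h2
      have := (pairSpan ℒ ℒ').add_mem ((pairSpan ℒ ℒ').add_mem h1 h2) h3
      rw [ℒ.dynamics, ℒ'.dynamics]
      exact this
    refine ⟨hs, ?_⟩
    obtain ⟨h1, h2, h3⟩ := obsSpan_le.1 hle
    refine obsSpan_le.2 ⟨h1, h2, fun r hr j => ?_⟩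
    rcases Nat.lt_succ_iff_lt_or_eq.1 hr with hr | rfl
    · exact h3 r hr j
    · exact hs _

/-- The process `(x, x̂, x̃)`. -/
def joint (ℒ : L2Loop S E) (t : ℕ) : (Fin n ⊕ Fin m) ⊕ (Fin n ⊕ Fin n) → E :=
  Sum.elim (ℒ.x t) (Sum.elim (ℒ.xHat t) (ℒ.xTilde t))

theorem joint_mem_pairSpan (hone : ∀ i, ⟪ℒ.one, ℒ.x 0 i⟫ = ⟪ℒ'.one, ℒ'.x 0 i⟫)
    (hx : ∀ i j, ⟪ℒ.x 0 i, ℒ.x 0 j⟫ = ⟪ℒ'.x 0 i, ℒ'.x 0 j⟫) (t : ℕ) (i) :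
    (ℒ.joint t i, ℒ'.joint t i) ∈ pairSpan ℒ ℒ' := by
  obtain ⟨hxt, hobs⟩ := mem_pairSpan hone hx t
  rcases i with i | i | i
  · exact hxt i
  · exact obsPair_succ_le hxt hobs (xHat_mem_obsPair hone hx hxt hobs i)
  · exact hobs (xTilde_mem_obsPair hone hx hxt hobs i)

/-- Two loops whose initial states have the same moments agree up to second moments. -/
theorem inner_joint_eq (hone : ∀ i, ⟪ℒ.one, ℒ.x 0 i⟫ = ⟪ℒ'.one, ℒ'.x 0 i⟫)
    (hx : ∀ i j, ⟪ℒ.x 0 i, ℒ.x 0 j⟫ = ⟪ℒ'.x 0 i, ℒ'.x 0 j⟫) (s t : ℕ) (i j) :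
    ⟪ℒ.joint s i, ℒ.joint t j⟫ = ⟪ℒ'.joint s i, ℒ'.joint t j⟫ :=
  inner_eq_of_mem_pairSpan hone hx (joint_mem_pairSpan hone hx s i) (joint_mem_pairSpan hone hx t j)

theorem inner_one_joint_eq (hone : ∀ i, ⟪ℒ.one, ℒ.x 0 i⟫ = ⟪ℒ'.one, ℒ'.x 0 i⟫)
    (hx : ∀ i j, ⟪ℒ.x 0 i, ℒ.x 0 j⟫ = ⟪ℒ'.x 0 i, ℒ'.x 0 j⟫) (t : ℕ) (i) :
    ⟪ℒ.one, ℒ.joint t i⟫ = ⟪ℒ'.one, ℒ'.joint t i⟫ :=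
  inner_eq_of_mem_pairSpan hone hx
    (z := (ℒ.one, ℒ'.one)) (Submodule.subset_span ⟨Sum.inl (), rfl⟩) (joint_mem_pairSpan hone hx t i)

end L2Loop

end L2Loop

namespace L2Loop

open scoped RealInnerProductSpace

variable {n m p : ℕ} {S : Setup n m p} {E : Type*} [NormedAddCommGroup E] [InnerProductSpace ℝ E]

/-! #### Covariance of the estimation errors -/

/-- The vectors that are orthogonal to the noise from time `t` on. -/
def past (ℒ : L2Loop S E) (t : ℕ) : Submodule ℝ E where
  carrier := {z | ∀ s, t ≤ s → (∀ i, ⟪z, ℒ.w s i⟫ = 0) ∧ ∀ i, ⟪z, ℒ.v s i⟫ = 0}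
  add_mem' ha hb s hs := by
    simp [inner_add_left, (ha s hs).1, (hb s hs).1, (ha s hs).2, (hb s hs).2]
  zero_mem' := by simp
  smul_mem' c z hz s hs := by simp [real_inner_smul_left, (hz s hs).1, (hz s hs).2]

variable (ℒ : L2Loop S E)

theorem past_mono {s t : ℕ} (h : s ≤ t) : ℒ.past s ≤ ℒ.past t := fun _ hz r hr => hz r (h.trans hr)

theorem w_mem_past (t : ℕ) (i) : ℒ.w t i ∈ ℒ.past (t + 1) := fun s hs =>
  ⟨fun j => by rw [ℒ.inner_w_w, if_neg (by omega)], fun j => ℒ.inner_w_v _ _ _ _⟩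

theorem v_mem_past (t : ℕ) (i) : ℒ.v t i ∈ ℒ.past (t + 1) := fun s hs =>
  ⟨fun j => (real_inner_comm _ _).trans (ℒ.inner_w_v _ _ _ _),
    fun j => by rw [ℒ.inner_v_v, if_neg (by omega)]⟩

theorem obs_succ_le_past {t : ℕ} (hx : ∀ i, ℒ.x t i ∈ ℒ.past t)
    (hobs : ℒ.obs t (t + 1) ≤ ℒ.past t) : ℒ.obs (t + 1) (t + 1) ≤ ℒ.past (t + 1) := by
  obtain ⟨h1, h2, h3⟩ := obsSpan_le.1 (hobs.trans (ℒ.past_mono t.le_succ))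
  refine obsSpan_le.2 ⟨h1, fun r hr i => ?_, h3⟩
  rcases Nat.lt_succ_iff_lt_or_eq.1 hr with hr | rfl
  · exact h2 r hr i
  · rw [ℒ.sensor]
    exact Submodule.add_mem _ (ℒ.past_mono r.le_succ (comb_mem _ (fun j => hx _) i))
      (ℒ.v_mem_past r i)

/-- Causality: what is formed before time `t` uses only the initial state, the constant and earlier
noise. The two claims are coupled through the feedback of `xHat`. -/
theorem mem_past (t : ℕ) : (∀ i, ℒ.x t i ∈ ℒ.past t) ∧ ℒ.obs t (t + 1) ≤ ℒ.past t := by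
  induction t with
  | zero =>
    have h0 : ∀ i, ℒ.x 0 i ∈ ℒ.past 0 := fun i s _ =>
      ⟨fun j => ℒ.inner_x_w s i j, fun j => ℒ.inner_x_v s i j⟩
    refine ⟨h0, obsSpan_le.2 ⟨fun s _ => ⟨ℒ.inner_one_w s, ℒ.inner_one_v s⟩, by simp,
      fun r hr j => ?_⟩⟩
    obtain rfl : r = 0 := by omega
    exact h0 _
  | succ t ih =>
    have hle := ℒ.obs_succ_le_past ih.1 ih.2
    have hs : ∀ i, ℒ.x (t + 1) i ∈ ℒ.past (t + 1) := fun i => by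
      rw [ℒ.dynamics]
      refine Submodule.add_mem _ (Submodule.add_mem _ ?_ ?_) (ℒ.w_mem_past t i)
      · exact ℒ.past_mono t.le_succ (comb_mem _ ih.1 i)
      · refine comb_mem _ ?_ i
        rintro (j | j)
        · exact hle (ℒ.xHat_mem t j)
        · exact ℒ.past_mono t.le_succ (ih.1 _)
    refine ⟨hs, ?_⟩
    obtain ⟨h1, h2, h3⟩ := obsSpan_le.1 hle
    refine obsSpan_le.2 ⟨h1, h2, fun r hr j => ?_⟩
    rcases Nat.lt_succ_iff_lt_or_eq.1 hr with hr | rfl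
    · exact h3 r hr j
    · exact hs _

/-- The prediction error. -/
def predErr (t : ℕ) : Fin n → E := ℒ.x t ∘ Sum.inl - ℒ.xTilde t

/-- The estimation error. -/
def estErr (t : ℕ) : Fin n → E := ℒ.x t ∘ Sum.inl - ℒ.xHat t

theorem predErr_mem_past (t : ℕ) (i) : ℒ.predErr t i ∈ ℒ.past t :=
  Submodule.sub_mem _ ((ℒ.mem_past t).1 _) ((ℒ.mem_past t).2 (ℒ.xTilde_mem t i))

theorem inner_w_of_mem_obs {t : ℕ} {u : E} (hu : u ∈ ℒ.obs t (t + 1)) (i) : ⟪ℒ.w t i, u⟫ = 0 :=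
  (real_inner_comm _ _).trans (((ℒ.mem_past t).2 hu t le_rfl).1 i)

theorem inner_v_of_mem_obs {t : ℕ} {u : E} (hu : u ∈ ℒ.obs t (t + 1)) (i) : ⟪ℒ.v t i, u⟫ = 0 :=
  (real_inner_comm _ _).trans (((ℒ.mem_past t).2 hu t le_rfl).2 i)

/-- The innovation form of the sensor: subtracting a predictable term leaves the prediction error
plus fresh noise. -/
theorem sensor_sub (t : ℕ) (i) :
    comb S.C₁ (ℒ.predErr t) i + ℒ.v t i = ℒ.y t i - comb S.C₁ (ℒ.xTilde t) i := by
  rw [ℒ.sensor, predErr, comb_sub]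
  simp only [Pi.sub_apply, Pi.add_apply]
  abel

theorem innerMatrix_v (t : ℕ) : innerMatrix (ℒ.v t) (ℒ.v t) = 1 := by
  ext i j; simp [innerMatrix, ℒ.inner_v_v]

theorem innerMatrix_predErr_v (t : ℕ) : innerMatrix (ℒ.predErr t) (ℒ.v t) = 0 := by
  ext i j; exact (ℒ.predErr_mem_past t i t le_rfl).2 j

/-- The estimation error covariance is the correction of the prediction error covariance. -/
theorem innerMatrix_estErr (t : ℕ) :
    innerMatrix (ℒ.estErr t) (ℒ.estErr t)
      = S.correct (innerMatrix (ℒ.predErr t) (ℒ.predErr t)) := by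
  have hmono : ℒ.obs t (t + 1) ≤ ℒ.obs (t + 1) (t + 1) := obsSpan_mono t.le_succ le_rfl
  -- The target is the current prediction error itself, hence identity dynamics and no process
  -- noise; it differs from `x¹` by `xTilde`, which is known.
  refine innerMatrix_projection_error (V := ℒ.obs t (t + 1)) (U := ℒ.obs (t + 1) (t + 1))
    (η := ℒ.v t) (ω := 0) Matrix.PosDef.one (ℒ.xTilde_orth t)
    (fun i u hu => ℒ.inner_v_of_mem_obs hu i) (by simp) (ℒ.innerMatrix_v t)
    (by ext; simp [innerMatrix]) (ℒ.innerMatrix_predErr_v t) (by ext; simp [innerMatrix])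
    (by ext; simp [innerMatrix]) (fun i => ?_) ?_ (fun i => ?_) (ℒ.xHat_mem t) (ℒ.xHat_orth t)
  · rw [Pi.add_apply, ℒ.sensor_sub]
    exact Submodule.sub_mem _ (fst_mem_obsSpan t.lt_succ_self i)
      (hmono (comb_mem _ (ℒ.xTilde_mem t) i))
  · refine obsSpan_le.2 ⟨Submodule.mem_sup_left one_mem_obsSpan, fun r hr i => ?_,
      fun r hr j => Submodule.mem_sup_left
        (snd_mem_obsSpan (s := fun r => ℒ.x r ∘ Sum.inr) hr j)⟩
    rcases Nat.lt_succ_iff_lt_or_eq.1 hr with hr | rfl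
    · exact Submodule.mem_sup_left (fst_mem_obsSpan hr i)
    · have h1 : ℒ.y r i = comb S.C₁ (ℒ.xTilde r) i + (comb S.C₁ (ℒ.predErr r) + ℒ.v r) i := by
        rw [Pi.add_apply, ℒ.sensor_sub]; abel
      rw [h1]
      exact Submodule.add_mem _ (Submodule.mem_sup_left (comb_mem _ (ℒ.xTilde_mem r) i))
        (Submodule.mem_sup_right (Submodule.subset_span ⟨i, rfl⟩))
  · rw [comb_one, add_zero, predErr, sub_sub_cancel]
    exact hmono (ℒ.xTilde_mem t i)

theorem comb_blocks_inl (A : Matrix (Fin n ⊕ Fin m) (Fin n ⊕ Fin m) ℝ) (e : Fin n ⊕ Fin m → E)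
    (i : Fin n) : comb A e (Sum.inl i)
      = comb A.toBlocks₁₁ (e ∘ Sum.inl) i + comb A.toBlocks₁₂ (e ∘ Sum.inr) i := by
  simp [comb, Fintype.sum_sum_type, Matrix.toBlocks₁₁, Matrix.toBlocks₁₂]

theorem comb_blocks_inr (A : Matrix (Fin n ⊕ Fin m) (Fin n ⊕ Fin m) ℝ) (e : Fin n ⊕ Fin m → E)
    (i : Fin m) : comb A e (Sum.inr i)
      = comb A.toBlocks₂₁ (e ∘ Sum.inl) i + comb A.toBlocks₂₂ (e ∘ Sum.inr) i := by
  simp [comb, Fintype.sum_sum_type, Matrix.toBlocks₂₁, Matrix.toBlocks₂₂]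

/-- The contribution of the control input. -/
def feedback (t : ℕ) : Fin n ⊕ Fin m → E :=
  comb (S.B * S.K) (Sum.elim (ℒ.xHat t) (ℒ.x t ∘ Sum.inr))

theorem feedback_mem (t : ℕ) (i) : ℒ.feedback t i ∈ ℒ.obs (t + 1) (t + 1) := by
  refine comb_mem _ ?_ i
  rintro (j | j)
  · exact ℒ.xHat_mem t j
  · exact snd_mem_obsSpan (s := fun r => ℒ.x r ∘ Sum.inr) t.lt_succ_self j

/-- The next side information is a noisy sensor in disguise: what it adds to data known at time `t`
is a reading of the prediction error through `A₂₁`, with noise the second block of `w`. -/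
theorem sideInfo_sub (t : ℕ) (j : Fin m) :
    comb S.A.toBlocks₂₁ (ℒ.predErr t) j + ℒ.w t (Sum.inr j) = ℒ.x (t + 1) (Sum.inr j) -
      (comb S.A.toBlocks₂₁ (ℒ.xTilde t) j + comb S.A.toBlocks₂₂ (ℒ.x t ∘ Sum.inr) j
        + ℒ.feedback t (Sum.inr j)) := by
  rw [ℒ.dynamics, predErr, comb_sub]
  simp only [Pi.sub_apply, Pi.add_apply, comb_blocks_inr S.A, feedback]
  abel

/-- The covariance recursion of the prediction error. -/
theorem innerMatrix_predErr_succ (hW₂₂ : S.W₂₂.PosDef) (t : ℕ) :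
    innerMatrix (ℒ.predErr (t + 1)) (ℒ.predErr (t + 1))
      = S.predict (innerMatrix (ℒ.predErr t) (ℒ.predErr t)) := by
  have hmono : ℒ.obs t (t + 1) ≤ ℒ.obs (t + 1) (t + 2) := obsSpan_mono t.le_succ (by omega)
  have hmono' : ℒ.obs (t + 1) (t + 1) ≤ ℒ.obs (t + 1) (t + 2) := obsSpan_mono le_rfl (by omega)
  have hx2 : ∀ j, comb S.A.toBlocks₂₂ (ℒ.x t ∘ Sum.inr) j ∈ ℒ.obs t (t + 1) :=
    comb_mem _ fun j => snd_mem_obsSpan (s := fun r => ℒ.x r ∘ Sum.inr) t.lt_succ_self j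
  -- One Riccati step processes `y t` and the next side information together, so their noises are
  -- stacked.
  set η : Fin n ⊕ Fin m → E := Sum.elim (ℒ.v t) (ℒ.w t ∘ Sum.inr) with hη
  have hinl : ∀ i, (comb S.obsMatrix (ℒ.predErr t) + η) (Sum.inl i) =
      ℒ.y t i - comb S.C₁ (ℒ.xTilde t) i := fun i => by
    rw [← ℒ.sensor_sub, Setup.obsMatrix, comb_fromRows]; rfl
  have hinr : ∀ j, (comb S.obsMatrix (ℒ.predErr t) + η) (Sum.inr j) = ℒ.x (t + 1) (Sum.inr j) -
      (comb S.A.toBlocks₂₁ (ℒ.xTilde t) j + comb S.A.toBlocks₂₂ (ℒ.x t ∘ Sum.inr) j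
        + ℒ.feedback t (Sum.inr j)) := fun j => by
    rw [← ℒ.sideInfo_sub, Setup.obsMatrix, comb_fromRows]; rfl
  -- The measurement alone is settled first, since removing the feedback from the side information
  -- requires `xHat t`, which uses `y t`.
  have hle : ℒ.obs (t + 1) (t + 1) ≤ ℒ.obs t (t + 1) ⊔
      Submodule.span ℝ (Set.range (comb S.obsMatrix (ℒ.predErr t) + η)) := by
    refine obsSpan_le.2 ⟨Submodule.mem_sup_left one_mem_obsSpan, fun r hr i => ?_,
      fun r hr j => Submodule.mem_sup_left
        (snd_mem_obsSpan (s := fun r => ℒ.x r ∘ Sum.inr) hr j)⟩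
    rcases Nat.lt_succ_iff_lt_or_eq.1 hr with hr | rfl
    · exact Submodule.mem_sup_left (fst_mem_obsSpan hr i)
    · rw [← sub_add_cancel (ℒ.y r i) (comb S.C₁ (ℒ.xTilde r) i), ← hinl]
      exact Submodule.add_mem _ (Submodule.mem_sup_right (Submodule.subset_span ⟨_, rfl⟩))
        (Submodule.mem_sup_left (comb_mem _ (ℒ.xTilde_mem r) i))
  refine innerMatrix_projection_error (V := ℒ.obs t (t + 1)) (U := ℒ.obs (t + 1) (t + 2))
    (η := η) (ω := ℒ.w t ∘ Sum.inl) (Setup.obsCov_posDef hW₂₂) (ℒ.xTilde_orth t) ?_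
    (fun i u hu => ℒ.inner_w_of_mem_obs hu _) ?_ ?_ ?_ ?_ ?_ ?_ ?_ (fun i => ?_)
    (ℒ.xTilde_mem (t + 1)) (ℒ.xTilde_orth (t + 1))
  · rintro (i | i) u hu
    · exact ℒ.inner_v_of_mem_obs hu _
    · exact ℒ.inner_w_of_mem_obs hu _
  · ext (i | i) (j | j)
    · simp [innerMatrix, hη, Setup.obsCov, ℒ.inner_v_v]
    · simp [innerMatrix, hη, Setup.obsCov, real_inner_comm (ℒ.w t _), ℒ.inner_w_v]
    · simp [innerMatrix, hη, Setup.obsCov, ℒ.inner_w_v]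
    · simp [innerMatrix, hη, Setup.obsCov, ℒ.inner_w_w, Setup.W]
  · ext i j
    simp [innerMatrix, ℒ.inner_w_w, Setup.W]
  · ext i (j | j)
    · exact (ℒ.predErr_mem_past t i t le_rfl).2 j
    · exact (ℒ.predErr_mem_past t i t le_rfl).1 _
  · ext i j
    exact (ℒ.predErr_mem_past t i t le_rfl).1 _
  · ext (i | i) j
    · simp [innerMatrix, hη, real_inner_comm (ℒ.w t _), ℒ.inner_w_v]
    · simp [innerMatrix, hη, ℒ.inner_w_w, Setup.W]
  · rintro (i | j)
    · rw [hinl]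
      exact Submodule.sub_mem _ (fst_mem_obsSpan t.lt_succ_self i)
        (hmono (comb_mem _ (ℒ.xTilde_mem t) i))
    · rw [hinr]
      refine Submodule.sub_mem _ (snd_mem_obsSpan (s := fun r => ℒ.x r ∘ Sum.inr)
        (t + 1).lt_succ_self j) (Submodule.add_mem _ (Submodule.add_mem _
          (hmono (comb_mem _ (ℒ.xTilde_mem t) j)) (hmono (hx2 j)))
          (hmono' (ℒ.feedback_mem t _)))
  · obtain ⟨h1, h2, h3⟩ := obsSpan_le.1 hle
    refine obsSpan_le.2 ⟨h1, h2, fun r hr j => ?_⟩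
    rcases Nat.lt_succ_iff_lt_or_eq.1 hr with hr | rfl
    · exact h3 r hr j
    · rw [Function.comp_apply, ← sub_add_cancel (ℒ.x (t + 1) (Sum.inr j))
        (comb S.A.toBlocks₂₁ (ℒ.xTilde t) j + comb S.A.toBlocks₂₂ (ℒ.x t ∘ Sum.inr) j
        + ℒ.feedback t (Sum.inr j)), ← hinr]
      exact Submodule.add_mem _ (Submodule.mem_sup_right (Submodule.subset_span ⟨_, rfl⟩))
        (Submodule.add_mem _ (Submodule.add_mem _
          (Submodule.mem_sup_left (comb_mem _ (ℒ.xTilde_mem t) j))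
          (Submodule.mem_sup_left (hx2 j))) (hle (ℒ.feedback_mem t _)))
  -- The rest of the next first block is predictable part, side information and feedback, all
  -- contained in the new data.
  · have h1 : (ℒ.x (t + 1) ∘ Sum.inl - (comb S.A.toBlocks₁₁ (ℒ.predErr t) + ℒ.w t ∘ Sum.inl)) i
        = comb S.A.toBlocks₁₁ (ℒ.xTilde t) i + comb S.A.toBlocks₁₂ (ℒ.x t ∘ Sum.inr) i
          + ℒ.feedback t (Sum.inl i) := by
      rw [ℒ.dynamics, predErr, comb_sub]
      simp only [Pi.sub_apply, Pi.add_apply, Function.comp_apply, comb_blocks_inl S.A, feedback]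
      abel
    rw [h1]
    exact Submodule.add_mem _ (Submodule.add_mem _ (hmono (comb_mem _ (ℒ.xTilde_mem t) i))
      (hmono (comb_mem _ (fun j => snd_mem_obsSpan (s := fun r => ℒ.x r ∘ Sum.inr)
        t.lt_succ_self j) i))) (hmono' (ℒ.feedback_mem t _))

theorem innerMatrix_estErr_eq_iterate (hW₂₂ : S.W₂₂.PosDef) (t : ℕ) :
    innerMatrix (ℒ.estErr t) (ℒ.estErr t)
      = S.correct (S.predict^[t] (innerMatrix (ℒ.predErr 0) (ℒ.predErr 0))) := by
  rw [innerMatrix_estErr]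
  congr 1
  induction t with
  | zero => rfl
  | succ t ih => rw [ℒ.innerMatrix_predErr_succ hW₂₂, ih, Function.iterate_succ_apply']

end L2Loop

/-! ### Random vectors as families in `L²` -/

section CoordLp

open scoped RealInnerProductSpace

variable {Ω : Type*} [MeasurableSpace Ω] {μ : Measure Ω} {ι κ : Type*} [Fintype ι] [Fintype κ]

/-- The coordinates of a square integrable random vector, as elements of `L²`. -/
def coordLp {X : Ω → EuclideanSpace ℝ ι} (h : MemLp X 2 μ) (i : ι) : Lp ℝ 2 μ :=
  (h.eval_piLp i).toLp _

variable {X X' : Ω → EuclideanSpace ℝ ι} {Y : Ω → EuclideanSpace ℝ κ}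

theorem coordLp_congr (h : MemLp X 2 μ) (h' : MemLp X' 2 μ) (hXX' : X =ᵐ[μ] X') :
    coordLp h = coordLp h' := by
  ext1 i
  exact MemLp.toLp_congr _ _ (hXX'.mono fun ω hω => by simp only [hω])

theorem inner_toLp {f g : Ω → ℝ} (hf : MemLp f 2 μ) (hg : MemLp g 2 μ) :
    ⟪hf.toLp f, hg.toLp g⟫ = ∫ ω, f ω * g ω ∂μ := by
  rw [L2.inner_def]
  refine integral_congr_ae ?_
  filter_upwards [hf.coeFn_toLp, hg.coeFn_toLp] with ω h1 h2
  rw [h1, h2]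
  simp [mul_comm]

theorem inner_coordLp (h : MemLp X 2 μ) (h' : MemLp Y 2 μ) (i : ι) (j : κ) :
    ⟪coordLp h i, coordLp h' j⟫ = crossMoment μ X Y i j := inner_toLp _ _

variable (μ) in
/-- The constant `1` in `L²`. -/
def oneLp [IsFiniteMeasure μ] : Lp ℝ 2 μ := (memLp_const (1 : ℝ)).toLp _

theorem inner_oneLp_coordLp [IsFiniteMeasure μ] (h : MemLp X 2 μ) (i : ι) :
    ⟪oneLp μ, coordLp h i⟫ = mean μ X i := by
  rw [oneLp, coordLp, inner_toLp]
  simp [mean]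

theorem toLp_sum_mul (c : κ → ℝ) (h : MemLp Y 2 μ)
    (hs : MemLp (fun ω => ∑ j, c j * Y ω j) 2 μ) :
    hs.toLp _ = ∑ j, c j • coordLp h j := by
  refine Lp.ext ?_
  filter_upwards [hs.coeFn_toLp, Lp.coeFn_fun_finsetSum Finset.univ fun j => c j • coordLp h j,
    ae_all_iff.2 fun j => Lp.coeFn_smul (c j) (coordLp h j),
    ae_all_iff.2 fun j => (h.eval_piLp j).coeFn_toLp] with ω h1 h2 h3 h4
  rw [h1, h2]
  refine Finset.sum_congr rfl fun j _ => ?_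
  rw [h3 j, Pi.smul_apply, smul_eq_mul, coordLp, h4 j]

theorem memLp_toEuclideanLin [DecidableEq κ] (M : Matrix ι κ ℝ) (h : MemLp Y 2 μ) :
    MemLp (fun ω => M.toEuclideanLin (Y ω)) 2 μ :=
  (LinearMap.toContinuousLinearMap M.toEuclideanLin).comp_memLp' h

theorem coordLp_toEuclideanLin [DecidableEq κ] (M : Matrix ι κ ℝ) (h : MemLp Y 2 μ) :
    coordLp (memLp_toEuclideanLin M h) = comb M (coordLp h) := by
  ext1 i
  exact toLp_sum_mul (M i) h _

theorem memLp_stack (h : MemLp X 2 μ) (h' : MemLp Y 2 μ) :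
    MemLp (fun ω => stack (X ω) (Y ω)) 2 μ := by
  refine MemLp.of_eval_piLp ?_
  rintro (i | i)
  · exact h.eval_piLp i
  · exact h'.eval_piLp i

theorem coordLp_stack (h : MemLp X 2 μ) (h' : MemLp Y 2 μ) :
    coordLp (memLp_stack h h') = Sum.elim (coordLp h) (coordLp h') := by
  ext1 (i | i) <;> rfl

theorem memLp_fstBlock {Z : Ω → EuclideanSpace ℝ (ι ⊕ κ)} (h : MemLp Z 2 μ) :
    MemLp (fun ω => fstBlock (Z ω)) 2 μ :=
  MemLp.of_eval_piLp fun i => h.eval_piLp (Sum.inl i)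

theorem memLp_sndBlock {Z : Ω → EuclideanSpace ℝ (ι ⊕ κ)} (h : MemLp Z 2 μ) :
    MemLp (fun ω => sndBlock (Z ω)) 2 μ :=
  MemLp.of_eval_piLp fun i => h.eval_piLp (Sum.inr i)

theorem coordLp_fstBlock {Z : Ω → EuclideanSpace ℝ (ι ⊕ κ)} (h : MemLp Z 2 μ) :
    coordLp (memLp_fstBlock h) = coordLp h ∘ Sum.inl := rfl

theorem coordLp_sndBlock {Z : Ω → EuclideanSpace ℝ (ι ⊕ κ)} (h : MemLp Z 2 μ) :
    coordLp (memLp_sndBlock h) = coordLp h ∘ Sum.inr := rfl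

/-- The square integrable functions whose class belongs to a subspace of `L²`. -/
def functionsOf (V : Submodule ℝ (Lp ℝ 2 μ)) : Submodule ℝ (Ω → ℝ) where
  carrier := {f | ∃ h : MemLp f 2 μ, h.toLp f ∈ V}
  add_mem' := by
    rintro f g ⟨hf, hf'⟩ ⟨hg, hg'⟩
    exact ⟨hf.add hg, V.add_mem hf' hg'⟩
  zero_mem' := ⟨MemLp.zero, V.zero_mem⟩
  smul_mem' := by
    rintro c f ⟨hf, hf'⟩
    exact ⟨hf.const_smul c, V.smul_mem c hf'⟩

/-- Lets pointwise identities between functions settle membership of their classes. -/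
theorem mem_functionsOf {V : Submodule ℝ (Lp ℝ 2 μ)} {f : Ω → ℝ} (h : MemLp f 2 μ) :
    f ∈ functionsOf V ↔ h.toLp f ∈ V := ⟨fun ⟨_, h'⟩ => h', fun h' => ⟨h, h'⟩⟩

end CoordLp

/-! ### Moments of the primitive random variables -/

section Moments

variable {Ω : Type*} [MeasurableSpace Ω] {μ : Measure Ω} {ι : Type*} [Fintype ι]

theorem crossMoment_eq_zero_of_indepFun {ι κ : Type*} {X : Ω → EuclideanSpace ℝ ι}
    {Y : Ω → EuclideanSpace ℝ κ}
    (h : IndepFun X Y μ) (hX : AEStronglyMeasurable X μ) (hY : AEStronglyMeasurable Y μ)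
    (hY0 : mean μ Y = 0) : crossMoment μ X Y = 0 := by
  ext i j
  have hij := h.comp (φ := fun x : EuclideanSpace ℝ ι => x i)
    (ψ := fun y : EuclideanSpace ℝ κ => y j) (by fun_prop) (by fun_prop)
  have := hij.integral_fun_mul_eq_mul_integral
    ((by fun_prop : Continuous fun x : EuclideanSpace ℝ ι => x i).comp_aestronglyMeasurable hX)
    ((by fun_prop : Continuous fun x : EuclideanSpace ℝ κ => x j).comp_aestronglyMeasurable hY)
  have h0 : ∫ ω, Y ω j ∂μ = 0 := congrFun hY0 j
  exact this.trans (by simp [h0])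

variable [DecidableEq ι] {X : Ω → EuclideanSpace ℝ ι} {W : Matrix ι ι ℝ}

theorem hasGaussianLaw_of_map_eq (h : μ.map X = multivariateGaussian 0 W) :
    HasGaussianLaw X μ := ⟨by rw [h]; infer_instance⟩

theorem mean_of_map_eq (hX : Measurable X) (h : μ.map X = multivariateGaussian 0 W) :
    mean μ X = 0 := by
  have hint : Integrable X μ := (hasGaussianLaw_of_map_eq h).integrable
  ext i
  have h1 : ∫ ω, X ω ∂μ = 0 := by
    have := integral_id_multivariateGaussian (μ := (0 : EuclideanSpace ℝ ι)) (S := W)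
    rwa [← h, integral_map hX.aemeasurable (by fun_prop)] at this
  rw [mean, ← eval_integral_piLp fun i => hint.eval_piLp i, h1]
  rfl

theorem crossMoment_of_map_eq (hW : W.PosSemidef) (hX : Measurable X)
    (h : μ.map X = multivariateGaussian 0 W) : crossMoment μ X X = W := by
  have hmem : MemLp X 2 μ := (hasGaussianLaw_of_map_eq h).memLp_two
  have : IsProbabilityMeasure μ := (hasGaussianLaw_of_map_eq h).isProbabilityMeasure
  ext i j
  have h1 := covariance_eval_multivariateGaussian (μ := (0 : EuclideanSpace ℝ ι)) hW i j
  rw [← h, covariance_map (by fun_prop) (by fun_prop) hX.aemeasurable] at h1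
  have h0 : ∫ ω, X ω i ∂μ = 0 := congrFun (mean_of_map_eq hX h) i
  have h2 : ∫ ω, X ω i * X ω j ∂μ - (∫ ω, X ω i ∂μ) * (∫ ω, X ω j ∂μ) = W i j :=
    (covariance_eq_sub (hmem.eval_piLp i) (hmem.eval_piLp j)).symm.trans h1
  rw [h0, zero_mul, sub_zero] at h2
  exact h2

end Moments

/-! ### Second moments of the loop noise and passage to `L²` -/

namespace FeedbackLoop

open scoped RealInnerProductSpace

variable {n m p : ℕ} {S : Setup n m p} {Ω : Type*} [MeasurableSpace Ω] {μ : Measure Ω}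
  (F : FeedbackLoop S μ)

theorem memLp_w (t : ℕ) : MemLp (F.w t) 2 μ :=
  (hasGaussianLaw_of_map_eq (F.w_law t)).memLp_two

theorem mean_w (t : ℕ) : mean μ (F.w t) = 0 := mean_of_map_eq (F.measurable_w t) (F.w_law t)

theorem crossMoment_w_w (hW : S.W.PosSemidef) (s t : ℕ) :
    crossMoment μ (F.w s) (F.w t) = if s = t then S.W else 0 := by
  split_ifs with h
  · subst h
    exact crossMoment_of_map_eq hW (F.measurable_w s) (F.w_law s)
  · exact crossMoment_eq_zero_of_indepFun (F.w_iIndep.indepFun h)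
      (F.measurable_w s).aestronglyMeasurable (F.measurable_w t).aestronglyMeasurable (F.mean_w t)

theorem crossMoment_x_w (t : ℕ) : crossMoment μ (F.x 0) (F.w t) = 0 :=
  crossMoment_eq_zero_of_indepFun
    (F.x_zero_indep.comp (φ := id) (ψ := fun q : (ℕ → EuclideanSpace ℝ (Fin n ⊕ Fin m)) ×
      (ℕ → EuclideanSpace ℝ (Fin n)) => q.1 t) measurable_id (by fun_prop))
    F.measurable_x_zero.aestronglyMeasurable (F.measurable_w t).aestronglyMeasurable (F.mean_w t)

theorem coordLp_x_succ {t : ℕ} (hx : MemLp (F.x t) 2 μ) (hH : MemLp (F.xHat t) 2 μ)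
    (hx' : MemLp (F.x (t + 1)) 2 μ) : coordLp hx' = comb S.A (coordLp hx)
      + comb (S.B * S.K) (Sum.elim (coordLp hH) (coordLp hx ∘ Sum.inr)) + coordLp (F.memLp_w t) := by
  have h1 := memLp_toEuclideanLin S.A hx
  have h2 := memLp_stack hH (memLp_sndBlock hx)
  have h3 := memLp_toEuclideanLin S.K h2
  have h4 := memLp_toEuclideanLin S.B h3
  rw [coordLp_congr hx' ((h1.add h4).add (F.memLp_w t)) (Eventually.of_forall (F.dynamics t)),
    ← comb_comb]
  rw [show coordLp ((h1.add h4).add (F.memLp_w t))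
      = coordLp h1 + coordLp h4 + coordLp (F.memLp_w t) from rfl, coordLp_toEuclideanLin S.A hx,
    coordLp_toEuclideanLin S.B h3, coordLp_toEuclideanLin S.K h2,
    coordLp_stack hH (memLp_sndBlock hx), coordLp_sndBlock]

/-- The Hilbert space description of a feedback loop whose sensor noise `v` and estimates have the
required second order properties. -/
def toL2Loop [IsProbabilityMeasure μ] (hW : S.W.PosSemidef)
    (hx : ∀ t, MemLp (F.x t) 2 μ)
    (hT : ∀ t, MemLp (F.xTilde t) 2 μ) (hH : ∀ t, MemLp (F.xHat t) 2 μ)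
    {v : ℕ → Ω → EuclideanSpace ℝ (Fin n)} (hv : ∀ t, MemLp (v t) 2 μ)
    (hv1 : ∀ t, mean μ (v t) = 0) (hvx : ∀ t, crossMoment μ (F.x 0) (v t) = 0)
    (hvw : ∀ s t, crossMoment μ (F.w s) (v t) = 0)
    (hvv : ∀ s t, crossMoment μ (v s) (v t) = if s = t then 1 else 0)
    {y : ℕ → Fin n → Lp ℝ 2 μ}
    (hy : ∀ t, y t = comb S.C₁ (coordLp (hx t) ∘ Sum.inl) + coordLp (hv t))
    (hTm : ∀ t i, coordLp (hT t) i ∈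
      obsSpan (oneLp μ) y (fun r => coordLp (hx r) ∘ Sum.inr) t (t + 1))
    (hTo : ∀ t i, ∀ u ∈ obsSpan (oneLp μ) y (fun r => coordLp (hx r) ∘ Sum.inr) t (t + 1),
      ⟪coordLp (hx t) (Sum.inl i) - coordLp (hT t) i, u⟫ = 0)
    (hHm : ∀ t i, coordLp (hH t) i ∈
      obsSpan (oneLp μ) y (fun r => coordLp (hx r) ∘ Sum.inr) (t + 1) (t + 1))
    (hHo : ∀ t i, ∀ u ∈ obsSpan (oneLp μ) y (fun r => coordLp (hx r) ∘ Sum.inr) (t + 1) (t + 1),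
      ⟪coordLp (hx t) (Sum.inl i) - coordLp (hH t) i, u⟫ = 0) :
    L2Loop S (Lp ℝ 2 μ) where
  one := oneLp μ
  x t := coordLp (hx t)
  w t := coordLp (F.memLp_w t)
  v t := coordLp (hv t)
  y := y
  xTilde t := coordLp (hT t)
  xHat t := coordLp (hH t)
  inner_one_one := by rw [oneLp, inner_toLp]; simp
  inner_one_w t i := by rw [inner_oneLp_coordLp, F.mean_w]; rfl
  inner_one_v t i := by rw [inner_oneLp_coordLp, hv1]; rfl
  inner_x_w t i j := by rw [inner_coordLp, F.crossMoment_x_w]; rfl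
  inner_x_v t i j := by rw [inner_coordLp, hvx]; rfl
  inner_w_v s t i j := by rw [inner_coordLp, hvw]; rfl
  inner_w_w s t i j := by rw [inner_coordLp, F.crossMoment_w_w hW]; split_ifs <;> rfl
  inner_v_v s t i j := by rw [inner_coordLp, hvv]; split_ifs <;> rfl
  dynamics t := F.coordLp_x_succ (hx t) (hH t) (hx (t + 1))
  sensor := hy
  xTilde_mem := hTm
  xTilde_orth := hTo
  xHat_mem := hHm
  xHat_orth := hHo

end FeedbackLoop

/-! ### Dithered quantization noise -/

section Dither

/-- The error of the scalar uniform quantizer. -/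
def quantError (Δ u : ℝ) : ℝ := (⌊u / Δ + 1 / 2⌋ : ℝ) * Δ - u

variable {Δ : ℝ}

theorem measurable_quantError : Measurable (quantError Δ) := by
  unfold quantError
  fun_prop

theorem abs_quantError_le (hΔ : 0 < Δ) (u : ℝ) : |quantError Δ u| ≤ Δ / 2 := by
  have h1 := Int.floor_le (u / Δ + 1 / 2)
  have h2 := Int.lt_floor_add_one (u / Δ + 1 / 2)
  have h3 : u = u / Δ * Δ := by field_simp
  have h4 : quantError Δ u = ((⌊u / Δ + 1 / 2⌋ : ℝ) - u / Δ) * Δ := by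
    rw [quantError, sub_mul, ← h3]
  rw [h4, abs_le]
  constructor <;> nlinarith

theorem quantError_periodic (hΔ : 0 < Δ) : Function.Periodic (quantError Δ) Δ := fun u => by
  have : (u + Δ) / Δ + 1 / 2 = u / Δ + 1 / 2 + 1 := by field_simp; ring
  rw [quantError, this, Int.floor_add_one, quantError]
  push_cast
  ring

theorem quantError_of_mem (hΔ : 0 < Δ) {u : ℝ} (hu : u ∈ Set.Ico (-(Δ / 2)) (Δ / 2)) :
    quantError Δ u = -u := by
  have : ⌊u / Δ + 1 / 2⌋ = 0 := by
    rw [Int.floor_eq_zero_iff]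
    have h : u / Δ + 1 / 2 = (u + Δ / 2) / Δ := by field_simp
    rw [h]
    exact ⟨div_nonneg (by linarith [hu.1]) hΔ.le, (div_lt_one hΔ).2 (by linarith [hu.2])⟩
  rw [quantError, this]
  simp

/-- Averages of a function of the quantization error over the dither do not depend on the
quantized value. -/
theorem setIntegral_comp_quantError (hΔ : 0 < Δ) (f : ℝ → ℝ) (z : ℝ) :
    ∫ d in Set.Ico (-(Δ / 2)) (Δ / 2), f (quantError Δ (z + d)) = ∫ u in -(Δ / 2)..Δ / 2, f (-u) := by
  have hle : -(Δ / 2) ≤ Δ / 2 := by linarith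
  have hper : Function.Periodic (fun u => f (quantError Δ u)) Δ := fun u => by
    simp only [quantError_periodic hΔ u]
  rw [integral_Ico_eq_integral_Ioc, ← intervalIntegral.integral_of_le hle,
    intervalIntegral.integral_comp_add_left (fun u => f (quantError Δ u)) z]
  have h1 : z + Δ / 2 = (z + -(Δ / 2)) + Δ := by ring
  have h2 : Δ / 2 = -(Δ / 2) + Δ := by ring
  -- The dither covers exactly one period, so the shift by `z` can be undone; on the central cell
  -- the error is `-u`.
  rw [h1, hper.intervalIntegral_add_eq _ (-(Δ / 2)), ← h2, intervalIntegral.integral_of_le hle,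
    intervalIntegral.integral_of_le hle, ← integral_Ico_eq_integral_Ioc,
    ← integral_Ico_eq_integral_Ioc]
  refine setIntegral_congr_fun measurableSet_Ico fun u hu => ?_
  simp only [quantError_of_mem hΔ hu]

variable {Ω : Type*} [MeasurableSpace Ω] {μ : Measure Ω} {D : Ω → ℝ}

theorem integral_map_uniform (hΔ : 0 < Δ)
    (h : pdf.IsUniform D (Set.Ico (-(Δ / 2)) (Δ / 2)) μ volume) (f : ℝ → ℝ) :
    ∫ d, f d ∂(μ.map D) = Δ⁻¹ * ∫ d in Set.Ico (-(Δ / 2)) (Δ / 2), f d := by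
  have h' : μ.map D = _ := h
  rw [h', ProbabilityTheory.cond, integral_smul_measure, Real.volume_Ico,
    show Δ / 2 - -(Δ / 2) = Δ by ring, ENNReal.toReal_inv, ENNReal.toReal_ofReal hΔ.le, smul_eq_mul]

theorem integral_quantError (hΔ : 0 < Δ)
    (h : pdf.IsUniform D (Set.Ico (-(Δ / 2)) (Δ / 2)) μ volume) (z : ℝ) :
    ∫ d, quantError Δ (z + d) ∂(μ.map D) = 0 := by
  rw [integral_map_uniform hΔ h, setIntegral_comp_quantError hΔ fun u => u,
    intervalIntegral.integral_neg, integral_id]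
  simp

theorem integral_quantError_sq (hΔ : 0 < Δ)
    (h : pdf.IsUniform D (Set.Ico (-(Δ / 2)) (Δ / 2)) μ volume) (z : ℝ) :
    ∫ d, quantError Δ (z + d) ^ 2 ∂(μ.map D) = Δ ^ 2 / 12 := by
  rw [integral_map_uniform hΔ h, setIntegral_comp_quantError hΔ fun u => u ^ 2]
  simp only [even_two, Even.neg_pow, integral_pow]
  norm_num
  field_simp
  ring

variable [IsProbabilityMeasure μ] {β : Type*} [MeasurableSpace β] {T : Ω → β} {Z G : Ω → ℝ}

/-- The quantization error is uncorrelated with everything that is independent of the dither. -/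
theorem integral_quantError_mul (hΔ : 0 < Δ) (hD : Measurable D) (hT : Measurable T)
    (h : pdf.IsUniform D (Set.Ico (-(Δ / 2)) (Δ / 2)) μ volume) (hDT : IndepFun D T μ)
    (hZ : Measurable[MeasurableSpace.comap T inferInstance] Z)
    (hG : Measurable[MeasurableSpace.comap T inferInstance] G) (hGi : Integrable G μ) :
    ∫ ω, quantError Δ (Z ω + D ω) * G ω ∂μ = 0 := by
  have hle : MeasurableSpace.comap T inferInstance ≤ (inferInstance : MeasurableSpace Ω) :=
    hT.comap_le
  have hZG : Measurable fun ω => (Z ω, G ω) := (hZ.mono hle le_rfl).prodMk (hG.mono hle le_rfl)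
  -- The input and the test variable are functions of `T`, so the dither is independent of the two
  -- jointly, not merely of each one.
  have hind : IndepFun D (fun ω => (Z ω, G ω)) μ :=
    indep_of_indep_of_le_right hDT (hZ.prodMk hG).comap_le
  have hlaw := (indepFun_iff_map_prod_eq_prod_map_map hD.aemeasurable hZG.aemeasurable).1 hind
  have : IsProbabilityMeasure (μ.map D) := Measure.isProbabilityMeasure_map hD.aemeasurable
  have : IsProbabilityMeasure (μ.map fun ω => (Z ω, G ω)) :=
    Measure.isProbabilityMeasure_map hZG.aemeasurable
  have hmeas : Measurable fun q : ℝ × ℝ × ℝ => quantError Δ (q.2.1 + q.1) * q.2.2 :=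
    (measurable_quantError.comp (by fun_prop)).mul (by fun_prop)
  have hint : Integrable (fun q : ℝ × ℝ × ℝ => quantError Δ (q.2.1 + q.1) * q.2.2)
      ((μ.map D).prod (μ.map fun ω => (Z ω, G ω))) := by
    rw [← hlaw, integrable_map_measure hmeas.aestronglyMeasurable (hD.prodMk hZG).aemeasurable]
    exact hGi.bdd_mul (c := Δ / 2) (measurable_quantError.comp
      ((hZ.mono hle le_rfl).add hD)).aestronglyMeasurable
      (Eventually.of_forall fun ω => abs_quantError_le hΔ _)
  calc ∫ ω, quantError Δ (Z ω + D ω) * G ω ∂μ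
      = ∫ q, quantError Δ (q.2.1 + q.1) * q.2.2 ∂(μ.map fun ω => (D ω, Z ω, G ω)) :=
        (integral_map (hD.prodMk hZG).aemeasurable hmeas.aestronglyMeasurable).symm
    _ = 0 := by
      -- Fubini with the dither innermost: for a frozen input the error averages to zero.
      rw [hlaw, integral_prod_symm _ hint]
      simp [integral_mul_const, integral_quantError hΔ h]

/-- For each frozen input the second moment over the dither is that of a uniform variable, so the
law of `Z` is irrelevant. -/
theorem integral_quantError_add_sq (hΔ : 0 < Δ) (hD : Measurable D) (hT : Measurable T)
    (h : pdf.IsUniform D (Set.Ico (-(Δ / 2)) (Δ / 2)) μ volume) (hDT : IndepFun D T μ)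
    (hZ : Measurable[MeasurableSpace.comap T inferInstance] Z) :
    ∫ ω, quantError Δ (Z ω + D ω) ^ 2 ∂μ = Δ ^ 2 / 12 := by
  have hle : MeasurableSpace.comap T inferInstance ≤ (inferInstance : MeasurableSpace Ω) :=
    hT.comap_le
  have hZ' : Measurable Z := hZ.mono hle le_rfl
  have hind : IndepFun D Z μ := indep_of_indep_of_le_right hDT hZ.comap_le
  have hlaw := (indepFun_iff_map_prod_eq_prod_map_map hD.aemeasurable hZ'.aemeasurable).1 hind
  have : IsProbabilityMeasure (μ.map D) := Measure.isProbabilityMeasure_map hD.aemeasurable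
  have : IsProbabilityMeasure (μ.map Z) := Measure.isProbabilityMeasure_map hZ'.aemeasurable
  have hmeas : Measurable fun q : ℝ × ℝ => quantError Δ (q.2 + q.1) ^ 2 :=
    (measurable_quantError.comp (by fun_prop)).pow_const 2
  have hint : Integrable (fun q : ℝ × ℝ => quantError Δ (q.2 + q.1) ^ 2)
      ((μ.map D).prod (μ.map Z)) := by
    refine Integrable.of_bound hmeas.aestronglyMeasurable ((Δ / 2) ^ 2)
      (Eventually.of_forall fun q => ?_)
    rw [norm_pow]
    exact pow_le_pow_left₀ (norm_nonneg _) (abs_quantError_le hΔ _) 2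
  calc ∫ ω, quantError Δ (Z ω + D ω) ^ 2 ∂μ
      = ∫ q, quantError Δ (q.2 + q.1) ^ 2 ∂(μ.map fun ω => (D ω, Z ω)) :=
        (integral_map (hD.prodMk hZ').aemeasurable hmeas.aestronglyMeasurable).symm
    _ = Δ ^ 2 / 12 := by
      rw [hlaw, integral_prod_symm _ hint]
      simp [integral_quantError_sq hΔ h]

end Dither

/-! ### Independence -/

section Indep

variable {Ω : Type*} [MeasurableSpace Ω] {μ : Measure Ω} [IsProbabilityMeasure μ]
  {α β γ : Type*} [MeasurableSpace α] [MeasurableSpace β] [MeasurableSpace γ]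
  {X : Ω → α} {Y : Ω → β} {Z : Ω → γ}

/-- The hypotheses make the joint law of the three variables a product measure, and permuting
factors keeps it one. -/
theorem indepFun_prodMk_rotate (hX : Measurable X) (hY : Measurable Y) (hZ : Measurable Z)
    (h : IndepFun X (fun ω => (Y ω, Z ω)) μ) (h' : IndepFun Y Z μ) :
    IndepFun Y (fun ω => (X ω, Z ω)) μ := by
  have hXZ : IndepFun X Z μ := h.comp measurable_id measurable_snd
  have l1 := (indepFun_iff_map_prod_eq_prod_map_map hX.aemeasurable
    (hY.prodMk hZ).aemeasurable).1 h
  rw [(indepFun_iff_map_prod_eq_prod_map_map hY.aemeasurable hZ.aemeasurable).1 h'] at l1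
  rw [indepFun_iff_map_prod_eq_prod_map_map hY.aemeasurable (hX.prodMk hZ).aemeasurable,
    (indepFun_iff_map_prod_eq_prod_map_map hX.aemeasurable hZ.aemeasurable).1 hXZ]
  have : IsProbabilityMeasure (μ.map X) := Measure.isProbabilityMeasure_map hX.aemeasurable
  have : IsProbabilityMeasure (μ.map Y) := Measure.isProbabilityMeasure_map hY.aemeasurable
  have : IsProbabilityMeasure (μ.map Z) := Measure.isProbabilityMeasure_map hZ.aemeasurable
  have h1 : μ.map (fun ω => (Y ω, X ω, Z ω))
      = (μ.map fun ω => (X ω, Y ω, Z ω)).map fun q => (q.2.1, q.1, q.2.2) := by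
    rw [Measure.map_map (by fun_prop) (by fun_prop)]
    rfl
  have h2 : (fun q : α × β × γ => (q.2.1, q.1, q.2.2)) ∘ MeasurableEquiv.prodAssoc
      = MeasurableEquiv.prodAssoc ∘ Prod.map Prod.swap (id : γ → γ) := rfl
  rw [h1, l1, ← Measure.prodAssoc_prod, Measure.map_map (by fun_prop) (by fun_prop), h2,
    ← Measure.map_map (by fun_prop) (by fun_prop),
    ← Measure.map_prod_map _ _ measurable_swap measurable_id, Measure.prod_swap, Measure.map_id,
    Measure.prodAssoc_prod]

end Indep

/-! ### Information carried by the primitive variables before a given time -/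

namespace FeedbackLoop

variable {n m p : ℕ} {S : Setup n m p} {Ω : Type*} [MeasurableSpace Ω] {μ : Measure Ω}
  (F : FeedbackLoop S μ)

theorem e_indep_x_w [IsProbabilityMeasure μ] :
    IndepFun (fun ω t => F.e t ω) (fun ω => (F.x 0 ω, fun t => F.w t ω)) μ :=
  indepFun_prodMk_rotate F.measurable_x_zero (measurable_pi_iff.2 F.measurable_e)
    (measurable_pi_iff.2 F.measurable_w)
    (F.x_zero_indep.comp measurable_id measurable_swap) F.w_indep_e.symm

/-- The initial state, the whole process noise and the sensor randomness before time `t`. -/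
def primitives (t : ℕ) (ω : Ω) : EuclideanSpace ℝ (Fin n ⊕ Fin m) ×
    (ℕ → EuclideanSpace ℝ (Fin n ⊕ Fin m)) × (ℕ → EuclideanSpace ℝ (Fin n)) :=
  (F.x 0 ω, fun s => F.w s ω, fun s => if s < t then F.e s ω else 0)

theorem measurable_ite_lt (t : ℕ) :
    Measurable fun (q : ℕ → EuclideanSpace ℝ (Fin n)) s => if s < t then q s else 0 :=
  measurable_pi_iff.2 fun s => by split_ifs <;> fun_prop

theorem measurable_primitives (t : ℕ) : Measurable (F.primitives t) :=
  F.measurable_x_zero.prodMk ((measurable_pi_iff.2 F.measurable_w).prodMk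
    ((measurable_ite_lt t).comp (measurable_pi_iff.2 F.measurable_e)))

/-- The σ-algebra generated by `primitives`. -/
abbrev primitiveSigma (t : ℕ) : MeasurableSpace Ω :=
  MeasurableSpace.comap (F.primitives t) inferInstance

theorem primitiveSigma_le (t : ℕ) : F.primitiveSigma t ≤ (inferInstance : MeasurableSpace Ω) :=
  (F.measurable_primitives t).comap_le

theorem primitiveSigma_mono {s t : ℕ} (h : s ≤ t) : F.primitiveSigma s ≤ F.primitiveSigma t := by
  have h1 : F.primitives s = (fun q => (q.1, q.2.1, fun r => if r < s then q.2.2 r else 0)) ∘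
      F.primitives t := by
    ext ω : 1
    simp only [primitives, Function.comp_apply, Prod.mk.injEq, true_and]
    ext1 r
    split_ifs <;> first | rfl | omega
  have h2 : Measurable fun q : EuclideanSpace ℝ (Fin n ⊕ Fin m) ×
      (ℕ → EuclideanSpace ℝ (Fin n ⊕ Fin m)) × (ℕ → EuclideanSpace ℝ (Fin n)) =>
      (q.1, q.2.1, fun r => if r < s then q.2.2 r else 0) :=
    measurable_fst.prodMk (measurable_snd.fst.prodMk ((measurable_ite_lt s).comp
      measurable_snd.snd))
  rw [primitiveSigma, h1]
  exact (h2.comp (comap_measurable _)).comap_le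

theorem measurable_x_zero_primitive (t : ℕ) : Measurable[F.primitiveSigma t] (F.x 0) :=
  measurable_fst.comp (comap_measurable (F.primitives t))

theorem measurable_w_primitive (s t : ℕ) : Measurable[F.primitiveSigma t] (F.w s) :=
  (measurable_pi_apply s).comp (measurable_snd.fst.comp (comap_measurable (F.primitives t)))

theorem measurable_e_primitive {s t : ℕ} (h : s < t) : Measurable[F.primitiveSigma t] (F.e s) := by
  have h' : Measurable[F.primitiveSigma t] fun ω => (F.primitives t ω).2.2 s :=
    (measurable_pi_apply s).comp (measurable_snd.snd.comp (comap_measurable (F.primitives t)))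
  convert h' using 1
  ext1 ω
  simp [primitives, h]

/-- Independence over time separates the current dither from earlier ones, and the whole dither
sequence is independent of initial state and process noise; `indepFun_prodMk_rotate` merges the two
facts. Filling with zeros keeps the target space the same for all times. -/
theorem e_indep_primitives [IsProbabilityMeasure μ] (t : ℕ) : IndepFun (F.e t) (F.primitives t) μ := by
  have he : Measurable fun ω t => F.e t ω := measurable_pi_iff.2 F.measurable_e
  have hw : Measurable fun ω t => F.w t ω := measurable_pi_iff.2 F.measurable_w
  have h1 := F.e_iIndep.indepFun_finset {t} (Finset.range t) (by simp) F.measurable_e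
  have h2 : IndepFun (F.e t) (fun ω s => if s < t then F.e s ω else 0) μ := by
    have hψ : Measurable fun (q : Finset.range t → EuclideanSpace ℝ (Fin n)) (s : ℕ) =>
        if h : s < t then q ⟨s, Finset.mem_range.2 h⟩ else 0 :=
      measurable_pi_iff.2 fun s => by split_ifs <;> fun_prop
    have hφ : Measurable fun q : ({t} : Finset ℕ) → EuclideanSpace ℝ (Fin n) =>
        q ⟨t, Finset.mem_singleton_self t⟩ := measurable_pi_apply _
    have := h1.comp hφ hψ
    convert this using 1
    · rfl
    · funext ω s
      by_cases h : s < t <;> simp [h]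
  have h3 := indepFun_prodMk_rotate (X := fun ω => (F.x 0 ω, fun t => F.w t ω)) (Y := F.e t)
    (Z := fun ω s => if s < t then F.e s ω else 0) (F.measurable_x_zero.prodMk hw)
    (F.measurable_e t) ((measurable_ite_lt t).comp he)
    (F.e_indep_x_w.symm.comp measurable_id ((measurable_pi_apply t).prodMk (measurable_ite_lt t)))
    h2
  exact h3.comp (ψ := fun q => (q.1.1, q.1.2, q.2)) measurable_id (by fun_prop)

end FeedbackLoop

/-! ### Affine estimators -/

section Affine

open scoped RealInnerProductSpace

variable {Ω : Type*} {n m k l : ℕ} {y : ℕ → Ω → EuclideanSpace ℝ (Fin n)}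
  {s : ℕ → Ω → EuclideanSpace ℝ (Fin m)} {Z Z' : Ω → EuclideanSpace ℝ (Fin n)}

theorem IsAffineEstimator.add_smul (h : IsAffineEstimator y s k l Z)
    (h' : IsAffineEstimator y s k l Z') (c : ℝ) : IsAffineEstimator y s k l (Z + c • Z') := by
  obtain ⟨a, L, M, hZ⟩ := h
  obtain ⟨a', L', M', hZ'⟩ := h'
  refine ⟨a + c • a', L + c • L', M + c • M', fun ω => ?_⟩
  simp only [Pi.add_apply, Pi.smul_apply, hZ, hZ', map_add, map_smul, LinearMap.add_apply,
    LinearMap.smul_apply, Finset.sum_add_distrib, ← Finset.smul_sum, smul_add]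
  abel

theorem isAffineEstimator_single_const (i : Fin n) (c : ℝ) :
    IsAffineEstimator y s k l fun _ => EuclideanSpace.single i c :=
  ⟨EuclideanSpace.single i c, 0, 0, fun ω => by simp⟩

theorem toEuclideanLin_single {ι κ : Type*} [Fintype ι] [DecidableEq ι] [Fintype κ] [DecidableEq κ]
    (i : ι) (j : κ) (z : EuclideanSpace ℝ κ) :
    (Matrix.single i j (1 : ℝ)).toEuclideanLin z = EuclideanSpace.single i (z j) := by
  ext q
  simp [Matrix.toLpLin_apply, Matrix.single_mulVec, Function.update_apply]

/-- A test direction for the variational argument: it changes one coordinate of the estimate by one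
scalar observation. -/
theorem isAffineEstimator_single_fst {r : ℕ} (hr : r < k) (i j : Fin n) :
    IsAffineEstimator y s k l fun ω => EuclideanSpace.single i (y r ω j) := by
  refine ⟨0, Pi.single ⟨r, hr⟩ (Matrix.single i j 1), 0, fun ω => ?_⟩
  rw [Finset.sum_eq_single ⟨r, hr⟩ (fun q _ hq => by simp [Pi.single_eq_of_ne hq]) (by simp),
    Pi.single_eq_same, toEuclideanLin_single]
  simp [history]

theorem isAffineEstimator_single_snd {r : ℕ} (hr : r < l) (i : Fin n) (j : Fin m) :
    IsAffineEstimator y s k l fun ω => EuclideanSpace.single i (s r ω j) := by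
  refine ⟨0, 0, Pi.single ⟨r, hr⟩ (Matrix.single i j 1), fun ω => ?_⟩
  rw [Finset.sum_eq_single (a := (⟨r, hr⟩ : Fin l))
    (f := fun q => ((Pi.single (⟨r, hr⟩ : Fin l) (Matrix.single i j (1 : ℝ)) :
      Fin l → Matrix (Fin n) (Fin m) ℝ) q).toEuclideanLin ((history y s k l ω).2 q))
    (fun q _ hq => by simp [Pi.single_eq_of_ne hq]) (by simp),
    Pi.single_eq_same, toEuclideanLin_single]
  simp [history]

/-- Square integrability together with measurability with respect to a sub-σ-algebra. -/
def SqMeasurable (𝓜 : MeasurableSpace Ω) {mΩ : MeasurableSpace Ω} (μ : Measure Ω) {ι : Type*}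
    [Fintype ι] (X : Ω → EuclideanSpace ℝ ι) : Prop :=
  Measurable[𝓜] X ∧ MemLp X 2 μ

namespace SqMeasurable

variable {𝓜 𝓝' mΩ : MeasurableSpace Ω} {μ : Measure Ω} {ι κ : Type*}
  [Fintype ι] [Fintype κ] {X X' : Ω → EuclideanSpace ℝ ι} {Y : Ω → EuclideanSpace ℝ κ}

theorem mono (h : SqMeasurable 𝓜 μ X) (hle : 𝓜 ≤ 𝓝') : SqMeasurable 𝓝' μ X :=
  ⟨h.1.mono hle le_rfl, h.2⟩

theorem add (h : SqMeasurable 𝓜 μ X) (h' : SqMeasurable 𝓜 μ X') :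
    SqMeasurable 𝓜 μ fun ω => X ω + X' ω :=
  ⟨h.1.add h'.1, h.2.add h'.2⟩

theorem sub (h : SqMeasurable 𝓜 μ X) (h' : SqMeasurable 𝓜 μ X') :
    SqMeasurable 𝓜 μ fun ω => X ω - X' ω :=
  ⟨h.1.sub h'.1, h.2.sub h'.2⟩

theorem const [IsFiniteMeasure μ] (a : EuclideanSpace ℝ ι) : SqMeasurable 𝓜 μ fun _ => a :=
  ⟨measurable_const, memLp_const a⟩

theorem toEuclideanLin [DecidableEq κ] (M : Matrix ι κ ℝ) (h : SqMeasurable 𝓜 μ Y) :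
    SqMeasurable 𝓜 μ fun ω => M.toEuclideanLin (Y ω) :=
  ⟨(LinearMap.toContinuousLinearMap M.toEuclideanLin).continuous.measurable.comp h.1,
    memLp_toEuclideanLin M h.2⟩

theorem sum {α : Type*} (t : Finset α) {f : α → Ω → EuclideanSpace ℝ ι}
    (h : ∀ a ∈ t, SqMeasurable 𝓜 μ (f a)) : SqMeasurable 𝓜 μ fun ω => ∑ a ∈ t, f a ω :=
  ⟨Finset.measurable_fun_sum t fun a ha => (h a ha).1, memLp_finsetSum t fun a ha => (h a ha).2⟩

theorem fstBlock {Z : Ω → EuclideanSpace ℝ (ι ⊕ κ)} (h : SqMeasurable 𝓜 μ Z) :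
    SqMeasurable 𝓜 μ fun ω => fstBlock (Z ω) := by
  have : Measurable (LQGSideInfo.fstBlock : EuclideanSpace ℝ (ι ⊕ κ) → EuclideanSpace ℝ ι) := by
    unfold LQGSideInfo.fstBlock; fun_prop
  exact ⟨this.comp h.1, memLp_fstBlock h.2⟩

theorem sndBlock {Z : Ω → EuclideanSpace ℝ (ι ⊕ κ)} (h : SqMeasurable 𝓜 μ Z) :
    SqMeasurable 𝓜 μ fun ω => sndBlock (Z ω) := by
  have : Measurable (LQGSideInfo.sndBlock : EuclideanSpace ℝ (ι ⊕ κ) → EuclideanSpace ℝ κ) := by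
    unfold LQGSideInfo.sndBlock; fun_prop
  exact ⟨this.comp h.1, memLp_sndBlock h.2⟩

theorem stack (h : SqMeasurable 𝓜 μ X) (h' : SqMeasurable 𝓜 μ Y) :
    SqMeasurable 𝓜 μ fun ω => stack (X ω) (Y ω) := by
  have : Measurable fun q : EuclideanSpace ℝ ι × EuclideanSpace ℝ κ =>
      LQGSideInfo.stack q.1 q.2 := by
    unfold LQGSideInfo.stack
    refine (WithLp.measurable_toLp 2 _).comp (measurable_pi_iff.2 ?_)
    rintro (i | i) <;> simp only [Sum.elim_inl, Sum.elim_inr] <;> fun_prop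
  exact ⟨this.comp (h.1.prodMk h'.1), memLp_stack h.2 h'.2⟩

end SqMeasurable

variable {𝓜 mΩ : MeasurableSpace Ω} {μ : Measure Ω}
  {X : Ω → EuclideanSpace ℝ (Fin n)}

theorem IsAffineEstimator.sqMeasurable [IsFiniteMeasure μ] (h : IsAffineEstimator y s k l Z)
    (hy : ∀ r < k, SqMeasurable 𝓜 μ (y r)) (hs : ∀ r < l, SqMeasurable 𝓜 μ (s r)) :
    SqMeasurable 𝓜 μ Z := by
  obtain ⟨a, L, M, hZ⟩ := h
  have h1 : SqMeasurable 𝓜 μ fun ω => ∑ i : Fin k, (L i).toEuclideanLin (y i ω) :=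
    SqMeasurable.sum Finset.univ fun (i : Fin k) _ => (hy i i.2).toEuclideanLin (L i)
  have h2 : SqMeasurable 𝓜 μ fun ω => ∑ i : Fin l, (M i).toEuclideanLin (s i ω) :=
    SqMeasurable.sum Finset.univ fun (i : Fin l) _ => (hs i i.2).toEuclideanLin (M i)
  have h3 : Z = fun ω => a + ∑ i, (L i).toEuclideanLin (y i ω) + ∑ i, (M i).toEuclideanLin (s i ω) :=
    funext hZ
  rw [h3]
  exact ((SqMeasurable.const a).add h1).add h2

theorem IsAffineEstimator.coordLp_mem [IsFiniteMeasure μ] (h : IsAffineEstimator y s k l Z)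
    (hy : ∀ r, MemLp (y r) 2 μ) (hs : ∀ r, MemLp (s r) 2 μ) (hZ : MemLp Z 2 μ) (i : Fin n) :
    coordLp hZ i ∈ obsSpan (oneLp μ) (fun r => coordLp (hy r)) (fun r => coordLp (hs r)) k l := by
  obtain ⟨a, L, M, hZ'⟩ := h
  set V := obsSpan (oneLp μ) (fun r => coordLp (hy r)) (fun r => coordLp (hs r)) k l
  refine (mem_functionsOf (hZ.eval_piLp i)).1 ?_
  have h1 : (fun _ => 1 : Ω → ℝ) ∈ functionsOf V := (mem_functionsOf _).2 one_mem_obsSpan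
  have h2 : ∀ r : Fin k, ∀ j, (fun ω => y r ω j) ∈ functionsOf V := fun r j =>
    (mem_functionsOf ((hy r).eval_piLp j)).2
      (fst_mem_obsSpan (y := fun r => coordLp (hy r)) r.2 j)
  have h3 : ∀ r : Fin l, ∀ j, (fun ω => s r ω j) ∈ functionsOf V := fun r j =>
    (mem_functionsOf ((hs r).eval_piLp j)).2
      (snd_mem_obsSpan (s := fun r => coordLp (hs r)) r.2 j)
  have h4 : (fun ω => Z ω i) = a i • (fun _ => 1 : Ω → ℝ)
      + ∑ r : Fin k, ∑ j, L r i j • (fun ω => y r ω j)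
      + ∑ r : Fin l, ∑ j, M r i j • (fun ω => s r ω j) := by
    ext ω
    simp [hZ' ω, history, Matrix.mulVec, dotProduct, Finset.sum_apply]
  rw [h4]
  exact Submodule.add_mem _ (Submodule.add_mem _ (Submodule.smul_mem _ _ h1)
    (Submodule.sum_mem _ fun r _ => Submodule.sum_mem _ fun j _ => Submodule.smul_mem _ _ (h2 r j)))
    (Submodule.sum_mem _ fun r _ => Submodule.sum_mem _ fun j _ => Submodule.smul_mem _ _ (h3 r j))

/-- If minimality along the line through `v` holds, it holds at the minimizing coefficient `⟪v, g⟫ /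
‖g‖ ^ 2`, where the squared norm drops by `⟪v, g⟫ ^ 2 / ‖g‖ ^ 2`. -/
theorem inner_eq_zero_of_forall_norm_le {E : Type*} [NormedAddCommGroup E] [InnerProductSpace ℝ E]
    {v g : E} (h : ∀ c : ℝ, ‖v‖ ≤ ‖v - c • g‖) : ⟪v, g⟫ = 0 := by
  rcases eq_or_ne g 0 with rfl | hg
  · simp
  have hg' : 0 < ‖g‖ ^ 2 := by positivity
  have h1 := pow_le_pow_left₀ (norm_nonneg _) (h (⟪v, g⟫ / ‖g‖ ^ 2)) 2
  rw [norm_sub_sq_real, norm_smul, real_inner_smul_right, mul_pow, Real.norm_eq_abs, sq_abs] at h1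
  have h2 : 2 * (⟪v, g⟫ / ‖g‖ ^ 2 * ⟪v, g⟫) - (⟪v, g⟫ / ‖g‖ ^ 2) ^ 2 * ‖g‖ ^ 2
      = ⟪v, g⟫ ^ 2 / ‖g‖ ^ 2 := by
    field_simp
    ring
  have h3 : ⟪v, g⟫ ^ 2 / ‖g‖ ^ 2 ≤ 0 := by linarith
  have h4 : ⟪v, g⟫ ^ 2 ≤ 0 := by
    rwa [div_le_iff₀ hg', zero_mul] at h3
  exact pow_eq_zero_iff two_ne_zero |>.1 (le_antisymm h4 (sq_nonneg _))

/-- Perturbing only coordinate `i` turns minimality of the vector error into a scalar orthogonality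
relation. -/
theorem IsLMMSE.inner_toLp_eq_zero (h : IsLMMSE μ y s k l X Z) (hX : MemLp X 2 μ)
    (hZ : MemLp Z 2 μ) {g : Ω → ℝ} (hg : MemLp g 2 μ) (i : Fin n)
    (hG : IsAffineEstimator y s k l fun ω => EuclideanSpace.single i (g ω)) :
    ⟪coordLp hX i - coordLp hZ i, hg.toLp g⟫ = 0 := by
  have hGm : MemLp (fun ω => EuclideanSpace.single i (g ω) : Ω → EuclideanSpace ℝ (Fin n)) 2 μ := by
    refine MemLp.of_eval_piLp fun j => ?_
    by_cases hij : j = i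
    · subst hij; simpa using hg
    · simp [hij]
  have h0 : ⟪(hX.sub hZ).toLp _, hGm.toLp _⟫ = 0 := by
    refine inner_eq_zero_of_forall_norm_le fun c => ?_
    have h1 := h.2 _ (h.1.add_smul hG c)
    have h2 : (hX.sub hZ).toLp _ - c • hGm.toLp _
        = (hX.sub (hZ.add (hGm.const_smul c))).toLp _ := by
      rw [← MemLp.toLp_const_smul, ← MemLp.toLp_sub]
      congr 1
      abel
    rw [h2, Lp.norm_toLp, Lp.norm_toLp]
    exact ENNReal.toReal_mono (hX.sub (hZ.add (hGm.const_smul c))).2.ne h1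
  have h3 : ⟪coordLp hX i - coordLp hZ i, hg.toLp g⟫ = ∫ ω, (X ω i - Z ω i) * g ω ∂μ :=
    inner_toLp ((hX.eval_piLp i).sub (hZ.eval_piLp i)) hg
  rw [h3, ← h0, L2.inner_def]
  refine integral_congr_ae ?_
  filter_upwards [(hX.sub hZ).coeFn_toLp, hGm.coeFn_toLp] with ω h1 h2
  rw [h1, h2, EuclideanSpace.inner_single_right]
  simp [mul_comm]

/-- The error of the affine minimum mean squared error estimate is orthogonal to the
observations. -/
theorem IsLMMSE.inner_eq_zero [IsFiniteMeasure μ] (h : IsLMMSE μ y s k l X Z) (hX : MemLp X 2 μ)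
    (hZ : MemLp Z 2 μ) (hy : ∀ r, MemLp (y r) 2 μ) (hs : ∀ r, MemLp (s r) 2 μ) (i : Fin n)
    {u : Lp ℝ 2 μ}
    (hu : u ∈ obsSpan (oneLp μ) (fun r => coordLp (hy r)) (fun r => coordLp (hs r)) k l) :
    ⟪coordLp hX i - coordLp hZ i, u⟫ = 0 := by
  have hle : obsSpan (oneLp μ) (fun r => coordLp (hy r)) (fun r => coordLp (hs r)) k l
      ≤ (innerSL ℝ (coordLp hX i - coordLp hZ i)).ker := by
    refine obsSpan_le.2 ⟨?_, fun r hr j => ?_, fun r hr j => ?_⟩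
    · exact h.inner_toLp_eq_zero hX hZ (memLp_const 1) i (isAffineEstimator_single_const i 1)
    · exact h.inner_toLp_eq_zero hX hZ ((hy r).eval_piLp j) i (isAffineEstimator_single_fst hr i j)
    · exact h.inner_toLp_eq_zero hX hZ ((hs r).eval_piLp j) i (isAffineEstimator_single_snd hr i j)
  exact hle hu

end Affine

/-! ### Second order properties of the quantized loop -/

theorem FeedbackLoop.sqMeasurable_x_succ {n m p : ℕ} {S : Setup n m p} {Ω : Type*}
    {𝓜 mΩ : MeasurableSpace Ω} {μ : Measure Ω} (F : FeedbackLoop S μ) {t : ℕ}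
    (hx : SqMeasurable 𝓜 μ (F.x t)) (hH : SqMeasurable 𝓜 μ (F.xHat t))
    (hw : SqMeasurable 𝓜 μ (F.w t)) : SqMeasurable 𝓜 μ (F.x (t + 1)) := by
  rw [show F.x (t + 1) = _ from funext (F.dynamics t)]
  exact ((hx.toEuclideanLin _).add (((hH.stack hx.sndBlock).toEuclideanLin _).toEuclideanLin _)).add
    hw

theorem sensitivity_pos : 0 < sensitivity := by unfold sensitivity; positivity

theorem sensitivity_sq_div : sensitivity ^ 2 / 12 = 1 := by
  unfold sensitivity
  rw [mul_pow, Real.sq_sqrt (by norm_num)]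
  norm_num

namespace QuantizedLoop

open scoped RealInnerProductSpace

variable {n m p : ℕ} {S : Setup n m p} {Ω : Type*} {𝓜 mΩ : MeasurableSpace Ω} {μ : Measure Ω}
  (F : QuantizedLoop S μ)

/-- The scaled prediction error, i.e. the quantizer input. -/
def quantInput (t : ℕ) (ω : Ω) : EuclideanSpace ℝ (Fin n) :=
  S.C₁.toEuclideanLin (F.x₁ t ω - F.xTilde t ω)

/-- The effective measurement noise of the dithered quantizer. -/
def noise (t : ℕ) (ω : Ω) : EuclideanSpace ℝ (Fin n) := F.y t ω - F.quantInput t ω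

theorem noise_apply (t : ℕ) (ω : Ω) (i : Fin n) :
    F.noise t ω i = quantError sensitivity (F.quantInput t ω i + F.e t ω i) := by
  rw [noise, F.sensor]
  simp only [ditheredQuantizer, quantizer, quantInput, quantError, PiLp.sub_apply, PiLp.add_apply]
  ring

theorem measurable_noise {t : ℕ} (hz : Measurable[𝓜] (F.quantInput t))
    (he : Measurable[𝓜] (F.e t)) : Measurable[𝓜] (F.noise t) := by
  have h : Measurable fun q : EuclideanSpace ℝ (Fin n) × EuclideanSpace ℝ (Fin n) =>
      WithLp.toLp 2 fun i => quantError sensitivity (q.1 i + q.2 i) :=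
    (WithLp.measurable_toLp 2 _).comp (measurable_pi_iff.2 fun i =>
      measurable_quantError.comp (by fun_prop))
  convert h.comp (hz.prodMk he) using 1
  ext ω i
  exact F.noise_apply t ω i

theorem memLp_noise_of_measurable [IsFiniteMeasure μ] {t : ℕ} (h : Measurable (F.noise t)) :
    MemLp (F.noise t) 2 μ := by
  refine MemLp.of_eval_piLp fun i => MemLp.of_bound
    ((by fun_prop : Measurable fun z : EuclideanSpace ℝ (Fin n) => z i).comp h).aestronglyMeasurable
    (sensitivity / 2) (Eventually.of_forall fun ω => ?_)
  rw [F.noise_apply]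
  exact abs_quantError_le sensitivity_pos _

/-- The primitive random variables before time `t` and the dither at time `t`, with the exception
of coordinate `i`. -/
def primitivesExcept (t : ℕ) (i : Fin n) (ω : Ω) :=
  (F.primitives t ω, fun j => if j = i then 0 else F.e t ω j)

theorem measurable_mask (i : Fin n) :
    Measurable fun (q : EuclideanSpace ℝ (Fin n)) j => if j = i then 0 else q j :=
  measurable_pi_iff.2 fun j => by split_ifs <;> fun_prop

theorem measurable_primitivesExcept (t : ℕ) (i : Fin n) : Measurable (F.primitivesExcept t i) :=
  (F.measurable_primitives t).prodMk ((measurable_mask i).comp (F.measurable_e t))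

theorem primitiveSigma_le_except (t : ℕ) (i : Fin n) :
    F.primitiveSigma t ≤ MeasurableSpace.comap (F.primitivesExcept t i) inferInstance :=
  (measurable_fst.comp (comap_measurable (F.primitivesExcept t i))).comap_le

theorem sqMeasurable_quantInput {t : ℕ} (hx : SqMeasurable 𝓜 μ (F.x t))
    (hT : SqMeasurable 𝓜 μ (F.xTilde t)) : SqMeasurable 𝓜 μ (F.quantInput t) :=
  (hx.fstBlock.sub hT).toEuclideanLin S.C₁

variable [IsProbabilityMeasure μ]

theorem sqMeasurable_noise (hle : 𝓜 ≤ mΩ) {t : ℕ} (hz : Measurable[𝓜] (F.quantInput t)) (he : Measurable[𝓜] (F.e t)) :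
    SqMeasurable 𝓜 μ (F.noise t) :=
  ⟨F.measurable_noise hz he, F.memLp_noise_of_measurable ((F.measurable_noise hz he).mono hle le_rfl)⟩

/-- Within one step the order is `xTilde`, quantizer input, noise, `y`, `xHat`, next state. Hence
states are covered up to `t` but measurements only strictly before it. The quantization error is
bounded, so square integrability is never lost. -/
theorem sqMeasurable_x_y (t : ℕ) :
    (∀ s ≤ t, SqMeasurable (F.primitiveSigma t) μ (F.x s)) ∧
      ∀ s < t, SqMeasurable (F.primitiveSigma t) μ (F.y s) := by
  induction t with
  | zero =>
    refine ⟨fun s hs => ?_, by simp⟩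
    obtain rfl := Nat.le_zero.1 hs
    exact ⟨F.measurable_x_zero_primitive 0, F.memLp_x_zero⟩
  | succ t ih =>
    have hmono := F.primitiveSigma_mono t.le_succ
    have hx : ∀ s ≤ t, SqMeasurable (F.primitiveSigma (t + 1)) μ (F.x s) := fun s hs =>
      (ih.1 s hs).mono hmono
    have hT : SqMeasurable (F.primitiveSigma (t + 1)) μ (F.xTilde t) :=
      (F.xTilde_lmmse t).1.sqMeasurable (fun r hr => (ih.2 r hr).mono hmono)
        fun r hr => (hx r (by omega)).sndBlock
    have hz := F.sqMeasurable_quantInput (hx t le_rfl) hT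
    have hy : ∀ s < t + 1, SqMeasurable (F.primitiveSigma (t + 1)) μ (F.y s) := by
      intro s hs
      rcases Nat.lt_succ_iff_lt_or_eq.1 hs with hs | rfl
      · exact (ih.2 s hs).mono hmono
      · have h := (F.sqMeasurable_noise (F.primitiveSigma_le _) hz.1
          (F.measurable_e_primitive s.lt_succ_self)).add hz
        simpa only [noise, sub_add_cancel] using h
    have hH : SqMeasurable (F.primitiveSigma (t + 1)) μ (F.xHat t) :=
      (F.xHat_lmmse t).1.sqMeasurable hy fun r hr => (hx r (by omega)).sndBlock
    refine ⟨fun s hs => ?_, hy⟩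
    rcases Nat.le_succ_iff.1 hs with hs | rfl
    · exact hx s hs
    · exact F.sqMeasurable_x_succ (hx t le_rfl) hH ⟨F.measurable_w_primitive t _, F.memLp_w t⟩

theorem sqMeasurable_xTilde (t : ℕ) : SqMeasurable (F.primitiveSigma t) μ (F.xTilde t) :=
  (F.xTilde_lmmse t).1.sqMeasurable (F.sqMeasurable_x_y t).2
    fun r hr => ((F.sqMeasurable_x_y t).1 r (by omega)).sndBlock

theorem memLp_x (t : ℕ) : MemLp (F.x t) 2 μ := ((F.sqMeasurable_x_y t).1 t le_rfl).2

theorem memLp_y (t : ℕ) : MemLp (F.y t) 2 μ := ((F.sqMeasurable_x_y (t + 1)).2 t t.lt_succ_self).2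

theorem memLp_xTilde (t : ℕ) : MemLp (F.xTilde t) 2 μ := (F.sqMeasurable_xTilde t).2

theorem memLp_xHat (t : ℕ) : MemLp (F.xHat t) 2 μ :=
  ((F.xHat_lmmse t).1.sqMeasurable (F.sqMeasurable_x_y (t + 1)).2
    fun r hr => ((F.sqMeasurable_x_y (t + 1)).1 r (by omega)).sndBlock).2

theorem sqMeasurable_quantInput_primitive (t : ℕ) :
    SqMeasurable (F.primitiveSigma t) μ (F.quantInput t) :=
  F.sqMeasurable_quantInput ((F.sqMeasurable_x_y t).1 t le_rfl) (F.sqMeasurable_xTilde t)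

theorem sqMeasurable_noise_primitive {s t : ℕ} (h : s < t) :
    SqMeasurable (F.primitiveSigma t) μ (F.noise s) :=
  F.sqMeasurable_noise (F.primitiveSigma_le t)
    ((F.sqMeasurable_quantInput_primitive s).1.mono (F.primitiveSigma_mono h.le) le_rfl)
    (F.measurable_e_primitive h)

theorem memLp_noise (t : ℕ) : MemLp (F.noise t) 2 μ :=
  (F.sqMeasurable_noise_primitive t.lt_succ_self).2

/-- Keeping the other dither coordinates on the independent side is what later decorrelates
different coordinates of the noise at one time. -/
theorem e_coord_indep_primitivesExcept (t : ℕ) (i : Fin n) :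
    IndepFun (fun ω => F.e t ω i) (F.primitivesExcept t i) μ := by
  have hm : ∀ j, Measurable fun ω => F.e t ω j := fun j =>
    (by fun_prop : Measurable fun z : EuclideanSpace ℝ (Fin n) => z j).comp (F.measurable_e t)
  have h1 := (F.e_coord_iIndep t).indepFun_finset {i} (Finset.univ \ {i}) (by simp) hm
  have h2 : IndepFun (fun ω => F.e t ω i) (fun ω j => if j = i then 0 else F.e t ω j) μ := by
    have hψ : Measurable fun (q : (Finset.univ \ {i} : Finset (Fin n)) → ℝ) (j : Fin n) =>
        if h : j = i then 0 else q ⟨j, by simpa using h⟩ :=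
      measurable_pi_iff.2 fun s => by split_ifs <;> fun_prop
    have hφ : Measurable fun q : ({i} : Finset (Fin n)) → ℝ =>
        q ⟨i, Finset.mem_singleton_self i⟩ := measurable_pi_apply _
    have := h1.comp hφ hψ
    convert this using 1
    · rfl
    · funext ω j
      by_cases h : j = i <;> simp [h]
  exact indepFun_prodMk_rotate (F.measurable_primitives t) (hm i)
    ((measurable_mask i).comp (F.measurable_e t))
    ((F.e_indep_primitives t).symm.comp measurable_id
      ((by fun_prop : Measurable fun z : EuclideanSpace ℝ (Fin n) => z i).prodMk
        (measurable_mask i))) h2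

theorem measurable_quantInput_apply (t : ℕ) (i j : Fin n) :
    Measurable[MeasurableSpace.comap (F.primitivesExcept t i) inferInstance]
      fun ω => F.quantInput t ω j :=
  (by fun_prop : Measurable fun z : EuclideanSpace ℝ (Fin n) => z j).comp
    ((F.sqMeasurable_quantInput_primitive t).1.mono (F.primitiveSigma_le_except t i) le_rfl)

theorem integral_noise_mul {t : ℕ} {i : Fin n} {G : Ω → ℝ}
    (hG : Measurable[MeasurableSpace.comap (F.primitivesExcept t i) inferInstance] G)
    (hGi : Integrable G μ) : ∫ ω, F.noise t ω i * G ω ∂μ = 0 := by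
  simp only [noise_apply]
  exact integral_quantError_mul sensitivity_pos
    ((by fun_prop : Measurable fun z : EuclideanSpace ℝ (Fin n) => z i).comp (F.measurable_e t))
    (F.measurable_primitivesExcept t i) (F.e_coord_law t i) (F.e_coord_indep_primitivesExcept t i)
    (F.measurable_quantInput_apply t i i) hG hGi

theorem mean_noise (t : ℕ) : mean μ (F.noise t) = 0 := by
  ext i
  have h := F.integral_noise_mul (t := t) (i := i) (measurable_const (a := (1 : ℝ)))
    (integrable_const 1)
  simp only [mul_one] at h
  exact h

theorem crossMoment_noise_right {ι : Type*} [Fintype ι] {X : Ω → EuclideanSpace ℝ ι} {t : ℕ}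
    (hX : SqMeasurable (F.primitiveSigma t) μ X) : crossMoment μ X (F.noise t) = 0 := by
  ext i j
  have h := F.integral_noise_mul (t := t) (i := j) (G := fun ω => X ω i)
    ((by fun_prop : Measurable fun z : EuclideanSpace ℝ ι => z i).comp
      (hX.1.mono (F.primitiveSigma_le_except t j) le_rfl))
    ((hX.2.eval_piLp i).integrable (by norm_num))
  refine Eq.trans ?_ h
  exact integral_congr_ae (Eventually.of_forall fun ω => mul_comm _ _)

theorem crossMoment_noise_self (t : ℕ) : crossMoment μ (F.noise t) (F.noise t) = 1 := by
  have hm : ∀ j, Measurable fun ω => F.e t ω j := fun j =>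
    (by fun_prop : Measurable fun z : EuclideanSpace ℝ (Fin n) => z j).comp (F.measurable_e t)
  ext i j
  rcases eq_or_ne i j with rfl | hij
  · have h := integral_quantError_add_sq sensitivity_pos (hm i) (F.measurable_primitivesExcept t i)
      (F.e_coord_law t i) (F.e_coord_indep_primitivesExcept t i)
      (F.measurable_quantInput_apply t i i)
    rw [sensitivity_sq_div] at h
    simp only [← noise_apply, sq] at h
    simpa [crossMoment] using h
  · rw [Matrix.one_apply_ne hij]
    -- Coordinate `j` of the noise involves only dither coordinate `j` and the past, so it is
    -- admissible as a test variable for coordinate `i`.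
    refine F.integral_noise_mul (G := fun ω => F.noise t ω j) ?_
      (((F.memLp_noise t).eval_piLp j).integrable (by norm_num))
    have h1 : Measurable[MeasurableSpace.comap (F.primitivesExcept t i) inferInstance]
        fun ω => (F.primitivesExcept t i ω).2 j :=
      (measurable_pi_apply j).comp
        (measurable_snd.comp (comap_measurable (F.primitivesExcept t i)))
    have h2 := measurable_quantError (Δ := sensitivity) |>.comp
      ((F.measurable_quantInput_apply t i j).add h1)
    convert h2 using 1
    ext ω
    simp [noise_apply, primitivesExcept, hij.symm]

theorem crossMoment_noise (s t : ℕ) :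
    crossMoment μ (F.noise s) (F.noise t) = if s = t then 1 else 0 := by
  rcases lt_trichotomy s t with h | rfl | h
  · rw [if_neg h.ne, F.crossMoment_noise_right (F.sqMeasurable_noise_primitive h)]
  · rw [if_pos rfl, crossMoment_noise_self]
  · rw [if_neg h.ne']
    ext i j
    have h1 := congrFun (congrFun
      (F.crossMoment_noise_right (F.sqMeasurable_noise_primitive h)) j) i
    refine Eq.trans ?_ h1
    exact integral_congr_ae (Eventually.of_forall fun ω => mul_comm _ _)

/-- The measurement that a linear sensor with the effective noise would deliver. -/
def linearMeasurement (t : ℕ) : Fin n → Lp ℝ 2 μ :=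
  comb S.C₁ (coordLp (F.memLp_x t) ∘ Sum.inl) + coordLp (F.memLp_noise t)

theorem linearMeasurement_eq (t : ℕ) :
    F.linearMeasurement t = coordLp (F.memLp_y t) + comb S.C₁ (coordLp (F.memLp_xTilde t)) := by
  have h := memLp_fstBlock (F.memLp_x t)
  have h1 : coordLp (F.memLp_noise t) = coordLp (F.memLp_y t)
      - coordLp (memLp_toEuclideanLin S.C₁ (h.sub (F.memLp_xTilde t))) := rfl
  have h2 : coordLp (h.sub (F.memLp_xTilde t)) = coordLp (F.memLp_x t) ∘ Sum.inl
      - coordLp (F.memLp_xTilde t) := rfl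
  rw [linearMeasurement, h1, coordLp_toEuclideanLin S.C₁ (h.sub (F.memLp_xTilde t)), h2, comb_sub]
  abel

/-- The two measurements differ by `C₁` times `xTilde`, which is affine in what was observed
earlier. Predictive quantization therefore conveys the same linear information as a linear sensor.
-/
theorem obsSpan_linearMeasurement {k l : ℕ} (hkl : k ≤ l) :
    obsSpan (oneLp μ) F.linearMeasurement (fun r => coordLp (F.memLp_x r) ∘ Sum.inr) k l
      = obsSpan (oneLp μ) (fun r => coordLp (F.memLp_y r))
        (fun r => coordLp (F.memLp_x r) ∘ Sum.inr) k l := by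
  refine obsSpan_congr (fun t i => ?_) hkl
  rw [linearMeasurement_eq, Pi.add_apply, add_sub_cancel_left]
  exact comb_mem _ (fun j => (F.xTilde_lmmse t).1.coordLp_mem F.memLp_y
    (fun r => memLp_sndBlock (F.memLp_x r)) (F.memLp_xTilde t) j) i

/-- The quantized loop as a feedback loop in a Hilbert space. -/
def l2Loop (hW : S.W.PosSemidef) : L2Loop S (Lp ℝ 2 μ) :=
  F.toL2Loop hW F.memLp_x F.memLp_xTilde F.memLp_xHat F.memLp_noise F.mean_noise
    (fun t => F.crossMoment_noise_right ⟨F.measurable_x_zero_primitive t, F.memLp_x_zero⟩)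
    (fun s t => F.crossMoment_noise_right ⟨F.measurable_w_primitive s t, F.memLp_w s⟩)
    F.crossMoment_noise (y := F.linearMeasurement) (fun _ => rfl)
    (fun t i => by
      rw [F.obsSpan_linearMeasurement t.le_succ]
      exact (F.xTilde_lmmse t).1.coordLp_mem F.memLp_y
        (fun r => memLp_sndBlock (F.memLp_x r)) (F.memLp_xTilde t) i)
    (fun t i u hu => by
      rw [F.obsSpan_linearMeasurement t.le_succ] at hu
      exact (F.xTilde_lmmse t).inner_eq_zero (memLp_fstBlock (F.memLp_x t)) (F.memLp_xTilde t)
        F.memLp_y (fun r => memLp_sndBlock (F.memLp_x r)) i hu)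
    (fun t i => by
      rw [F.obsSpan_linearMeasurement le_rfl]
      exact (F.xHat_lmmse t).1.coordLp_mem F.memLp_y
        (fun r => memLp_sndBlock (F.memLp_x r)) (F.memLp_xHat t) i)
    (fun t i u hu => by
      rw [F.obsSpan_linearMeasurement le_rfl] at hu
      exact (F.xHat_lmmse t).inner_eq_zero (memLp_fstBlock (F.memLp_x t)) (F.memLp_xHat t)
        F.memLp_y (fun r => memLp_sndBlock (F.memLp_x r)) i hu)

end QuantizedLoop

/-! ### Conditional expectations in Gaussian subspaces -/

theorem finite_exists_lt_eq {ι E : Type*} [Finite ι] (y : ℕ → ι → E) (k : ℕ) :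
    {z | ∃ r < k, ∃ i, y r i = z}.Finite := by
  refine (Set.finite_range fun q : Fin k × ι => y q.1 q.2).subset ?_
  rintro _ ⟨r, hr, i, rfl⟩
  exact ⟨(⟨r, hr⟩, i), rfl⟩

/-- Guarantees that the orthogonal projection onto the observation span exists. -/
theorem finiteDimensional_obsSpan {ι κ : Type*} [Finite ι] [Finite κ] {E : Type*} [AddCommGroup E]
    [Module ℝ E] (one : E) (y : ℕ → ι → E) (s : ℕ → κ → E) (k l : ℕ) :
    FiniteDimensional ℝ (obsSpan one y s k l) :=
  FiniteDimensional.span_of_finite ℝ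
    (((Set.finite_singleton one).union (finite_exists_lt_eq y k)).union (finite_exists_lt_eq s l))

section Projection

open scoped RealInnerProductSpace

variable {Ω : Type*} {mΩ : MeasurableSpace Ω} {μ : Measure Ω} {n m k l : ℕ}
  {y : ℕ → Ω → EuclideanSpace ℝ (Fin n)} {s : ℕ → Ω → EuclideanSpace ℝ (Fin m)}
  {X Z : Ω → EuclideanSpace ℝ (Fin n)}

theorem historySigma_le (hy : ∀ r < k, Measurable (y r)) (hs : ∀ r < l, Measurable (s r)) :
    historySigma y s k l ≤ mΩ :=
  ((measurable_pi_iff.2 fun r : Fin k => hy r r.2).prodMk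
    (measurable_pi_iff.2 fun r : Fin l => hs r r.2)).comap_le

theorem measurable_fst_history {r : ℕ} (hr : r < k) : Measurable[historySigma y s k l] (y r) :=
  (measurable_pi_apply (⟨r, hr⟩ : Fin k)).comp
    (measurable_fst.comp (comap_measurable (history y s k l)))

theorem measurable_snd_history {r : ℕ} (hr : r < l) : Measurable[historySigma y s k l] (s r) :=
  (measurable_pi_apply (⟨r, hr⟩ : Fin l)).comp
    (measurable_snd.comp (comap_measurable (history y s k l)))

theorem IsMMSE.sqMeasurable (h : IsMMSE μ y s k l X Z) (hX : MemLp X 2 μ)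
    (hy : ∀ r < k, Measurable (y r)) (hs : ∀ r < l, Measurable (s r)) : SqMeasurable mΩ μ Z :=
  ⟨h.1.mono (historySigma_le hy hs) le_rfl,
    (memLp_congr_ae h.2).2 (hX.condExp (by norm_num))⟩

/-- The coordinates of the observations. -/
def historyCoord (y : ℕ → Ω → EuclideanSpace ℝ (Fin n)) (s : ℕ → Ω → EuclideanSpace ℝ (Fin m))
    (k l : ℕ) : (Fin k × Fin n) ⊕ (Fin l × Fin m) → Ω → ℝ :=
  Sum.elim (fun q ω => y q.1 ω q.2) (fun q ω => s q.1 ω q.2)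

theorem historySigma_le_comap_historyCoord : historySigma y s k l ≤
    MeasurableSpace.comap (fun ω q => historyCoord y s k l q ω) inferInstance := by
  have h : Measurable fun q : (Fin k × Fin n) ⊕ (Fin l × Fin m) → ℝ =>
      ((fun r => WithLp.toLp 2 fun i => q (Sum.inl (r, i)),
        fun r => WithLp.toLp 2 fun i => q (Sum.inr (r, i))) :
        (Fin k → EuclideanSpace ℝ (Fin n)) × (Fin l → EuclideanSpace ℝ (Fin m))) :=
    (measurable_pi_iff.2 fun r => (WithLp.measurable_toLp 2 _).comp (by fun_prop)).prodMk
      (measurable_pi_iff.2 fun r => (WithLp.measurable_toLp 2 _).comp (by fun_prop))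
  exact (h.comp (comap_measurable fun ω q => historyCoord y s k l q ω)).comap_le

/-- In a Gaussian subspace of `L²` the residual of the orthogonal projection onto the span of the
observations has vanishing conditional expectation. -/
theorem condExp_eq_zero_of_inner_eq_zero [IsProbabilityMeasure μ] {V : Submodule ℝ (Lp ℝ 2 μ)}
    (hV : IsGaussianProcess (fun (f : V) => ((f : Lp ℝ 2 μ) : Ω → ℝ)) μ)
    (hy : ∀ r, Measurable (y r)) (hs : ∀ r, Measurable (s r))
    (hy2 : ∀ r, MemLp (y r) 2 μ) (hs2 : ∀ r, MemLp (s r) 2 μ)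
    (hyV : ∀ r < k, ∀ i, coordLp (hy2 r) i ∈ V) (hsV : ∀ r < l, ∀ j, coordLp (hs2 r) j ∈ V)
    {ε : Lp ℝ 2 μ} (hε : ε ∈ V)
    (h : ∀ u ∈ obsSpan (oneLp μ) (fun r => coordLp (hy2 r)) (fun r => coordLp (hs2 r)) k l,
      ⟪ε, u⟫ = 0) : μ[(ε : Ω → ℝ) | historySigma y s k l] =ᵐ[μ] 0 := by
  have hle := historySigma_le (fun r (_ : r < k) => hy r) fun r (_ : r < l) => hs r
  have hε2 : MemLp (ε : Ω → ℝ) 2 μ := Lp.memLp ε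
  have hinner : ∀ {g : Ω → ℝ} (hg : MemLp g 2 μ), ⟪ε, hg.toLp g⟫ = ∫ ω, ε ω * g ω ∂μ := by
    intro g hg
    rw [← inner_toLp hε2 hg, Lp.toLp_coeFn]
  -- The constant belongs to the span, so the residual is centred and its covariances are inner
  -- products.
  have hε0 : ∫ ω, ε ω ∂μ = 0 := by
    have := (hinner (memLp_const (1 : ℝ))).symm.trans (h _ one_mem_obsSpan)
    simpa only [mul_one] using this
  have hfst : ∀ q : Fin k × Fin n, MemLp (fun ω => y q.1 ω q.2) 2 μ := fun q =>
    (hy2 q.1).eval_piLp q.2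
  have hsnd : ∀ q : Fin l × Fin m, MemLp (fun ω => s q.1 ω q.2) 2 μ := fun q =>
    (hs2 q.1).eval_piLp q.2
  have hgauss : IsGaussianProcess (Sum.elim (fun _ : Unit => (ε : Ω → ℝ)) (historyCoord y s k l))
      μ := by
    refine (hV.comp_right (Sum.elim (fun _ : Unit => ⟨ε, hε⟩)
      (Sum.elim (fun q : Fin k × Fin n => ⟨coordLp (hy2 q.1) q.2, hyV _ q.1.2 _⟩)
        (fun q : Fin l × Fin m => ⟨coordLp (hs2 q.1) q.2, hsV _ q.1.2 _⟩)))).congr ?_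
    rintro (_ | q | q)
    · exact EventuallyEq.rfl
    · exact (hfst q).coeFn_toLp
    · exact (hsnd q).coeFn_toLp
  -- Here joint Gaussianity is decisive: uncorrelated becomes independent of the whole observation
  -- vector.
  have hindep := hgauss.indepFun_of_covariance_eq_zero (fun _ => hε2.1.aemeasurable)
    (by
      rintro (q | q)
      · exact (hfst q).1.aemeasurable
      · exact (hsnd q).1.aemeasurable)
    (by
      rintro _ (q | q)
      · rw [historyCoord, Sum.elim_inl, covariance_eq_sub hε2 (hfst q), hε0, zero_mul, sub_zero]
        exact (hinner (hfst q)).symm.trans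
          (h _ (fst_mem_obsSpan (y := fun r => coordLp (hy2 r)) q.1.2 q.2))
      · rw [historyCoord, Sum.elim_inr, covariance_eq_sub hε2 (hsnd q), hε0, zero_mul, sub_zero]
        exact (hinner (hsnd q)).symm.trans
          (h _ (snd_mem_obsSpan (s := fun r => coordLp (hs2 r)) q.1.2 q.2)))
  have hεm : Measurable fun ω (_ : Unit) => ε ω :=
    measurable_pi_iff.2 fun _ => (Lp.stronglyMeasurable ε).measurable
  have hcond := condExp_indep_eq hεm.comap_le hle
    ((measurable_pi_apply ()).comp (comap_measurable fun ω (_ : Unit) => ε ω)).stronglyMeasurable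
    (indep_of_indep_of_le_right hindep historySigma_le_comap_historyCoord)
  refine hcond.trans (Eventually.of_forall fun ω => ?_)
  exact hε0

/-- In a Gaussian subspace of `L²` the conditional expectation given the observations is the
orthogonal projection onto their span. -/
theorem IsMMSE.coordLp_mem_and_inner_eq_zero [IsProbabilityMeasure μ]
    {V : Submodule ℝ (Lp ℝ 2 μ)}
    (hV : IsGaussianProcess (fun (f : V) => ((f : Lp ℝ 2 μ) : Ω → ℝ)) μ) (h1 : oneLp μ ∈ V)
    (h : IsMMSE μ y s k l X Z) (hX : MemLp X 2 μ) (hZ : MemLp Z 2 μ)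
    (hy : ∀ r, Measurable (y r)) (hs : ∀ r, Measurable (s r))
    (hy2 : ∀ r, MemLp (y r) 2 μ) (hs2 : ∀ r, MemLp (s r) 2 μ) (i : Fin n)
    (hXV : coordLp hX i ∈ V) (hyV : ∀ r < k, ∀ i, coordLp (hy2 r) i ∈ V)
    (hsV : ∀ r < l, ∀ j, coordLp (hs2 r) j ∈ V) :
    coordLp hZ i ∈ obsSpan (oneLp μ) (fun r => coordLp (hy2 r)) (fun r => coordLp (hs2 r)) k l ∧
    ∀ u ∈ obsSpan (oneLp μ) (fun r => coordLp (hy2 r)) (fun r => coordLp (hs2 r)) k l,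
      ⟪coordLp hX i - coordLp hZ i, u⟫ = 0 := by
  set U := obsSpan (oneLp μ) (fun r => coordLp (hy2 r)) (fun r => coordLp (hs2 r)) k l with hU
  have hfin : FiniteDimensional ℝ U := finiteDimensional_obsSpan _ _ _ _ _
  have hle := historySigma_le (fun r (_ : r < k) => hy r) fun r (_ : r < l) => hs r
  set P := U.starProjection (coordLp hX i) with hP
  have hPU : P ∈ U := U.starProjection_apply_mem _
  have horth : ∀ u ∈ U, ⟪coordLp hX i - P, u⟫ = 0 := U.starProjection_inner_eq_zero _
  have hUV : U ≤ V := obsSpan_le.2 ⟨h1, hyV, hsV⟩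
  have hres := condExp_eq_zero_of_inner_eq_zero hV hy hs hy2 hs2 hyV hsV
    (V.sub_mem hXV (hUV hPU)) horth
  have hUm : U ≤ lpMeas ℝ ℝ (historySigma y s k l) 2 μ := by
    refine obsSpan_le.2 ⟨?_, fun r hr j => ?_, fun r hr j => ?_⟩ <;>
      refine mem_lpMeas_iff_aestronglyMeasurable.2 ?_
    · exact stronglyMeasurable_const.aestronglyMeasurable.congr (memLp_const (1 : ℝ)).coeFn_toLp.symm
    · exact ((by fun_prop : Measurable fun z : EuclideanSpace ℝ (Fin n) => z j).comp
        (measurable_fst_history hr)).stronglyMeasurable.aestronglyMeasurable.congr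
        ((hy2 r).eval_piLp j).coeFn_toLp.symm
    · exact ((by fun_prop : Measurable fun z : EuclideanSpace ℝ (Fin m) => z j).comp
        (measurable_snd_history hr)).stronglyMeasurable.aestronglyMeasurable.congr
        ((hs2 r).eval_piLp j).coeFn_toLp.symm
  have hPm := condExp_of_aestronglyMeasurable' hle
    (mem_lpMeas_iff_aestronglyMeasurable.1 (hUm hPU)) ((Lp.memLp P).integrable (by norm_num))
  -- Of the two summands, conditioning kills the residual and fixes the projection, which is
  -- measurable with respect to the history.
  have hXi : (fun ω => X ω i) =ᵐ[μ] ((coordLp hX i - P : Lp ℝ 2 μ) : Ω → ℝ) + (P : Ω → ℝ) := by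
    filter_upwards [(hX.eval_piLp i).coeFn_toLp, Lp.coeFn_sub (coordLp hX i) P] with ω h1 h2
    rw [Pi.add_apply, h2, Pi.sub_apply, sub_add_cancel, ← h1]
    rfl
  have hcomm := (EuclideanSpace.proj i : EuclideanSpace ℝ (Fin n) →L[ℝ] ℝ).comp_condExp_comm
    (m := historySigma y s k l) (hX.integrable (by norm_num))
  have hZP : coordLp hZ i = P := by
    refine Lp.ext ?_
    have hadd := condExp_add ((Lp.memLp (coordLp hX i - P)).integrable (by norm_num))
      ((Lp.memLp P).integrable (by norm_num)) (historySigma y s k l)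
    filter_upwards [(hZ.eval_piLp i).coeFn_toLp, h.2, hcomm, hadd, hres, hPm,
      condExp_congr_ae (m := historySigma y s k l) hXi] with ω e1 e2 e3 e4 e5 e6 e7
    rw [coordLp, e1, e2]
    refine e3.trans (e7.trans (e4.trans ?_))
    rw [Pi.add_apply, e5, e6, Pi.zero_apply, zero_add]
  rw [hZP]
  exact ⟨hPU, horth⟩

end Projection

/-! ### Second order properties of the Gaussian loop -/

namespace GaussianLoop

open scoped RealInnerProductSpace

variable {n m p : ℕ} {S : Setup n m p} {Ω : Type*} {mΩ : MeasurableSpace Ω} {μ : Measure Ω}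
  (F : GaussianLoop S μ)

/-- A constant, the initial state and the noises before time `N`. -/
def noiseVector (N : ℕ) (ω : Ω) : ℝ × EuclideanSpace ℝ (Fin n ⊕ Fin m) ×
    (Fin N → EuclideanSpace ℝ (Fin n ⊕ Fin m)) × (Fin N → EuclideanSpace ℝ (Fin n)) :=
  (1, F.x 0 ω, fun s => F.w s ω, fun s => F.e s ω)

theorem hasGaussianLaw_noiseVector [IsProbabilityMeasure μ] (N : ℕ) :
    HasGaussianLaw (F.noiseVector N) μ := by
  have hx : HasGaussianLaw (F.x 0) μ := ⟨F.x_zero_gaussian⟩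
  have hw : HasGaussianLaw (fun ω (s : Fin N) => F.w s ω) μ :=
    (F.w_iIndep.precomp Fin.val_injective).hasGaussianLaw
      fun s => hasGaussianLaw_of_map_eq (F.w_law s)
  have he : HasGaussianLaw (fun ω (s : Fin N) => F.e s ω) μ :=
    (F.e_iIndep.precomp Fin.val_injective).hasGaussianLaw
      fun s => hasGaussianLaw_of_map_eq (F.e_law s)
  -- A Dirac mass is a degenerate Gaussian; carrying the constant along turns affine functions into
  -- linear functionals.
  have h1 : HasGaussianLaw (fun _ : Ω => (1 : ℝ)) μ :=
    ⟨by rw [Measure.map_const, measure_univ, one_smul]; infer_instance⟩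
  have hwe := (F.w_indep_e.comp
    (φ := fun (q : ℕ → EuclideanSpace ℝ (Fin n ⊕ Fin m)) (s : Fin N) => q s)
    (ψ := fun (q : ℕ → EuclideanSpace ℝ (Fin n)) (s : Fin N) => q s)
    (by fun_prop) (by fun_prop)).hasGaussianLaw hw he
  have hxwe := (F.x_zero_indep.comp (φ := id)
    (ψ := fun q : (ℕ → EuclideanSpace ℝ (Fin n ⊕ Fin m)) × (ℕ → EuclideanSpace ℝ (Fin n)) =>
      ((fun s : Fin N => q.1 s, fun s : Fin N => q.2 s) :
        (Fin N → EuclideanSpace ℝ (Fin n ⊕ Fin m)) × (Fin N → EuclideanSpace ℝ (Fin n))))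
    measurable_id (by fun_prop)).hasGaussianLaw hx hwe
  exact (indepFun_const_left 1 _).hasGaussianLaw h1 hxwe

/-- Functionals on a short horizon extend to a longer one, so finitely many elements of
`gaussianSpace` are functionals of one Gaussian vector. -/
theorem exists_noiseVector_eq {N M : ℕ} (h : N ≤ M)
    (L : (ℝ × EuclideanSpace ℝ (Fin n ⊕ Fin m) × (Fin N → EuclideanSpace ℝ (Fin n ⊕ Fin m)) ×
      (Fin N → EuclideanSpace ℝ (Fin n))) →L[ℝ] ℝ) :
    ∃ L' : (ℝ × EuclideanSpace ℝ (Fin n ⊕ Fin m) × (Fin M → EuclideanSpace ℝ (Fin n ⊕ Fin m)) ×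
      (Fin M → EuclideanSpace ℝ (Fin n))) →L[ℝ] ℝ,
      ∀ ω, L (F.noiseVector N ω) = L' (F.noiseVector M ω) :=
  ⟨L ∘L (.prodMap (.id ℝ _) (.prodMap (.id ℝ _) (.prodMap
    (.pi fun s => .proj (Fin.castLE h s)) (.pi fun s => .proj (Fin.castLE h s))))), fun _ => rfl⟩

/-- The subspace of `L²` formed by the linear functionals of the noises. -/
def gaussianSpace : Submodule ℝ (Lp ℝ 2 μ) where
  carrier := {f | ∃ (N : ℕ) (L : (ℝ × EuclideanSpace ℝ (Fin n ⊕ Fin m) ×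
    (Fin N → EuclideanSpace ℝ (Fin n ⊕ Fin m)) × (Fin N → EuclideanSpace ℝ (Fin n))) →L[ℝ] ℝ),
    f =ᵐ[μ] fun ω => L (F.noiseVector N ω)}
  add_mem' := by
    rintro f g ⟨N, L, hf⟩ ⟨M, L', hg⟩
    obtain ⟨K, hK⟩ := F.exists_noiseVector_eq (le_max_left N M) L
    obtain ⟨K', hK'⟩ := F.exists_noiseVector_eq (le_max_right N M) L'
    refine ⟨max N M, K + K', ?_⟩
    filter_upwards [hf, hg, Lp.coeFn_add f g] with ω h1 h2 h3
    rw [h3, Pi.add_apply, h1, h2, hK, hK', _root_.add_apply]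
  zero_mem' := ⟨0, 0, Lp.coeFn_zero _ _ _⟩
  smul_mem' := by
    rintro c f ⟨N, L, hf⟩
    refine ⟨N, c • L, ?_⟩
    filter_upwards [hf, Lp.coeFn_smul c f] with ω h1 h2
    rw [h2, Pi.smul_apply, h1, _root_.smul_apply]

theorem isGaussianProcess_gaussianSpace [IsProbabilityMeasure μ] :
    IsGaussianProcess (fun (f : F.gaussianSpace) => ((f : Lp ℝ 2 μ) : Ω → ℝ)) μ := by
  choose N L hL using fun f : F.gaussianSpace => f.2
  suffices h : IsGaussianProcess (fun f ω => L f (F.noiseVector (N f) ω)) μ from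
    h.congr fun f => (hL f).symm
  refine ⟨fun I => ?_⟩
  choose K hK using fun f : I => F.exists_noiseVector_eq (Finset.le_sup (f := N) f.2) (L f)
  have h := (F.hasGaussianLaw_noiseVector (I.sup N)).map (ContinuousLinearMap.pi K)
  exact h.congr (Eventually.of_forall fun ω => funext fun f => (hK f ω).symm)

theorem oneLp_mem_gaussianSpace [IsProbabilityMeasure μ] : oneLp μ ∈ F.gaussianSpace :=
  ⟨0, .fst ℝ _ _, (memLp_const (1 : ℝ)).coeFn_toLp⟩

theorem coordLp_x_zero_mem_gaussianSpace (h : MemLp (F.x 0) 2 μ) (i) :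
    coordLp h i ∈ F.gaussianSpace :=
  ⟨0, EuclideanSpace.proj i ∘L .fst ℝ _ _ ∘L .snd ℝ _ _, (h.eval_piLp i).coeFn_toLp⟩

theorem coordLp_w_mem_gaussianSpace (t : ℕ) (h : MemLp (F.w t) 2 μ) (i) :
    coordLp h i ∈ F.gaussianSpace :=
  ⟨t + 1, EuclideanSpace.proj i ∘L
    .proj (φ := fun _ : Fin (t + 1) => EuclideanSpace ℝ (Fin n ⊕ Fin m)) (Fin.last t) ∘L
    .fst ℝ _ _ ∘L .snd ℝ _ _ ∘L .snd ℝ _ _,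
    (h.eval_piLp i).coeFn_toLp⟩

theorem coordLp_e_mem_gaussianSpace (t : ℕ) (h : MemLp (F.e t) 2 μ) (i) :
    coordLp h i ∈ F.gaussianSpace :=
  ⟨t + 1, EuclideanSpace.proj i ∘L
    .proj (φ := fun _ : Fin (t + 1) => EuclideanSpace ℝ (Fin n)) (Fin.last t) ∘L
    .snd ℝ _ _ ∘L .snd ℝ _ _ ∘L .snd ℝ _ _,
    (h.eval_piLp i).coeFn_toLp⟩

theorem memLp_e (t : ℕ) : MemLp (F.e t) 2 μ := (hasGaussianLaw_of_map_eq (F.e_law t)).memLp_two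

theorem sqMeasurable_y_of_x {t : ℕ} (h : SqMeasurable mΩ μ (F.x t)) : SqMeasurable mΩ μ (F.y t) := by
  rw [show F.y t = _ from funext (F.sensor t)]
  exact (h.fstBlock.toEuclideanLin S.C₁).add ⟨F.measurable_e t, F.memLp_e t⟩

theorem sqMeasurable_x (t : ℕ) : SqMeasurable mΩ μ (F.x t) := by
  induction t using Nat.strong_induction_on with
  | _ t ih =>
    cases t with
    | zero => exact ⟨F.measurable_x_zero, F.memLp_x_zero⟩
    | succ t =>
      have hx : SqMeasurable mΩ μ (F.x t) := ih t t.lt_succ_self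
      refine F.sqMeasurable_x_succ hx ((F.xHat_mmse t).sqMeasurable hx.fstBlock.2
        (fun r hr => (F.sqMeasurable_y_of_x (ih r hr)).1) fun r hr => (ih r hr).sndBlock.1)
        ⟨F.measurable_w t, F.memLp_w t⟩

theorem sqMeasurable_y (t : ℕ) : SqMeasurable mΩ μ (F.y t) :=
  F.sqMeasurable_y_of_x (F.sqMeasurable_x t)

theorem sqMeasurable_xTilde (t : ℕ) : SqMeasurable mΩ μ (F.xTilde t) :=
  (F.xTilde_mmse t).sqMeasurable (F.sqMeasurable_x t).fstBlock.2
    (fun r _ => (F.sqMeasurable_y r).1) fun r _ => (F.sqMeasurable_x r).sndBlock.1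

theorem sqMeasurable_xHat (t : ℕ) : SqMeasurable mΩ μ (F.xHat t) :=
  (F.xHat_mmse t).sqMeasurable (F.sqMeasurable_x t).fstBlock.2
    (fun r _ => (F.sqMeasurable_y r).1) fun r _ => (F.sqMeasurable_x r).sndBlock.1

/-- The measurements in `L²`. -/
def measurement (t : ℕ) : Fin n → Lp ℝ 2 μ := coordLp (F.sqMeasurable_y t).2

theorem measurement_eq (t : ℕ) : F.measurement t =
    comb S.C₁ (coordLp (F.sqMeasurable_x t).2 ∘ Sum.inl) + coordLp (F.memLp_e t) := by
  have h := memLp_fstBlock (F.sqMeasurable_x t).2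
  rw [measurement, coordLp_congr (F.sqMeasurable_y t).2
    ((memLp_toEuclideanLin S.C₁ h).add (F.memLp_e t)) (Eventually.of_forall (F.sensor t)),
    ← coordLp_fstBlock, ← coordLp_toEuclideanLin S.C₁ h]
  rfl

theorem measurement_mem_gaussianSpace {t : ℕ}
    (h : ∀ i, coordLp (F.sqMeasurable_x t).2 i ∈ F.gaussianSpace) (i) :
    F.measurement t i ∈ F.gaussianSpace := by
  rw [measurement_eq]
  exact Submodule.add_mem _ (comb_mem _ (fun j => h _) i) (F.coordLp_e_mem_gaussianSpace t _ i)

theorem crossMoment_e (s t : ℕ) : crossMoment μ (F.e s) (F.e t) = if s = t then 1 else 0 := by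
  split_ifs with h
  · subst h
    exact crossMoment_of_map_eq Matrix.PosSemidef.one (F.measurable_e s) (F.e_law s)
  · exact crossMoment_eq_zero_of_indepFun (F.e_iIndep.indepFun h)
      (F.measurable_e s).aestronglyMeasurable (F.measurable_e t).aestronglyMeasurable
      (mean_of_map_eq (F.measurable_e t) (F.e_law t))

theorem crossMoment_w_e (s t : ℕ) : crossMoment μ (F.w s) (F.e t) = 0 :=
  crossMoment_eq_zero_of_indepFun
    (F.w_indep_e.comp (measurable_pi_apply s) (measurable_pi_apply t))
    (F.measurable_w s).aestronglyMeasurable (F.measurable_e t).aestronglyMeasurable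
    (mean_of_map_eq (F.measurable_e t) (F.e_law t))

theorem crossMoment_x_e (t : ℕ) : crossMoment μ (F.x 0) (F.e t) = 0 :=
  crossMoment_eq_zero_of_indepFun
    (F.x_zero_indep.comp measurable_id ((measurable_pi_apply t).comp measurable_snd))
    F.measurable_x_zero.aestronglyMeasurable (F.measurable_e t).aestronglyMeasurable
    (mean_of_map_eq (F.measurable_e t) (F.e_law t))

variable [IsProbabilityMeasure μ]

/-- The span of the observations. -/
def obs (k l : ℕ) : Submodule ℝ (Lp ℝ 2 μ) :=
  obsSpan (oneLp μ) F.measurement (fun r => coordLp (F.sqMeasurable_x r).2 ∘ Sum.inr) k l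

/-- Gaussianity is assumed only up to `t`, so that the result can be used inside the induction that
establishes it for all times. -/
theorem xHat_mem_obs {t : ℕ} (h : ∀ s ≤ t, ∀ i, coordLp (F.sqMeasurable_x s).2 i ∈ F.gaussianSpace)
    (i : Fin n) : coordLp (F.sqMeasurable_xHat t).2 i ∈ F.obs (t + 1) (t + 1) ∧
      ∀ u ∈ F.obs (t + 1) (t + 1),
        ⟪coordLp (F.sqMeasurable_x t).2 (Sum.inl i) - coordLp (F.sqMeasurable_xHat t).2 i, u⟫ = 0 :=
  (F.xHat_mmse t).coordLp_mem_and_inner_eq_zero F.isGaussianProcess_gaussianSpace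
    F.oneLp_mem_gaussianSpace (memLp_fstBlock (F.sqMeasurable_x t).2) (F.sqMeasurable_xHat t).2
    (fun r => (F.sqMeasurable_y r).1) (fun r => (F.sqMeasurable_x r).sndBlock.1)
    (fun r => (F.sqMeasurable_y r).2) (fun r => memLp_sndBlock (F.sqMeasurable_x r).2) i
    (h t le_rfl _) (fun r hr => F.measurement_mem_gaussianSpace (h r (by omega)))
    fun r hr j => h r (by omega) _

theorem xTilde_mem_obs {t : ℕ}
    (h : ∀ s ≤ t, ∀ i, coordLp (F.sqMeasurable_x s).2 i ∈ F.gaussianSpace)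
    (i : Fin n) : coordLp (F.sqMeasurable_xTilde t).2 i ∈ F.obs t (t + 1) ∧
      ∀ u ∈ F.obs t (t + 1),
        ⟪coordLp (F.sqMeasurable_x t).2 (Sum.inl i) - coordLp (F.sqMeasurable_xTilde t).2 i, u⟫
          = 0 :=
  (F.xTilde_mmse t).coordLp_mem_and_inner_eq_zero F.isGaussianProcess_gaussianSpace
    F.oneLp_mem_gaussianSpace (memLp_fstBlock (F.sqMeasurable_x t).2) (F.sqMeasurable_xTilde t).2
    (fun r => (F.sqMeasurable_y r).1) (fun r => (F.sqMeasurable_x r).sndBlock.1)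
    (fun r => (F.sqMeasurable_y r).2) (fun r => memLp_sndBlock (F.sqMeasurable_x r).2) i
    (h t le_rfl _) (fun r hr => F.measurement_mem_gaussianSpace (h r (by omega)))
    fun r hr j => h r (by omega) _

/-- A conditional mean could be nonlinear in the data. Since the past is Gaussian, `xHat` is a
projection, and the feedback keeps the next state in the Gaussian subspace. -/
theorem coordLp_x_mem_gaussianSpace (t : ℕ) (i) :
    coordLp (F.sqMeasurable_x t).2 i ∈ F.gaussianSpace := by
  induction t using Nat.strong_induction_on generalizing i with
  | _ t ih =>
    cases t with
    | zero => exact F.coordLp_x_zero_mem_gaussianSpace _ i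
    | succ t =>
      have hle : F.obs (t + 1) (t + 1) ≤ F.gaussianSpace :=
        obsSpan_le.2 ⟨F.oneLp_mem_gaussianSpace,
          fun r hr => F.measurement_mem_gaussianSpace (ih r hr), fun r hr j => ih r hr _⟩
      have hH : ∀ i, coordLp (F.sqMeasurable_xHat t).2 i ∈ F.gaussianSpace := fun i =>
        hle (F.xHat_mem_obs (fun s hs => ih s (by omega)) i).1
      rw [F.coordLp_x_succ (F.sqMeasurable_x t).2 (F.sqMeasurable_xHat t).2]
      refine Submodule.add_mem _ (Submodule.add_mem _ (comb_mem _ (ih t t.lt_succ_self) i)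
        (comb_mem _ ?_ i)) (F.coordLp_w_mem_gaussianSpace t _ i)
      rintro (j | j)
      · exact hH j
      · exact ih t t.lt_succ_self _

/-- The Gaussian loop as a feedback loop in a Hilbert space. -/
def l2Loop (hW : S.W.PosSemidef) : L2Loop S (Lp ℝ 2 μ) :=
  F.toL2Loop hW (fun t => (F.sqMeasurable_x t).2) (fun t => (F.sqMeasurable_xTilde t).2)
    (fun t => (F.sqMeasurable_xHat t).2) F.memLp_e
    (fun t => mean_of_map_eq (F.measurable_e t) (F.e_law t)) F.crossMoment_x_e F.crossMoment_w_e
    F.crossMoment_e F.measurement_eq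
    (fun _ i => (F.xTilde_mem_obs (fun s _ => F.coordLp_x_mem_gaussianSpace s) i).1)
    (fun _ i => (F.xTilde_mem_obs (fun s _ => F.coordLp_x_mem_gaussianSpace s) i).2)
    (fun _ i => (F.xHat_mem_obs (fun s _ => F.coordLp_x_mem_gaussianSpace s) i).1)
    (fun _ i => (F.xHat_mem_obs (fun s _ => F.coordLp_x_mem_gaussianSpace s) i).2)

end GaussianLoop

/-! ### From Hilbert space back to moments -/

section Moments

open scoped RealInnerProductSpace

variable {n m p : ℕ} {S : Setup n m p} {Ω Ω' : Type*} {mΩ : MeasurableSpace Ω}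
  {mΩ' : MeasurableSpace Ω'} {μ : Measure Ω} {μ' : Measure Ω'}

theorem EquivUpToSecondMoments.of_coordLp [IsFiniteMeasure μ] [IsFiniteMeasure μ'] {ι : Type*}
    [Fintype ι] {ξ : ℕ → Ω → EuclideanSpace ℝ ι} {ξ' : ℕ → Ω' → EuclideanSpace ℝ ι}
    (h : ∀ t, MemLp (ξ t) 2 μ) (h' : ∀ t, MemLp (ξ' t) 2 μ')
    (hone : ∀ t i, ⟪oneLp μ, coordLp (h t) i⟫ = ⟪oneLp μ', coordLp (h' t) i⟫)
    (hinner : ∀ s t i j, ⟪coordLp (h s) i, coordLp (h t) j⟫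
      = ⟪coordLp (h' s) i, coordLp (h' t) j⟫) : EquivUpToSecondMoments μ μ' ξ ξ' := by
  refine ⟨h, h', fun t => ?_, fun s t => ?_⟩
  · ext i
    rw [← inner_oneLp_coordLp (h t), hone, inner_oneLp_coordLp]
  · ext i j
    rw [← inner_coordLp (h s) (h t), hinner, inner_coordLp]

theorem coordLp_joint (F : FeedbackLoop S μ) {t : ℕ} (hx : MemLp (F.x t) 2 μ)
    (hH : MemLp (F.xHat t) 2 μ) (hT : MemLp (F.xTilde t) 2 μ) :
    coordLp (memLp_stack hx (memLp_stack hH hT))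
      = Sum.elim (coordLp hx) (Sum.elim (coordLp hH) (coordLp hT)) := by
  rw [coordLp_stack hx (memLp_stack hH hT), coordLp_stack hH hT]

theorem equivUpToSecondMoments_joint [IsProbabilityMeasure μ] [IsProbabilityMeasure μ']
    (hW : S.W.PosSemidef) (NG : QuantizedLoop S μ) (G : GaussianLoop S μ')
    (h : SameMoments μ μ' (NG.x 0) (G.x 0)) : EquivUpToSecondMoments μ μ' NG.joint G.joint := by
  obtain ⟨h0, h0', hmean, hcross⟩ := h
  have hone : ∀ i, ⟪oneLp μ, coordLp h0 i⟫ = ⟪oneLp μ', coordLp h0' i⟫ := fun i => by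
    rw [inner_oneLp_coordLp, inner_oneLp_coordLp, hmean]
  have hx : ∀ i j, ⟪coordLp h0 i, coordLp h0 j⟫ = ⟪coordLp h0' i, coordLp h0' j⟫ := fun i j => by
    rw [inner_coordLp, inner_coordLp, hcross]
  have e : ∀ t, coordLp (memLp_stack (NG.memLp_x t) (memLp_stack (NG.memLp_xHat t)
      (NG.memLp_xTilde t))) = (NG.l2Loop hW).joint t := fun t =>
    coordLp_joint NG.toFeedbackLoop (NG.memLp_x t) (NG.memLp_xHat t) (NG.memLp_xTilde t)
  have e' : ∀ t, coordLp (memLp_stack (G.sqMeasurable_x t).2 (memLp_stack (G.sqMeasurable_xHat t).2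
      (G.sqMeasurable_xTilde t).2)) = (G.l2Loop hW).joint t := fun t =>
    coordLp_joint G.toFeedbackLoop (G.sqMeasurable_x t).2 (G.sqMeasurable_xHat t).2
      (G.sqMeasurable_xTilde t).2
  refine EquivUpToSecondMoments.of_coordLp (ξ := NG.joint) (ξ' := G.joint)
    (fun t => memLp_stack (NG.memLp_x t) (memLp_stack (NG.memLp_xHat t) (NG.memLp_xTilde t)))
    (fun t => memLp_stack (G.sqMeasurable_x t).2 (memLp_stack (G.sqMeasurable_xHat t).2
      (G.sqMeasurable_xTilde t).2)) (fun t i => ?_) (fun s t i j => ?_)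
  · refine (congrArg _ (congrFun (e t) i)).trans (Eq.trans ?_ (congrArg _ (congrFun (e' t) i)).symm)
    exact L2Loop.inner_one_joint_eq (ℒ := NG.l2Loop hW) (ℒ' := G.l2Loop hW) hone hx t i
  · refine (congrArg₂ _ (congrFun (e s) i) (congrFun (e t) j)).trans
      (Eq.trans ?_ (congrArg₂ _ (congrFun (e' s) i) (congrFun (e' t) j)).symm)
    exact L2Loop.inner_joint_eq (ℒ := NG.l2Loop hW) (ℒ' := G.l2Loop hW) hone hx s t i j

/-- The initial condition enters only through the first prediction error covariance, which the
Riccati limit does not remember. -/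
theorem tendsto_crossMoment_error (hW₂₂ : S.W₂₂.PosDef) {Phat : Matrix (Fin n) (Fin n) ℝ}
    (hP : ∀ P₀ : Matrix (Fin n) (Fin n) ℝ, P₀.PosSemidef →
      Tendsto (fun k => S.correct (S.predict^[k] P₀)) atTop (𝓝 Phat))
    (F : FeedbackLoop S μ) (hx : ∀ t, MemLp (F.x t) 2 μ) (hH : ∀ t, MemLp (F.xHat t) 2 μ)
    (ℒ : L2Loop S (Lp ℝ 2 μ)) (hℒx : ∀ t, ℒ.x t = coordLp (hx t))
    (hℒH : ∀ t, ℒ.xHat t = coordLp (hH t)) :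
    (∀ t, MemLp (F.error t) 2 μ) ∧
      Tendsto (fun t => crossMoment μ (F.error t) (F.error t)) atTop (𝓝 Phat) := by
  have herr : ∀ t, MemLp (F.error t) 2 μ := fun t => (memLp_fstBlock (hx t)).sub (hH t)
  refine ⟨herr, ?_⟩
  have h : ∀ t, crossMoment μ (F.error t) (F.error t)
      = S.correct (S.predict^[t] (innerMatrix (ℒ.predErr 0) (ℒ.predErr 0))) := fun t => by
    rw [← ℒ.innerMatrix_estErr_eq_iterate hW₂₂, L2Loop.estErr, hℒx, hℒH]
    ext i j
    exact (inner_coordLp (herr t) (herr t) i j).symm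
  simp only [h]
  exact hP _ (innerMatrix_self_posSemidef _)

end Moments

end LQGSideInfo

end

/-! ### The main theorem -/

theorem lemma1 {n m p : ℕ} (S : LQGSideInfo.Setup n m p)
    (hW₁₁ : S.W₁₁.PosDef) (hW₂₂ : S.W₂₂.PosDef)
    (hdet : LQGSideInfo.IsDetectable (Matrix.fromRows S.C₁ S.A.toBlocks₂₁) S.A.toBlocks₁₁) :
    (∀ (Ω : Type*) (_ : MeasurableSpace Ω) (μ : Measure Ω) (_ : IsProbabilityMeasure μ)
        (Ω' : Type*) (_ : MeasurableSpace Ω') (μ' : Measure Ω') (_ : IsProbabilityMeasure μ')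
        (NG : LQGSideInfo.QuantizedLoop S μ) (G : LQGSideInfo.GaussianLoop S μ'),
        LQGSideInfo.SameMoments μ μ' (NG.x 0) (G.x 0) →
        LQGSideInfo.EquivUpToSecondMoments μ μ' NG.joint G.joint) ∧
    ∃ Phat Ptilde : Matrix (Fin n) (Fin n) ℝ,
      LQGSideInfo.IsSteadyState S Phat Ptilde ∧
      (∀ Phat' Ptilde', LQGSideInfo.IsSteadyState S Phat' Ptilde' →
        Phat' = Phat ∧ Ptilde' = Ptilde) ∧
      (∀ (Ω : Type*) (_ : MeasurableSpace Ω) (μ : Measure Ω) (_ : IsProbabilityMeasure μ)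
        (G : LQGSideInfo.GaussianLoop S μ),
        (∀ t, MemLp (G.error t) 2 μ) ∧
        Tendsto (fun t => LQGSideInfo.crossMoment μ (G.error t) (G.error t)) atTop (𝓝 Phat)) ∧
      ∀ (Ω : Type*) (_ : MeasurableSpace Ω) (μ : Measure Ω) (_ : IsProbabilityMeasure μ)
        (NG : LQGSideInfo.QuantizedLoop S μ),
        (∀ t, MemLp (NG.error t) 2 μ) ∧
        Tendsto (fun t => LQGSideInfo.crossMoment μ (NG.error t) (NG.error t)) atTop
          (𝓝 Phat) := by
  have hW : S.W.PosSemidef := (LQGSideInfo.posDef_fromBlocks_zero hW₁₁ hW₂₂).posSemidef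
  obtain ⟨Phat, Ptilde, hss, huniq, hlim⟩ := LQGSideInfo.exists_steadyState hW₁₁ hW₂₂ hdet
  refine ⟨fun Ω _ μ _ Ω' _ μ' _ NG G h => LQGSideInfo.equivUpToSecondMoments_joint hW NG G h,
    Phat, Ptilde, hss, huniq, fun Ω _ μ _ G => ?_, fun Ω _ μ _ NG => ?_⟩
  · exact LQGSideInfo.tendsto_crossMoment_error hW₂₂ hlim G.toFeedbackLoop
      (fun t => (G.sqMeasurable_x t).2) (fun t => (G.sqMeasurable_xHat t).2) (G.l2Loop hW)
      (fun _ => rfl) fun _ => rfl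
  · exact LQGSideInfo.tendsto_crossMoment_error hW₂₂ hlim NG.toFeedbackLoop
      NG.memLp_x NG.memLp_xHat (NG.l2Loop hW) (fun _ => rfl) fun _ => rfl
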